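/- Let $(r,\theta,z)$ be cylindrical coordinates on $\mathbb R^3$ and $\partial_\theta = x\,e_y-y\,e_x$. There is a constant $C>0$ such that for every integer $m\ge 4$ there is a function $T_0:\mathbb R\to(0,\infty)$, $N\mapsto T_0(N)$, with the following property. Let ${\bf \Pi}_0\in H^m(\mathbb R^3;\mathbb R^3)$ be a vector field of the form ${\bf \Pi}_0=\Pi_0(r,z)\,\partial_\theta$, and put $T_0=T_0(\|{\bf \Pi}_0\|_{H^m})$. Then there is a unique ${\bf \Pi}\in C([0,T_0];H^m(\mathbb R^3;\mathbb R^3))$ of the form ${\bf \Pi}(t)=\Pi(t,r,z)\,\partial_\theta$ with ${\bf \Pi}(0)={\bf \Pi}_0$ that solves the axisymmetric E-MHD equation $$\partial_t\Pi-2\,\Pi\,\partial_z\Pi=0,$$ in the sense that (after modification on null sets in space) $\Pi$ is continuously differentiable on $[0,T_0]\times(0,\infty)\times\mathbb R$ and satisfies the equation pointwise there. Moreover $$\sup_{t\in[0,T_0]}\|{\bf \Pi}(t)\|_{H^m}\le C\,\|{\bf \Pi}_0\|_{H^m}.$$ Here $\|{\bf u}\|_{H^m}^2=\sum_{n\le m}\|\nabla^n{\bf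 u}\|_{L^2}^2$. -/

import Mathlib

open MeasureTheory Set
open scoped ContDiff

noncomputable section

namespace AxisymEMHD

/-- Euclidean three-space, used both for points `(x, y, z)` and for vectors. -/
abbrev E3 : Type := EuclideanSpace ℝ (Fin 3)

/-- The space `L²(ℝ³; ℝ³)`. -/
abbrev L2 : Type := Lp E3 2 (volume : Measure E3)

/-- The partial derivative `∂_{w 0} ⋯ ∂_{w (n-1)} φ` of a smooth function `φ : ℝ³ → ℝ`. -/
def partialDeriv {n : ℕ} (w : Fin n → Fin 3) (φ : E3 → ℝ) (x : E3) : ℝ :=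
  iteratedFDeriv ℝ n φ x (fun i => EuclideanSpace.single (w i) (1 : ℝ))

/-- `g` is the weak derivative `∂_{w 0} ⋯ ∂_{w (n-1)} f` of the vector field `f` on `ℝ³`. -/
def IsWeakDeriv {n : ℕ} (w : Fin n → Fin 3) (f g : E3 → E3) : Prop :=
  ∀ φ : E3 → ℝ, ContDiff ℝ ∞ φ → HasCompactSupport φ →
    ∫ x, partialDeriv w φ x • f x = (-1 : ℝ) ^ n • ∫ x, φ x • g x

theorem continuous_partialDeriv {n : ℕ} (w : Fin n → Fin 3) {φ : E3 → ℝ}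
    (h : ContDiff ℝ ∞ φ) : Continuous (partialDeriv w φ) := by
  have h1 : Continuous (iteratedFDeriv ℝ n φ) :=
    h.continuous_iteratedFDeriv (by exact_mod_cast le_top)
  unfold partialDeriv
  fun_prop

theorem hasCompactSupport_partialDeriv {n : ℕ} (w : Fin n → Fin 3) {φ : E3 → ℝ}
    (h : HasCompactSupport φ) : HasCompactSupport (partialDeriv w φ) :=
  HasCompactSupport.comp_left (h.iteratedFDeriv (𝕜 := ℝ) n)
    (g := fun S : E3 [×n]→L[ℝ] ℝ => S (fun i => EuclideanSpace.single (w i) (1 : ℝ))) rfl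

theorem integrable_smul_L2 {ψ : E3 → ℝ} (hc : Continuous ψ) (hs : HasCompactSupport ψ)
    (f : L2) : Integrable (fun x => ψ x • f x) volume :=
  memLp_one_iff_integrable.mp
    (MemLp.smul (p := 2) (q := 2) (r := 1) (Lp.memLp f) (hc.memLp_of_hasCompactSupport hs))

theorem integral_smul_add {ψ : E3 → ℝ} (hc : Continuous ψ) (hs : HasCompactSupport ψ)
    (f g : L2) : ∫ x, ψ x • (f + g : L2) x = (∫ x, ψ x • f x) + ∫ x, ψ x • g x := by
  rw [← integral_add (integrable_smul_L2 hc hs f) (integrable_smul_L2 hc hs g)]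
  refine integral_congr_ae ?_
  filter_upwards [Lp.coeFn_add f g] with x hx
  rw [hx, Pi.add_apply, smul_add]

theorem integral_smul_smul (ψ : E3 → ℝ) (c : ℝ) (f : L2) :
    ∫ x, ψ x • (c • f : L2) x = c • ∫ x, ψ x • f x := by
  rw [← integral_smul]
  refine integral_congr_ae ?_
  filter_upwards [Lp.coeFn_smul c f] with x hx
  rw [hx, Pi.smul_apply, smul_comm]

/-- Indices of the partial derivatives of order at most `m`: an order `n ≤ m` together with a
word of length `n` in the three coordinate directions. -/
abbrev DerivIndex (m : ℕ) : Type := Σ n : Fin (m + 1), (Fin (n : ℕ) → Fin 3)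

/-- The index of the zeroth derivative, that is, of the field itself. -/
def idIndex (m : ℕ) : DerivIndex m := ⟨0, fun i => i.elim0⟩

/-- The Sobolev space `H^m(ℝ³; ℝ³)`: a field in `L²` whose weak derivatives up to order `m` lie
in `L²`, recorded together with these (uniquely determined) derivatives. The norm inherited from
the ambient `ℓ²`-product is `‖u‖² = ∑_{n ≤ m} ‖∇ⁿ u‖²_{L²}`. -/
def SobolevH (m : ℕ) : Submodule ℝ (PiLp 2 (fun _ : DerivIndex m => L2)) where
  carrier := {U | ∀ a : DerivIndex m, IsWeakDeriv a.2 (U (idIndex m)) (U a)}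
  zero_mem' := by
    intro a φ hφ hs
    have h0 : ∀ ψ : E3 → ℝ, ∫ x, ψ x • (0 : L2) x = 0 := fun ψ => by
      simpa only [zero_smul] using integral_smul_smul ψ 0 0
    simp only [PiLp.zero_apply, h0, smul_zero]
  add_mem' := by
    intro U V hU hV a φ hφ hs
    have h1 := continuous_partialDeriv a.2 hφ
    have h2 := hasCompactSupport_partialDeriv a.2 hs
    simp only [PiLp.add_apply]
    rw [integral_smul_add h1 h2, integral_smul_add hφ.continuous hs, hU a φ hφ hs,
      hV a φ hφ hs, smul_add]
  smul_mem' := by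
    intro c U hU a φ hφ hs
    simp only [PiLp.smul_apply]
    rw [integral_smul_smul, integral_smul_smul, hU a φ hφ hs, smul_comm]

/-- The vector field (defined up to null sets) underlying an element of `H^m`. -/
def field {m : ℕ} (u : SobolevH m) : E3 → E3 := (u : PiLp 2 (fun _ => L2)) (idIndex m)

/-- The distance `r = √(x² + y²)` to the `z`-axis. -/
def cylRadius (x : E3) : ℝ := Real.sqrt (x 0 ^ 2 + x 1 ^ 2)

/-- The coordinate vector field `∂_θ = x e_y - y e_x`. -/
def dTheta (x : E3) : E3 := !₂[-x 1, x 0, 0]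

/-- `u = P(r, z) ∂_θ` as an element of `H^m`. -/
def HasCoeff {m : ℕ} (u : SobolevH m) (P : ℝ → ℝ → ℝ) : Prop :=
  field u =ᵐ[volume] fun x => P (cylRadius x) (x 2) • dTheta x

/-- `u` is a solution in `C([0, T]; H^m)` of `∂_t Π - 2 Π ∂_z Π = 0`, in the sense that
`u(t) = Π(t, r, z) ∂_θ` with a continuously differentiable `Π` on `[0, T] × (0, ∞) × ℝ` which
satisfies the equation pointwise (one-sided time derivatives at `t = 0` and `t = T`). -/
structure IsSolution {m : ℕ} (T : ℝ) (u : ℝ → SobolevH m) : Prop where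
  continuousOn : ContinuousOn u (Icc 0 T)
  equation : ∃ P : ℝ → ℝ → ℝ → ℝ,
    (∀ t ∈ Icc 0 T, HasCoeff (u t) (P t)) ∧
    ContDiffOn ℝ 1 (fun p : ℝ × ℝ × ℝ => P p.1 p.2.1 p.2.2) (Icc 0 T ×ˢ Ioi 0 ×ˢ univ) ∧
    ∀ t ∈ Icc 0 T, ∀ r > 0, ∀ z : ℝ,
      derivWithin (fun s => P s r z) (Icc 0 T) t - 2 * P t r z * deriv (fun ζ => P t r ζ) z = 0

end AxisymEMHD

end

/-! The coefficient solves Burgers' equation `∂_t Π = 2 Π ∂_z Π`, so it is constant on the lines `t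
↦ x - 2 t a(x) e_z`, where `a` is the initial coefficient. While `4 |t| sup |∂_z a| < 1` these lines
do not cross, and `burgers a t` is the unique root `s` of `s = a(y + 2 t s e_z)`. Since `∂_θ` does
not depend on `z`, the field `v` is transported by the same shear as its coefficient, which makes
the problem one about composition with a shear.

The main difficulty is the `H^m` estimate. By the chain rule `D_shear`, each derivative satisfies
`D^w v ∘ shear = D^w (a ∂_θ) + t H`, where `H` is polynomial in the derivatives of `a` and in `1 /
jac` (`exists_W_transport`). No term of `H` carries too many derivatives: every factor is
differentiated at least once, and the grade "derivatives minus factors" rises by one with each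
differentiation. A curl identity of Hardy type (`eLpNorm_coeff_le`) bounds `a` in `L²` with one
derivative less than the field; with the weight `r` no derivative is lost. The embedding of `H²` in
`L^∞` and an `L⁴` interpolation then give a family of bounds indexed by the grade (`Bd`), which is
stable under products once `m ≥ 4`. Hence `H` is Lipschitz in `a` from `H^m` to `L²` (`W.bound`).
The factor `t` makes the remainder small for short times, and the change of variables costs a
bounded factor, so the final constant 3 is independent of `m`.

Continuity in time and passage to the limit use a comparison with a fixed test coefficient `c`. The
Lagrangian expression of `a` is replaced by that of `c` along the same characteristics, with error
proportional to `‖a - c‖` in `H^m`; the expression of `c` is continuous with compact support, so it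
varies little in `L²` when the characteristics are perturbed (`exists_delta_Dw`). Along
approximating test data the transported fields are therefore uniformly Cauchy in `C([0,T]; H^m)`.
The approximations are obtained by radial mollification, which respects the reflections
characterizing multiples of `∂_θ`, followed by smooth division by `∂_θ` and a cutoff
(`exists_test_near`). The coefficients converge in `C¹`, so the limit is `burgers a₀ t` with `a₀` of
class `C¹`, a classical solution.

Uniqueness holds because any classical solution is constant on the lines issued from its initial
data, by Gronwall's inequality (`eq_along_characteristic`). -/

open MeasureTheory Set
open scoped ContDiff

noncomputable section

namespace AxisymEMHD

/-! ### Iterated partial derivatives and test functions -/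

section

variable {V : Type*} [NormedAddCommGroup V] [NormedSpace ℝ V]

/-- The standard basis vectors of three-space. -/
abbrev e (j : Fin 3) : E3 := EuclideanSpace.single j (1 : ℝ)

/-- The partial derivative in the direction `j`. -/
def D (j : Fin 3) (f : E3 → V) : E3 → V := fun x => fderiv ℝ f x (e j)

/-- The iterated partial derivative along a list of directions. -/
def Dw : List (Fin 3) → (E3 → V) → E3 → V
  | [], f => f
  | j :: w, f => D j (Dw w f)

@[simp] theorem Dw_nil (f : E3 → V) : Dw [] f = f := rfl
@[simp] theorem Dw_cons (j : Fin 3) (w : List (Fin 3)) (f : E3 → V) :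
    Dw (j :: w) f = D j (Dw w f) := rfl

theorem contDiff_D {f : E3 → V} (h : ContDiff ℝ ∞ f) (j : Fin 3) : ContDiff ℝ ∞ (D j f) := by
  have h1 : ContDiff ℝ ∞ (fderiv ℝ f) := h.fderiv_right (by simp)
  exact h1.clm_apply contDiff_const

theorem contDiff_Dw {f : E3 → V} (h : ContDiff ℝ ∞ f) : ∀ w, ContDiff ℝ ∞ (Dw w f)
  | [] => h
  | j :: w => contDiff_D (contDiff_Dw h w) j

theorem diff_of_smooth {f : E3 → V} (h : ContDiff ℝ ∞ f) : Differentiable ℝ f :=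
  h.differentiable (by simp)

theorem support_D_subset (j : Fin 3) (f : E3 → V) : tsupport (D j f) ⊆ tsupport f := by
  refine closure_minimal (fun x hx => ?_) isClosed_closure
  have : fderiv ℝ f x ≠ 0 := fun h => hx (by simp [D, h])
  exact support_fderiv_subset ℝ this

theorem tsupport_Dw_subset (f : E3 → V) : ∀ w, tsupport (Dw w f) ⊆ tsupport f
  | [] => subset_rfl
  | j :: w => (support_D_subset j _).trans (tsupport_Dw_subset f w)

theorem _root_.HasCompactSupport.D {f : E3 → V} (h : HasCompactSupport f) (j : Fin 3) :
    HasCompactSupport (D j f) :=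
  h.mono' ((subset_tsupport _).trans (support_D_subset j f))

/-- Smooth compactly supported functions. -/
structure Test (f : E3 → V) : Prop where
  smooth : ContDiff ℝ ∞ f
  supp : HasCompactSupport f

namespace Test
variable {f g : E3 → V}

theorem cont (h : Test f) : Continuous f := h.smooth.continuous
theorem diff (h : Test f) : Differentiable ℝ f := diff_of_smooth h.smooth
theorem D (h : Test f) (j : Fin 3) : Test (D j f) :=
  ⟨contDiff_D h.smooth j, h.supp.D j⟩
theorem Dw (h : Test f) : ∀ w, Test (Dw w f)
  | [] => h
  | j :: w => (Dw h w).D j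
theorem add (h : Test f) (h' : Test g) : Test (f + g) :=
  ⟨h.smooth.add h'.smooth, h.supp.add h'.supp⟩
theorem neg (h : Test f) : Test (-f) :=
  ⟨h.smooth.neg, h.supp.mono (by simp)⟩
theorem sub (h : Test f) (h' : Test g) : Test (f - g) := by
  rw [sub_eq_add_neg]; exact h.add h'.neg
theorem zero : Test (0 : E3 → V) := ⟨contDiff_const, HasCompactSupport.zero⟩
theorem smul_left {c : E3 → ℝ} (hc : ContDiff ℝ ∞ c) (h : Test f) : Test (fun x => c x • f x) :=
  ⟨hc.smul h.smooth, h.supp.smul_left⟩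
theorem smul_right {c : E3 → ℝ} (hc : Test c) (h : ContDiff ℝ ∞ f) : Test (fun x => c x • f x) :=
  ⟨hc.smooth.smul h, hc.supp.smul_right⟩
theorem integrable (h : Test f) : Integrable f := h.cont.integrable_of_hasCompactSupport h.supp
theorem memLp (h : Test f) (p : ENNReal) : MemLp f p := h.cont.memLp_of_hasCompactSupport h.supp

end Test

theorem D_add {f g : E3 → V} (hf : Differentiable ℝ f) (hg : Differentiable ℝ g) (j : Fin 3) :
    D j (f + g) = D j f + D j g := by
  ext1 x; simp [D, fderiv_add (hf x) (hg x)]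

theorem D_sub {f g : E3 → V} (hf : Differentiable ℝ f) (hg : Differentiable ℝ g) (j : Fin 3) :
    D j (f - g) = D j f - D j g := by
  ext1 x; simp [D, fderiv_sub (hf x) (hg x)]

@[simp] theorem D_const (c : V) (j : Fin 3) : D j (fun _ => c) = 0 := by
  ext1 x; simp [D]

@[simp] theorem D_zero (j : Fin 3) : D j (0 : E3 → V) = 0 := D_const 0 j

@[simp] theorem Dw_zero : ∀ w, Dw w (0 : E3 → V) = 0
  | [] => rfl
  | j :: w => by simp [Dw_zero w]

theorem D_smul {c : E3 → ℝ} {f : E3 → V} (hc : Differentiable ℝ c) (hf : Differentiable ℝ f)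
    (j : Fin 3) : D j (fun x => c x • f x) = fun x => c x • D j f x + D j c x • f x := by
  ext1 x
  simp [D, fderiv_fun_smul (hc x) (hf x)]

theorem D_const_smul (c : ℝ) {f : E3 → V} (hf : Differentiable ℝ f) (j : Fin 3) :
    D j (fun x => c • f x) = fun x => c • D j f x := by
  ext1 x
  simp [D, fderiv_fun_const_smul (hf x)]

theorem Dw_add {f g : E3 → V} (hf : ContDiff ℝ ∞ f) (hg : ContDiff ℝ ∞ g) :
    ∀ w, Dw w (f + g) = Dw w f + Dw w g
  | [] => rfl
  | j :: w => by
    rw [Dw_cons, Dw_add hf hg w, D_add (diff_of_smooth (contDiff_Dw hf w))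
      (diff_of_smooth (contDiff_Dw hg w))]; rfl

theorem Dw_sub {f g : E3 → V} (hf : ContDiff ℝ ∞ f) (hg : ContDiff ℝ ∞ g) :
    ∀ w, Dw w (f - g) = Dw w f - Dw w g
  | [] => rfl
  | j :: w => by
    rw [Dw_cons, Dw_sub hf hg w, D_sub (diff_of_smooth (contDiff_Dw hf w))
      (diff_of_smooth (contDiff_Dw hg w))]; rfl

theorem Dw_const_smul (c : ℝ) {f : E3 → V} (hf : ContDiff ℝ ∞ f) :
    ∀ w, Dw w (fun x => c • f x) = fun x => c • Dw w f x
  | [] => rfl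
  | j :: w => by
    rw [Dw_cons, Dw_const_smul c hf w, D_const_smul c (diff_of_smooth (contDiff_Dw hf w))]; rfl

theorem D_comm {f : E3 → V} (hf : ContDiff ℝ ∞ f) (i j : Fin 3) : D i (D j f) = D j (D i f) := by
  ext1 x
  have hd : Differentiable ℝ (fderiv ℝ f) :=
    (hf.fderiv_right (m := ∞) (by simp)).differentiable (by simp)
  have h1 : ∀ i j : Fin 3, D i (D j f) x = fderiv ℝ (fderiv ℝ f) x (e i) (e j) := fun i j => by
    rw [D, show D j f = fun y => fderiv ℝ f y (e j) from rfl,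
      fderiv_clm_apply (hd x) (differentiableAt_const _)]
    simp
  rw [h1, h1]
  exact ((contDiff_infty.1 hf 2).contDiffAt.isSymmSndFDerivAt (by simp)) _ _

theorem Dw_D {f : E3 → V} (hf : ContDiff ℝ ∞ f) (j : Fin 3) : ∀ w, Dw w (D j f) = D j (Dw w f)
  | [] => rfl
  | i :: w => by rw [Dw_cons, Dw_D hf j w, D_comm (contDiff_Dw hf w)]; rfl

theorem Dw_append (f : E3 → V) (v : List (Fin 3)) : ∀ w, Dw (w ++ v) f = Dw w (Dw v f)
  | [] => rfl
  | j :: w => by rw [List.cons_append, Dw_cons, Dw_append f v w]; rfl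

theorem D_clm {V' : Type*} [NormedAddCommGroup V'] [NormedSpace ℝ V'] (T : V →L[ℝ] V')
    {f : E3 → V} (hf : Differentiable ℝ f) (j : Fin 3) :
    D j (fun x => T (f x)) = fun x => T (D j f x) := by
  ext1 x
  have := (T.hasFDerivAt.comp x (hf x).hasFDerivAt).fderiv
  simp only [D]
  rw [show (fun x => T (f x)) = T ∘ f from rfl, this]; rfl

theorem Dw_clm {V' : Type*} [NormedAddCommGroup V'] [NormedSpace ℝ V'] (T : V →L[ℝ] V')
    {f : E3 → V} (hf : ContDiff ℝ ∞ f) : ∀ w, Dw w (fun x => T (f x)) = fun x => T (Dw w f x)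
  | [] => rfl
  | j :: w => by rw [Dw_cons, Dw_clm T hf w, D_clm T (diff_of_smooth (contDiff_Dw hf w))]; rfl

theorem integral_smul_D {φ : E3 → ℝ} {f : E3 → V} (hφ : ContDiff ℝ ∞ φ) (hf : ContDiff ℝ ∞ f)
    (h : HasCompactSupport φ ∨ HasCompactSupport f) (j : Fin 3) :
    ∫ x, φ x • D j f x = - ∫ x, D j φ x • f x := by
  have hi : ∀ {p : E3 → ℝ} {q : E3 → V}, Continuous p → Continuous q →
      (HasCompactSupport p ∨ HasCompactSupport q) → Integrable fun x => p x • q x := by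
    intro p q hp hq hc
    refine (hp.smul hq).integrable_of_hasCompactSupport ?_
    rcases hc with hc | hc
    · exact hc.smul_right
    · exact hc.smul_left
  refine integral_smul_fderiv_eq_neg_fderiv_smul_of_integrable (𝕜 := ℝ) ?_ ?_ ?_ ?_ ?_
  · exact hi (contDiff_D hφ j).continuous hf.continuous (h.imp_left (·.D j))
  · exact hi hφ.continuous (contDiff_D hf j).continuous (h.imp_right (·.D j))
  · exact hi hφ.continuous hf.continuous h
  · exact fun x _ => diff_of_smooth hφ x
  · exact fun x _ => diff_of_smooth hf x

/-- Bridge between the multilinear derivatives in the definition of weak derivatives and the words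
of directions on which all inductions run. -/
theorem partialDeriv_eq {φ : E3 → ℝ} (hφ : ContDiff ℝ ∞ φ) : ∀ {n : ℕ} (w : Fin n → Fin 3),
    partialDeriv w φ = Dw (List.ofFn w) φ
  | 0, w => by ext x; simp [partialDeriv]
  | n + 1, w => by
    rw [List.ofFn_succ, Dw_cons, ← partialDeriv_eq hφ (fun i => w i.succ)]
    ext x
    simp only [partialDeriv, D]
    rw [iteratedFDeriv_succ_apply_left]
    have hd : DifferentiableAt ℝ (iteratedFDeriv ℝ n φ) x :=
      (hφ.differentiable_iteratedFDeriv (by exact_mod_cast ENat.natCast_lt_top n)) x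
    have := ((ContinuousMultilinearMap.apply ℝ (fun _ : Fin n => E3) ℝ
      (fun i => e (w i.succ))).hasFDerivAt.comp x hd.hasFDerivAt).fderiv
    simp only [Function.comp_def, ContinuousMultilinearMap.apply_apply] at this
    rw [show partialDeriv (fun i => w i.succ) φ =
      fun x => iteratedFDeriv ℝ n φ x fun i => e (w i.succ) from rfl, this]
    simp [Fin.tail_def]

end

/-! ### Test fields in `H^m`; completeness of `H^m` -/

section

open Filter Topology

theorem integral_Dw_smul {φ : E3 → ℝ} {f : E3 → E3} (hφ : Test φ) (hf : ContDiff ℝ ∞ f) :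
    ∀ w : List (Fin 3), ∫ x, Dw w φ x • f x = (-1 : ℝ) ^ w.length • ∫ x, φ x • Dw w f x := by
  intro w
  induction w generalizing f with
  | nil => simp
  | cons j w ih =>
    have h1 := integral_smul_D (hφ.Dw w).smooth hf (Or.inl (hφ.Dw w).supp) j
    rw [ih (contDiff_D hf j), Dw_D hf] at h1
    rw [List.length_cons, pow_succ, Dw_cons, Dw_cons, mul_neg_one, neg_smul, h1, neg_neg]

theorem isWeakDeriv_of_smooth {n : ℕ} (w : Fin n → Fin 3) {f g g' : E3 → E3}
    (hf : ContDiff ℝ ∞ f) (hg : g =ᵐ[volume] f) (hg' : g' =ᵐ[volume] Dw (List.ofFn w) f) :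
    IsWeakDeriv w g g' := by
  intro φ hφ hs
  have h1 : ∫ x, partialDeriv w φ x • g x = ∫ x, Dw (List.ofFn w) φ x • f x := by
    rw [partialDeriv_eq hφ]
    exact integral_congr_ae (hg.mono fun x hx => by simp only [hx])
  have h2 : ∫ x, φ x • g' x = ∫ x, φ x • Dw (List.ofFn w) f x :=
    integral_congr_ae (hg'.mono fun x hx => by simp only [hx])
  rw [h1, h2, integral_Dw_smul ⟨hφ, hs⟩ hf, List.length_ofFn]

/-- The element of `H^m` given by a test field. -/
def toSob (m : ℕ) {f : E3 → E3} (hf : Test f) : SobolevH m :=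
  ⟨WithLp.toLp 2 fun a => ((hf.Dw (List.ofFn a.2)).memLp 2).toLp _, fun a => by
    refine isWeakDeriv_of_smooth a.2 hf.smooth ?_
      (MemLp.coeFn_toLp ((hf.Dw (List.ofFn a.2)).memLp 2))
    refine (MemLp.coeFn_toLp ((hf.Dw (List.ofFn (idIndex m).2)).memLp 2)).trans ?_
    exact Eventually.of_forall fun x => by simp [idIndex]⟩

theorem toSob_apply {m : ℕ} {f : E3 → E3} (hf : Test f) (a : DerivIndex m) :
    (toSob m hf : PiLp 2 fun _ : DerivIndex m => L2) a
      = ((hf.Dw (List.ofFn a.2)).memLp 2).toLp _ := rfl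

theorem field_toSob {m : ℕ} {f : E3 → E3} (hf : Test f) : field (toSob m hf) =ᵐ[volume] f := by
  refine (MemLp.coeFn_toLp ((hf.Dw (List.ofFn (idIndex m).2)).memLp 2)).trans ?_
  exact Eventually.of_forall fun x => by simp [idIndex]

theorem toSob_sub {m : ℕ} {f g : E3 → E3} (hf : Test f) (hg : Test g) :
    toSob m (hf.sub hg) = toSob m hf - toSob m hg := by
  ext1
  ext1 a
  rw [Submodule.coe_sub, PiLp.sub_apply, toSob_apply, toSob_apply, toSob_apply, ← MemLp.toLp_sub]
  exact MemLp.toLp_congr _ _ (by rw [Dw_sub hf.smooth hg.smooth])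

/-- The index of a list of at most `m` directions. -/
def indexOf {m : ℕ} (w : List (Fin 3)) (h : w.length ≤ m) : DerivIndex m :=
  ⟨⟨w.length, Nat.lt_succ_of_le h⟩, w.get⟩

theorem length_le_of_index {m : ℕ} (a : DerivIndex m) : (List.ofFn a.2).length ≤ m := by
  rw [List.length_ofFn]; exact Nat.le_of_lt_succ a.1.2

theorem norm_apply_le {m : ℕ} (U : SobolevH m) (a : DerivIndex m) :
    ‖(U : PiLp 2 fun _ : DerivIndex m => L2) a‖ ≤ ‖U‖ := PiLp.norm_apply_le _ a

theorem norm_sq_eq {m : ℕ} (U : SobolevH m) :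
    ‖U‖ ^ 2 = ∑ a, ‖(U : PiLp 2 fun _ : DerivIndex m => L2) a‖ ^ 2 := by
  rw [← PiLp.norm_sq_eq_of_L2]; rfl

theorem norm_le_sum {m : ℕ} (U : SobolevH m) :
    ‖U‖ ≤ ∑ a, ‖(U : PiLp 2 fun _ : DerivIndex m => L2) a‖ := by
  refine le_of_sq_le_sq ?_ (Finset.sum_nonneg fun _ _ => norm_nonneg _)
  rw [norm_sq_eq]
  exact Finset.sum_sq_le_sq_sum_of_nonneg fun _ _ => norm_nonneg _

theorem eLpNorm_Dw_le {m : ℕ} {f : E3 → E3} (hf : Test f) (w : List (Fin 3)) (h : w.length ≤ m) :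
    eLpNorm (Dw w f) 2 volume ≤ ENNReal.ofReal ‖toSob m hf‖ := by
  have h1 := norm_apply_le (toSob m hf) (indexOf w h)
  rw [toSob_apply, Lp.norm_toLp] at h1
  have h2 : List.ofFn (indexOf w h).2 = w := List.ofFn_get w
  rw [h2] at h1
  exact (ENNReal.le_ofReal_iff_toReal_le ((hf.Dw w).memLp 2).eLpNorm_ne_top (norm_nonneg _)).2 h1

theorem norm_toSob_apply {m : ℕ} {f : E3 → E3} (hf : Test f) (a : DerivIndex m) :
    ‖(toSob m hf : PiLp 2 fun _ : DerivIndex m => L2) a‖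
      = (eLpNorm (Dw (List.ofFn a.2) f) 2 volume).toReal := by
  rw [toSob_apply, Lp.norm_toLp]

theorem norm_integral_smul_le {φ : E3 → ℝ} (hφ : MemLp φ 2 (volume : Measure E3)) (f : L2) :
    ‖∫ x, φ x • f x‖ ≤ (eLpNorm φ 2 volume).toReal * ‖f‖ := by
  have h1 : eLpNorm (fun x => φ x • f x) 1 volume ≤ eLpNorm φ 2 volume * eLpNorm f 2 volume :=
    eLpNorm_smul_le_mul_eLpNorm (p := 2) (q := 2) (r := 1) (f := (f : E3 → E3)) (φ := φ)
      (Lp.aestronglyMeasurable f) hφ.1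
  have h2 : ‖∫ x, φ x • f x‖ₑ ≤ eLpNorm φ 2 volume * eLpNorm f 2 volume := by
    refine le_trans ?_ h1
    rw [eLpNorm_one_eq_lintegral_enorm]
    exact enorm_integral_le_lintegral_enorm _
  rw [Lp.norm_def, ← ENNReal.toReal_mul, ← toReal_enorm]
  exact ENNReal.toReal_mono (ENNReal.mul_ne_top hφ.eLpNorm_ne_top (Lp.eLpNorm_ne_top f)) h2

theorem continuous_integral_smul {φ : E3 → ℝ} (hc : Continuous φ) (hs : HasCompactSupport φ) :
    Continuous fun f : L2 => ∫ x, φ x • f x :=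
  AddMonoidHomClass.continuous_of_bound (AddMonoidHom.mk' (fun f : L2 => ∫ x, φ x • f x)
    (integral_smul_add hc hs)) _ (norm_integral_smul_le (hc.memLp_of_hasCompactSupport hs))

/-- For a fixed test function the defining identity equates two continuous functions on the ambient
product, by Cauchy–Schwarz. Closedness makes `H^m` complete, so that limits of approximate solutions
exist. -/
theorem isClosed_sobolevH (m : ℕ) :
    IsClosed (SobolevH m : Set (PiLp 2 fun _ : DerivIndex m => L2)) := by
  have : (SobolevH m : Set (PiLp 2 fun _ : DerivIndex m => L2)) =
      ⋂ (a : DerivIndex m) (φ : E3 → ℝ) (_ : ContDiff ℝ ∞ φ) (_ : HasCompactSupport φ),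
        {U | ∫ x, partialDeriv a.2 φ x • (U (idIndex m)) x
          = (-1 : ℝ) ^ (a.1 : ℕ) • ∫ x, φ x • (U a) x} := by
    ext U
    simp only [mem_iInter]
    rfl
  rw [this]
  refine isClosed_iInter fun a => isClosed_iInter fun φ => isClosed_iInter fun hφ =>
    isClosed_iInter fun hs => isClosed_eq ?_ ?_
  · exact (continuous_integral_smul (continuous_partialDeriv a.2 hφ)
      (hasCompactSupport_partialDeriv a.2 hs)).comp (PiLp.continuous_apply 2 (fun _ => L2) _)
  · exact ((continuous_integral_smul hφ.continuous hs).comp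
      (PiLp.continuous_apply 2 (fun _ => L2) a)).const_smul ((-1 : ℝ) ^ (a.1 : ℕ))

instance (m : ℕ) : CompleteSpace (SobolevH m) := (isClosed_sobolevH m).completeSpace_coe

/-- Weak derivatives are determined by the field, so uniqueness of solutions reduces to almost
everywhere equality of fields. -/
theorem sobolevH_ext {m : ℕ} {u v : SobolevH m} (h : field u =ᵐ[volume] field v) : u = v := by
  ext1
  ext1 a
  refine Lp.ext ?_
  refine ae_eq_of_integral_contDiff_smul_eq
    ((Lp.memLp _).locallyIntegrable (by norm_num)) ((Lp.memLp _).locallyIntegrable (by norm_num)) ?_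
  intro φ hφ hs
  have h1 := u.2 a φ hφ hs
  have h2 := v.2 a φ hφ hs
  have h3 : ∫ x, partialDeriv a.2 φ x • field u x = ∫ x, partialDeriv a.2 φ x • field v x :=
    integral_congr_ae (h.mono fun x hx => by simp only [hx])
  have h4 := h1.symm.trans (h3.trans h2)
  exact smul_right_injective E3 (pow_ne_zero _ (by norm_num : (-1 : ℝ) ≠ 0)) h4

end

/-! ### Sobolev embedding by the Fourier transform -/

section

open FourierTransform SchwartzMap LineDeriv
open scoped Real

theorem fourier_first (F : 𝓢(E3, ℂ)) (j : Fin 3) (ξ : E3) :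
    𝓕 (∂_{e j} F) ξ = 2 * π * Complex.I * (ξ j : ℂ) * 𝓕 F ξ := by
  have hg : Function.HasTemperateGrowth fun x : E3 => inner ℝ x (e j) := by fun_prop
  rw [SchwartzMap.fourier_lineDerivOp_eq, _root_.smul_apply, SchwartzMap.smulLeftCLM_apply_apply hg]
  simp [EuclideanSpace.inner_single_right, mul_assoc]

theorem fourier_second (F : 𝓢(E3, ℂ)) (j : Fin 3) (ξ : E3) :
    𝓕 (∂_{e j} (∂_{e j} F)) ξ = -(2 * π * (ξ j : ℂ)) ^ 2 * 𝓕 F ξ := by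
  rw [fourier_first, fourier_first]
  linear_combination (2 * π * (ξ j : ℂ)) ^ 2 * 𝓕 F ξ * Complex.I_sq

/-- The embedding of `H²` into bounded functions on three-space. -/
theorem exists_sobolev_const : ∃ C : ℝ, 0 ≤ C ∧ ∀ (f : E3 → ℝ) (M : ℝ), Test f → 0 ≤ M →
    (∀ w : List (Fin 3), w.length ≤ 2 → eLpNorm (Dw w f) 2 volume ≤ ENNReal.ofReal M) →
    ∀ x, |f x| ≤ C * M := by
  let wt : E3 → ℝ := fun ξ => (1 + ‖ξ‖ ^ 2)⁻¹
  have hwt : MemLp wt 2 (volume : Measure E3) := by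
    have hc : Continuous wt := by
      refine Continuous.inv₀ (by fun_prop) fun x => by positivity
    refine (memLp_two_iff_integrable_sq hc.aestronglyMeasurable).2 ?_
    have := integrable_rpow_neg_one_add_norm_sq (E := E3) (μ := volume) (r := 4)
      (by simp; norm_num)
    refine this.congr (Filter.Eventually.of_forall fun x => ?_)
    have h0 : (0 : ℝ) ≤ 1 + ‖x‖ ^ 2 := by positivity
    simp only [wt]
    rw [show (-4 / 2 : ℝ) = -((2 : ℕ) : ℝ) by norm_num, Real.rpow_neg h0, Real.rpow_natCast, inv_pow]
  -- The weight is square integrable because its square decays like `|ξ|⁻⁴` in dimension 3. The 4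
  -- counts the terms of `g` below: `f` and three second derivatives.
  refine ⟨(eLpNorm wt 2 volume).toReal * 4, by positivity, fun f M hf hM hw x => ?_⟩
  -- `g = f - Δf / (4π²)` has Fourier transform `(1 + |ξ|²)` times that of `f`. Cauchy–Schwarz in
  -- the inversion formula and Plancherel for `g` then bound `f`.
  let g : E3 → ℝ := f - ∑ j, fun x => (1 / (4 * π ^ 2)) • D j (D j f) x
  have hsum : ∀ j, Test (fun x => (1 / (4 * π ^ 2)) • D j (D j f) x) := fun j =>
    ((hf.D j).D j).smul_left (c := fun _ => 1 / (4 * π ^ 2)) contDiff_const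
  have hg : Test g := by
    simp only [g, Fin.sum_univ_three]
    exact hf.sub (((hsum 0).add (hsum 1)).add (hsum 2))
  have hgM : eLpNorm g 2 volume ≤ ENNReal.ofReal (4 * M) := by
    have h1 : ∀ j, eLpNorm (fun x => (1 / (4 * π ^ 2)) • D j (D j f) x) 2 volume
        ≤ ENNReal.ofReal M := fun j => by
      refine (eLpNorm_mono fun x => ?_).trans (hw [j, j] (by simp))
      rw [norm_smul]
      refine mul_le_of_le_one_left (norm_nonneg _) ?_
      rw [Real.norm_of_nonneg (by positivity), div_le_one (by positivity)]
      nlinarith [Real.pi_gt_three]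
    simp only [g, Fin.sum_univ_three]
    refine (eLpNorm_sub_le hf.cont.aestronglyMeasurable
      (((hsum 0).add (hsum 1)).add (hsum 2)).cont.aestronglyMeasurable (by norm_num)).trans ?_
    rw [show 4 * M = M + ((M + M) + M) by ring, ENNReal.ofReal_add hM (by positivity),
      ENNReal.ofReal_add (by positivity) hM, ENNReal.ofReal_add hM hM]
    refine add_le_add (hw [] (by simp)) ((eLpNorm_add_le
      ((hsum 0).add (hsum 1)).cont.aestronglyMeasurable
      (hsum 2).cont.aestronglyMeasurable (by norm_num)).trans (add_le_add ((eLpNorm_add_le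
      (hsum 0).cont.aestronglyMeasurable
      (hsum 1).cont.aestronglyMeasurable (by norm_num)).trans (add_le_add (h1 0) (h1 1))) (h1 2)))
  have hC : ∀ {p : E3 → ℝ}, Test p → Test fun x => (p x : ℂ) := fun hp =>
    ⟨Complex.ofRealCLM.contDiff.comp hp.smooth, hp.supp.comp_left (g := Complex.ofReal) rfl⟩
  let F : 𝓢(E3, ℂ) := (hC hf).supp.toSchwartzMap (hC hf).smooth
  let G : 𝓢(E3, ℂ) := (hC hg).supp.toSchwartzMap (hC hg).smooth
  have hD : ∀ j y, (∂_{e j} (∂_{e j} F)) y = ((D j (D j f) y : ℝ) : ℂ) := by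
    intro j y
    have h1 : ∀ {p : E3 → ℝ}, Differentiable ℝ p → ∀ y,
        fderiv ℝ (fun x => (p x : ℂ)) y (e j) = ((D j p y : ℝ) : ℂ) := fun hp y =>
      congrFun (D_clm Complex.ofRealCLM hp j) y
    have h2 : ⇑(∂_{e j} F : 𝓢(E3, ℂ)) = fun y => ((D j f y : ℝ) : ℂ) := by
      ext y
      rw [SchwartzMap.lineDerivOp_apply_eq_fderiv]
      exact h1 hf.diff y
    rw [SchwartzMap.lineDerivOp_apply_eq_fderiv, h2]
    exact h1 (hf.D j).diff y
  have hGF : G = F - ∑ j, (1 / (4 * π ^ 2) : ℝ) • ∂_{e j} (∂_{e j} F) := by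
    ext y
    simp only [_root_.sub_apply, _root_.sum_apply, _root_.smul_apply, hD]
    simp [G, F, g]
  have hFG : ∀ ξ, 𝓕 F ξ = wt ξ • 𝓕 G ξ := by
    intro ξ
    have h1 : 𝓕 G ξ = 𝓕 F ξ + ((‖ξ‖ ^ 2 : ℝ) : ℂ) * 𝓕 F ξ := by
      rw [hGF, EuclideanSpace.norm_sq_eq, ← SchwartzMap.fourierTransformCLM_apply ℝ]
      simp only [Fin.sum_univ_three, map_sub, map_add, map_smul,
        SchwartzMap.fourierTransformCLM_apply, _root_.sub_apply, _root_.add_apply,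
        _root_.smul_apply, fourier_second, Complex.real_smul]
      have hπ : (π : ℂ) ≠ 0 := by exact_mod_cast Real.pi_ne_zero
      simp only [Real.norm_eq_abs, sq_abs]
      push_cast
      field_simp
      ring
    have h0 : (0 : ℝ) < 1 + ‖ξ‖ ^ 2 := by positivity
    rw [h1]
    simp only [wt, Complex.real_smul]
    rw [← one_add_mul, Complex.ofReal_inv, ← mul_assoc, ← Complex.ofReal_one, ← Complex.ofReal_add,
      inv_mul_cancel₀ (by exact_mod_cast h0.ne'), one_mul]
  have hGn : eLpNorm (𝓕 G : 𝓢(E3, ℂ)) 2 volume = eLpNorm g 2 volume := by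
    have h1 := SchwartzMap.norm_fourier_toL2_eq G
    rw [SchwartzMap.norm_toLp, SchwartzMap.norm_toLp, ENNReal.toReal_eq_toReal_iff'
      ((𝓕 G).memLp 2 _).eLpNorm_ne_top (G.memLp 2 _).eLpNorm_ne_top] at h1
    rw [h1]
    exact eLpNorm_congr_norm_ae (Filter.Eventually.of_forall fun y => by simp [G])
  have h1 : ‖F x‖ₑ ≤ eLpNorm wt 2 volume * eLpNorm (𝓕 G : 𝓢(E3, ℂ)) 2 volume := by
    have h2 : F x = 𝓕⁻ (⇑(𝓕 F : 𝓢(E3, ℂ))) x := by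
      rw [← SchwartzMap.fourierInv_coe, FourierTransform.fourierInv_fourier_eq]
    rw [h2, Real.fourierInv_eq]
    refine (enorm_integral_le_lintegral_enorm _).trans ?_
    have h3 : eLpNorm (fun ξ => wt ξ • 𝓕 G ξ) 1 volume ≤ _ :=
      eLpNorm_smul_le_mul_eLpNorm (p := 2) (q := 2) (r := 1) (f := ⇑(𝓕 G : 𝓢(E3, ℂ))) (φ := wt)
        (𝓕 G).continuous.aestronglyMeasurable hwt.1
    rw [eLpNorm_one_eq_lintegral_enorm] at h3
    refine le_trans (le_of_eq (lintegral_congr fun ξ => ?_)) h3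
    rw [← hFG, ← ofReal_norm, ← ofReal_norm, Circle.norm_smul]
  rw [hGn] at h1
  have h4 : ‖F x‖ₑ ≤ ENNReal.ofReal ((eLpNorm wt 2 volume).toReal * 4 * M) := by
    refine h1.trans ((mul_le_mul_right hgM _).trans (le_of_eq ?_))
    rw [mul_assoc (ENNReal.toReal _), ENNReal.ofReal_mul ENNReal.toReal_nonneg,
      ENNReal.ofReal_toReal hwt.eLpNorm_ne_top]
  have h5 : ‖F x‖ ≤ (eLpNorm wt 2 volume).toReal * 4 * M := by
    rw [← ofReal_norm] at h4
    exact (ENNReal.ofReal_le_ofReal_iff (by positivity)).1 h4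
  simpa [F] using h5

end

/-! ### Interpolation in `L⁴`; Hardy's inequality for the coefficient -/

section

variable {V : Type*} [NormedAddCommGroup V] [NormedSpace ℝ V]

theorem eLpNorm_le_ofReal_iff {f : E3 → V} (hf : Test f) {n : ℕ} (hn : n ≠ 0) {M : ℝ}
    (hM : 0 ≤ M) :
    eLpNorm f n volume ≤ ENNReal.ofReal M ↔ ∫ x, ‖f x‖ ^ n ≤ M ^ n := by
  have h0 : 0 ≤ ∫ x, ‖f x‖ ^ n := integral_nonneg fun x => by positivity
  rw [(hf.memLp n).eLpNorm_eq_integral_rpow_norm (by exact_mod_cast hn) (by simp)]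
  simp only [ENNReal.toReal_natCast, Real.rpow_natCast]
  rw [ENNReal.ofReal_le_ofReal_iff hM, Real.rpow_inv_le_iff_of_pos h0 hM (by positivity),
    Real.rpow_natCast]

theorem Test.integrable_mul {f g : E3 → ℝ} (hf : Test f) (hg : Continuous g) :
    Integrable fun x => f x * g x :=
  (hf.cont.mul hg).integrable_of_hasCompactSupport hf.supp.mul_right

theorem integral_mul_D {f g : E3 → ℝ} (hf : Test f) (hg : Test g) (j : Fin 3) :
    ∫ x, f x * D j g x = - ∫ x, D j f x * g x :=
  integral_smul_D hf.smooth hg.smooth (Or.inl hf.supp) j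

theorem D_mul {f g : E3 → ℝ} (hf : Differentiable ℝ f) (hg : Differentiable ℝ g) (j : Fin 3) :
    D j (fun x => f x * g x) = fun x => f x * D j g x + D j f x * g x := D_smul hf hg j

/-- The interpolation inequality `‖∂f‖₄² ≲ ‖f‖_∞ ‖∂²f‖₂`. -/
theorem eLpNorm_four_D_le {f : E3 → ℝ} (hf : Test f) (j : Fin 3) {M : ℝ} (hM : 0 ≤ M)
    (h1 : ∀ x, |f x| ≤ M) (h2 : eLpNorm (D j (D j f)) 2 volume ≤ ENNReal.ofReal M) :
    eLpNorm (D j f) 4 volume ≤ ENNReal.ofReal (2 * M) := by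
  have hg := hf.D j
  have hg2 := hg.D j
  have h2' := (eLpNorm_le_ofReal_iff hg2 two_ne_zero hM).1 (by exact_mod_cast h2)
  suffices hI : ∫ x, ‖D j f x‖ ^ 4 ≤ (2 * M) ^ 4 by
    exact_mod_cast (eLpNorm_le_ofReal_iff hg four_ne_zero (by positivity : 0 ≤ 2 * M)).2 hI
  set g := D j f with hgdef
  have hp : ∀ n, ContDiff ℝ ∞ fun x => g x ^ n := fun n => hg.smooth.pow n
  have hg3 : Test fun x => g x ^ 2 * g x :=
    ⟨(hp 2).mul hg.smooth, hg.supp.mul_left⟩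
  have hDg2 : D j (fun x => g x ^ 2) = fun x => 2 * g x * D j g x := by
    have := D_mul hg.diff hg.diff j
    simp only [← sq] at this
    rw [this]; ext x; ring
  have hD3 : D j (fun x => g x ^ 2 * g x) = fun x => 3 * g x ^ 2 * D j g x := by
    rw [D_mul (diff_of_smooth (hp 2)) hg.diff, hDg2]
    ext x; ring
  have e1 := integral_mul_D hg3 hf j
  rw [hD3, ← hgdef] at e1
  have i4 : Integrable fun x => ‖g x‖ ^ 4 := by
    have : Integrable fun x => g x * g x ^ 3 := hg.integrable_mul (hp 3).continuous
    refine this.congr (Filter.Eventually.of_forall fun x => ?_)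
    simp only [Real.norm_eq_abs]
    rw [← abs_pow, abs_of_nonneg (by positivity)]; ring
  have i2 : Integrable fun x => ‖D j g x‖ ^ 2 := by
    have : Integrable fun x => D j g x * D j g x := hg2.integrable_mul hg2.cont
    refine this.congr (Filter.Eventually.of_forall fun x => ?_)
    simp only [Real.norm_eq_abs, sq_abs]; ring
  -- Integrate `g³ ∂f` by parts. Young's inequality then absorbs half of `∫ g⁴`, leaving `∫ g⁴ ≤ 9
  -- M⁴ ≤ (2M)⁴`.
  have e2 : ∫ x, ‖g x‖ ^ 4 = ∫ x, -(3 * g x ^ 2 * D j g x * f x) := by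
    rw [integral_neg, ← e1]
    refine integral_congr_ae (Filter.Eventually.of_forall fun x => ?_)
    simp only [Real.norm_eq_abs]
    rw [← abs_pow, abs_of_nonneg (by positivity)]; ring
  have e3 : ∫ x, -(3 * g x ^ 2 * D j g x * f x)
      ≤ ∫ x, (1 / 2 * ‖g x‖ ^ 4 + 9 / 2 * M ^ 2 * ‖D j g x‖ ^ 2) := by
    refine integral_mono ?_ ((i4.const_mul _).add (i2.const_mul _)) fun x => ?_
    · refine ((hf.integrable_mul (g := fun x => 3 * g x ^ 2 * D j g x) ?_).neg).congr
        (Filter.Eventually.of_forall fun x => ?_)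
      · exact (((hp 2).continuous.const_mul 3 |>.congr fun _ => rfl).mul hg2.cont)
      · simp only [Pi.neg_apply]; ring
    · have hx := h1 x
      have h4 : ‖g x‖ ^ 4 = (g x ^ 2) ^ 2 := by
        rw [Real.norm_eq_abs, ← abs_pow, abs_of_nonneg (by positivity)]; ring
      simp only []
      rw [h4, Real.norm_eq_abs, sq_abs]
      have h5 : -(3 * g x ^ 2 * D j g x * f x) ≤ 3 * g x ^ 2 * |D j g x| * M := by
        refine (neg_le_abs _).trans ?_
        rw [abs_mul, abs_mul, abs_of_nonneg (by positivity : 0 ≤ 3 * g x ^ 2)]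
        gcongr
      nlinarith [sq_nonneg (g x ^ 2 - 3 * M * |D j g x|), sq_abs (D j g x)]
  rw [integral_add (i4.const_mul _) (i2.const_mul _), integral_const_mul, integral_const_mul] at e3
  have e4 : 9 / 2 * M ^ 2 * ∫ x, ‖D j g x‖ ^ 2 ≤ 9 / 2 * M ^ 2 * M ^ 2 := by gcongr
  nlinarith [pow_nonneg hM 4]

/-- Integration by parts of `x_i ∂_i (b²) / 2`. -/
theorem integral_coord_mul (i : Fin 3) {b : E3 → ℝ} (hb : Test b) :
    ∫ x : E3, b x * (x i * D i b x) = -(1 / 2) * ∫ x, b x ^ 2 := by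
  have hc : ContDiff ℝ ∞ fun x : E3 => x i := by fun_prop
  have hcb : Test fun x : E3 => x i * b x := Test.smul_left hc hb
  have h1 := integral_mul_D hcb hb i
  have hDi : D i (fun x : E3 => x i) = fun _ => 1 := by
    ext x
    have : HasFDerivAt (fun x : E3 => x i) (EuclideanSpace.proj i : E3 →L[ℝ] ℝ) x :=
      (EuclideanSpace.proj i : E3 →L[ℝ] ℝ).hasFDerivAt
    simp [D, this.fderiv]
  rw [D_mul (diff_of_smooth hc) hb.diff, hDi] at h1
  have i1 : Integrable fun x : E3 => b x * (x i * D i b x) :=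
    hb.integrable_mul (hc.continuous.mul (hb.D i).cont)
  have i2 : Integrable fun x : E3 => b x * b x := hb.integrable_mul hb.cont
  have e1 : ∫ x : E3, x i * b x * D i b x = ∫ x : E3, b x * (x i * D i b x) :=
    integral_congr_ae (Filter.Eventually.of_forall fun x => by simp only []; ring)
  have e2 : ∫ x : E3, (x i * D i b x + 1 * b x) * b x
      = (∫ x : E3, b x * (x i * D i b x)) + ∫ x, b x * b x := by
    rw [← integral_add i1 i2]
    exact integral_congr_ae (Filter.Eventually.of_forall fun x => by simp only []; ring)
  rw [e1, e2] at h1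
  simp only [sq]
  linarith

/-- The vector field with coefficient `a`. -/
def fld (a : E3 → ℝ) : E3 → E3 := fun x => a x • dTheta x

/-- `∂_θ` as a linear map. -/
def dThetaL : E3 →L[ℝ] E3 :=
  LinearMap.toContinuousLinearMap
    { toFun := dTheta
      map_add' := fun x y => by ext i; fin_cases i <;> simp [dTheta]; ring
      map_smul' := fun c x => by ext i; fin_cases i <;> simp [dTheta] }

theorem contDiff_dTheta : ContDiff ℝ ∞ dTheta := dThetaL.contDiff

theorem D_dTheta (j : Fin 3) : D j dTheta = fun _ => dTheta (e j) := by
  ext1 x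
  have : HasFDerivAt dTheta dThetaL x := dThetaL.hasFDerivAt
  rw [D, this.fderiv]; rfl

theorem dTheta_e_two : dTheta (e 2) = 0 := by
  ext i; fin_cases i <;> simp [dTheta]

theorem norm_dTheta_e_le (j : Fin 3) : ‖dTheta (e j)‖ ≤ 1 := by
  fin_cases j <;> simp [dTheta, EuclideanSpace.norm_eq, Fin.sum_univ_three]

theorem D_smul_dTheta {a : E3 → ℝ} (ha : Differentiable ℝ a) (j : Fin 3) :
    D j (fld a) = fun x => a x • dTheta (e j) + D j a x • dTheta x := by
  unfold fld
  rw [D_smul ha (diff_of_smooth contDiff_dTheta), D_dTheta]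

theorem Test.fld {a : E3 → ℝ} (ha : Test a) : Test (fld a) :=
  Test.smul_right ha contDiff_dTheta

/-- The lower order terms of the iterated derivative of a field with coefficient `a`. -/
def lowerTerms (a : E3 → ℝ) : List (Fin 3) → E3 → E3
  | [] => 0
  | j :: v => D j (lowerTerms a v) + fun x => Dw v a x • dTheta (e j)

theorem test_lowerTerms {a : E3 → ℝ} (ha : Test a) : ∀ v, Test (lowerTerms a v)
  | [] => Test.zero
  | j :: v => ((test_lowerTerms ha v).D j).add ((ha.Dw v).smul_right contDiff_const)

/-- As `∂_θ` is linear in `x`, each derivative falls either on the coefficient or, at most once, on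
`∂_θ`, which then becomes a constant vector. -/
theorem Dw_fld {a : E3 → ℝ} (ha : Test a) :
    ∀ v, Dw v (fld a) = fld (Dw v a) + lowerTerms a v
  | [] => by simp [lowerTerms]
  | j :: v => by
    rw [Dw_cons, Dw_fld ha v, D_add (ha.Dw v).fld.diff (test_lowerTerms ha v).diff,
      D_smul_dTheta (ha.Dw v).diff]
    ext1 x
    simp [lowerTerms, fld]
    abel

/-- Every lower term has spent one derivative on `∂_θ`: it is an unweighted derivative of `a` of
order one less, times a vector of norm at most 1. There is one such term per letter of `v`. -/
theorem eLpNorm_Dw_lowerTerms_le {a : E3 → ℝ} (ha : Test a) {m : ℕ} {B : ℝ} (hB : 0 ≤ B)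
    (h : ∀ w : List (Fin 3), w.length + 1 ≤ m → eLpNorm (Dw w a) 2 volume ≤ ENNReal.ofReal B) :
    ∀ v u : List (Fin 3), u.length + v.length ≤ m →
      eLpNorm (Dw u (lowerTerms a v)) 2 volume ≤ ENNReal.ofReal (v.length * B) := by
  intro v
  induction v with
  | nil => intro u _; simp [lowerTerms]
  | cons j v ih =>
    intro u hu
    rw [List.length_cons] at hu
    have hc : Test fun x => Dw v a x • dTheta (e j) := (ha.Dw v).smul_right contDiff_const
    have hv := test_lowerTerms ha v
    rw [lowerTerms, Dw_add (hv.D j).smooth hc.smooth]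
    refine (eLpNorm_add_le ((hv.D j).Dw u).cont.aestronglyMeasurable
      (hc.Dw u).cont.aestronglyMeasurable (by norm_num)).trans ?_
    rw [List.length_cons, Nat.cast_succ, add_one_mul, ENNReal.ofReal_add (by positivity) hB]
    refine add_le_add ?_ ?_
    · have := ih (u ++ [j]) (by simp; omega)
      rwa [Dw_append] at this
    · let T : ℝ →L[ℝ] E3 := (ContinuousLinearMap.id ℝ ℝ).smulRight (dTheta (e j))
      have h1 : (fun x => Dw v a x • dTheta (e j)) = fun x => T (Dw v a x) := rfl
      rw [h1, Dw_clm T (ha.Dw v).smooth, ← Dw_append]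
      refine (eLpNorm_mono fun x => ?_).trans (h (u ++ v) (by simp; omega))
      change ‖Dw (u ++ v) a x • dTheta (e j)‖ ≤ _
      rw [norm_smul]
      exact mul_le_of_le_one_right (norm_nonneg _) (norm_dTheta_e_le j)

/-- The bound `‖u‖_{H^m} ≤ N` for the field `u` with coefficient `a`. -/
def HB (m : ℕ) (a : E3 → ℝ) (N : ℝ) : Prop :=
  ∀ w : List (Fin 3), w.length ≤ m → eLpNorm (Dw w (fld a)) 2 volume ≤ ENNReal.ofReal N

/-- Commutator with the horizontal Euler operator: each letter 0 or 1 adds one copy of the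
derivative. Only the sign of `k` matters for the Hardy inequality. -/
theorem Dw_euler {a : E3 → ℝ} (ha : ContDiff ℝ ∞ a) : ∀ w : List (Fin 3), ∃ k : ℝ, 0 ≤ k ∧
    Dw w (fun x => x 0 * D 0 a x + x 1 * D 1 a x)
      = fun x => k * Dw w a x + (x 0 * D 0 (Dw w a) x + x 1 * D 1 (Dw w a) x)
  | [] => ⟨0, le_rfl, by simp⟩
  | j :: w => by
    obtain ⟨k, hk, h⟩ := Dw_euler ha w
    have hb := contDiff_Dw ha w
    have hc : ∀ i, Differentiable ℝ fun x : E3 => x i := fun i => by fun_prop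
    have hDc : ∀ i x, D j (fun x : E3 => x i) x = if i = j then 1 else 0 := fun i x => by
      have : HasFDerivAt (fun x : E3 => x i) (EuclideanSpace.proj i : E3 →L[ℝ] ℝ) x :=
        (EuclideanSpace.proj i : E3 →L[ℝ] ℝ).hasFDerivAt
      simp [D, this.fderiv]
    have hdd : ∀ i, Differentiable ℝ (D i (Dw w a)) := fun i => diff_of_smooth (contDiff_D hb i)
    have hm : ∀ i, Differentiable ℝ fun x : E3 => x i * D i (Dw w a) x := fun i =>
      (hc i).mul (hdd i)
    refine ⟨k + (if j = 2 then 0 else 1), by split_ifs <;> linarith, ?_⟩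
    rw [Dw_cons, h]
    have e0 : (fun x : E3 => k * Dw w a x + (x 0 * D 0 (Dw w a) x + x 1 * D 1 (Dw w a) x))
        = (fun x => k • Dw w a x) + ((fun x => x 0 * D 0 (Dw w a) x)
          + fun x => x 1 * D 1 (Dw w a) x) := rfl
    have hkb : Differentiable ℝ fun x => k • Dw w a x := (diff_of_smooth hb).const_smul k
    rw [e0, D_add hkb ((hm 0).add (hm 1)), D_add (hm 0) (hm 1),
      D_const_smul k (diff_of_smooth hb), D_mul (hc 0) (hdd 0), D_mul (hc 1) (hdd 1)]
    ext x
    simp only [Pi.add_apply, hDc, smul_eq_mul, Dw_cons, D_comm hb j]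
    fin_cases j <;> simp <;> ring

/-- Hardy's inequality: the coefficient has one derivative less than the field. -/
theorem eLpNorm_coeff_le {m : ℕ} {a : E3 → ℝ} (ha : Test a) {N : ℝ} (hN : 0 ≤ N)
    (h : HB m a N) (w : List (Fin 3)) (hw : w.length + 1 ≤ m) :
    eLpNorm (Dw w a) 2 volume ≤ ENNReal.ofReal (2 * N) := by
  have hF := ha.fld
  let p : Fin 3 → E3 →L[ℝ] ℝ := fun i => EuclideanSpace.proj i
  have hpn : ∀ i (v : E3), ‖p i v‖ ≤ ‖v‖ := fun i v => PiLp.norm_apply_le v i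
  let q : Fin 3 → Fin 3 → E3 → ℝ := fun i j x => p i (Dw w (D j (fld a)) x)
  have hq : ∀ i j, Test (q i j) := fun i j => by
    have := ((hF.D j).Dw w)
    exact ⟨(p i).contDiff.comp this.smooth, this.supp.comp_left (map_zero _)⟩
  have hqN : ∀ i j, eLpNorm (q i j) 2 volume ≤ ENNReal.ofReal N := fun i j => by
    have := h (w ++ [j]) (by simpa using hw)
    rw [Dw_append] at this
    exact (eLpNorm_mono fun x => hpn i _).trans this
  -- This is `D^w` of the vertical component of the curl of `a ∂_θ`, which equals `2a + x₀ ∂₀a + x₁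
  -- ∂₁a`.
  have hh : Test (q 1 0 - q 0 1) := (hq 1 0).sub (hq 0 1)
  have hhN : eLpNorm (q 1 0 - q 0 1) 2 volume ≤ ENNReal.ofReal (2 * N) := by
    rw [two_mul, ENNReal.ofReal_add hN hN]
    exact (eLpNorm_sub_le (hq 1 0).cont.aestronglyMeasurable (hq 0 1).cont.aestronglyMeasurable
      (by norm_num)).trans (add_le_add (hqN 1 0) (hqN 0 1))
  obtain ⟨k, hk, hE⟩ := Dw_euler ha.smooth w
  have hb := ha.Dw w
  set b := Dw w a with hbdef
  have hid : q 1 0 - q 0 1 = fun x => (2 + k) * b x + (x 0 * D 0 b x + x 1 * D 1 b x) := by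
    have e1 : ∀ i j, q i j = Dw w (fun x => p i (D j (fld a) x)) := fun i j =>
      (Dw_clm (p i) (hF.D j).smooth w).symm
    have hs : ∀ i j, ContDiff ℝ ∞ fun x => p i (D j (fld a) x) := fun i j =>
      (p i).contDiff.comp (hF.D j).smooth
    rw [e1, e1, ← Dw_sub (hs 1 0) (hs 0 1)]
    have hEs : ContDiff ℝ ∞ fun x : E3 => x 0 * D 0 a x + x 1 * D 1 a x := by
      have h0 := (ha.D 0).smooth
      have h1 := (ha.D 1).smooth
      fun_prop
    have e2 : ((fun x => p 1 (D 0 (fld a) x)) - fun x => p 0 (D 1 (fld a) x))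
        = (fun x => (2 : ℝ) • a x) + fun x => x 0 * D 0 a x + x 1 * D 1 a x := by
      ext x
      simp [p, D_smul_dTheta ha.diff, dTheta]
      ring
    have h2a : ContDiff ℝ ∞ fun x => (2 : ℝ) • a x := ha.smooth.const_smul 2
    rw [e2, Dw_add h2a hEs, Dw_const_smul 2 ha.smooth, hE]
    ext x
    simp only [Pi.add_apply, smul_eq_mul, ← hbdef]
    ring
  have h2 : ∫ x, ‖(q 1 0 - q 0 1) x‖ ^ 2 ≤ (2 * N) ^ 2 :=
    (eLpNorm_le_ofReal_iff hh two_ne_zero (by positivity)).1 (by exact_mod_cast hhN)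
  have : (∫ x, ‖b x‖ ^ 2 ≤ (2 * N) ^ 2) → eLpNorm b 2 volume ≤ ENNReal.ofReal (2 * N) := fun h' =>
    by exact_mod_cast (eLpNorm_le_ofReal_iff hb two_ne_zero (by positivity)).2 h'
  refine this (le_trans ?_ h2)
  simp only [Real.norm_eq_abs, sq_abs]
  have ibb : Integrable fun x => b x ^ 2 :=
    (hb.integrable_mul hb.cont).congr (Filter.Eventually.of_forall fun x => by simp [sq])
  have ihh : Integrable fun x => (q 1 0 - q 0 1) x ^ 2 :=
    (hh.integrable_mul hh.cont).congr (Filter.Eventually.of_forall fun x => by simp [sq])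
  have ibh : Integrable fun x => b x * (q 1 0 - q 0 1) x := hb.integrable_mul hh.cont
  have ic : ∀ i, Integrable fun x : E3 => b x * (x i * D i b x) := fun i =>
    hb.integrable_mul (by have := (hb.D i).cont; fun_prop)
  -- The factor `2 + k` loses `1/2` for each of the two horizontal variables. The remaining `1 + k ≥
  -- 1` is coercive, and Young's inequality closes the estimate.
  have e1 : ∫ x, b x * (q 1 0 - q 0 1) x = (1 + k) * ∫ x, b x ^ 2 := by
    have : ∀ x, b x * (q 1 0 - q 0 1) x
        = (2 + k) * b x ^ 2 + (b x * (x 0 * D 0 b x) + b x * (x 1 * D 1 b x)) := fun x => by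
      rw [hid]; ring
    simp only [this]
    have ic' : Integrable fun x : E3 => b x * (x 0 * D 0 b x) + b x * (x 1 * D 1 b x) :=
      (ic 0).add (ic 1)
    rw [integral_add (ibb.const_mul _) ic', integral_add (ic 0) (ic 1),
      integral_const_mul, integral_coord_mul 0 hb, integral_coord_mul 1 hb]
    ring
  have e2 : ∫ x, b x * (q 1 0 - q 0 1) x
      ≤ ∫ x, (1 / 2 * b x ^ 2 + 1 / 2 * (q 1 0 - q 0 1) x ^ 2) :=
    integral_mono ibh ((ibb.const_mul _).add (ihh.const_mul _)) fun x => by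
      simp only []
      nlinarith [sq_nonneg (b x - (q 1 0 - q 0 1) x)]
  rw [integral_add (ibb.const_mul _) (ihh.const_mul _), integral_const_mul, integral_const_mul,
    e1] at e2
  have h0 : 0 ≤ ∫ x, b x ^ 2 := integral_nonneg fun x => sq_nonneg _
  nlinarith [mul_nonneg hk h0]

end

/-! ### Product estimates graded by the number of derivatives -/

section

/-- Bounds satisfied by a function that behaves like a derivative of order `d + 1` of the
coefficient of a field in `H^m`. -/
structure Bd (m d : ℕ) (f : E3 → ℝ) (M : ℝ) : Prop where
  cont : Continuous f
  nonneg : 0 ≤ M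
  sup : d + 4 ≤ m → ∀ x, |f x| ≤ M
  supw : d + 3 ≤ m → ∀ x, ‖fld f x‖ ≤ M
  l4 : d + 3 ≤ m → eLpNorm f 4 volume ≤ ENNReal.ofReal M
  l2 : d + 2 ≤ m → eLpNorm f 2 volume ≤ ENNReal.ofReal M
  l2w : d + 1 ≤ m → eLpNorm (fld f) 2 volume ≤ ENNReal.ofReal M

theorem continuous_fld {f : E3 → ℝ} (hf : Continuous f) : Continuous (fld f) :=
  hf.smul contDiff_dTheta.continuous

theorem eLpNorm_le_of_norm_le_mul {V V' : Type*} [NormedAddCommGroup V] [NormedAddCommGroup V']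
    {f : E3 → V} {g : E3 → V'} {M M' : ℝ} (hM : 0 ≤ M)
    {p : ENNReal} (h : ∀ x, ‖f x‖ ≤ M * ‖g x‖) (hg : eLpNorm g p volume ≤ ENNReal.ofReal M') :
    eLpNorm f p volume ≤ ENNReal.ofReal (M * M') := by
  rw [ENNReal.ofReal_mul hM]
  exact (eLpNorm_le_mul_eLpNorm_of_ae_le_mul (Filter.Eventually.of_forall h) p).trans
    (mul_le_mul_right hg _)

theorem fld_mul (f g : E3 → ℝ) (x : E3) : fld (fun x => f x * g x) x = f x • fld g x := by
  simp [fld, mul_smul]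

theorem fld_mul' (f g : E3 → ℝ) (x : E3) : fld (fun x => f x * g x) x = g x • fld f x := by
  simp [fld, smul_smul, mul_comm]

namespace Bd

variable {m d k : ℕ} {f g h : E3 → ℝ} {M M' : ℝ}

theorem bdd_mul (hf : Bd m d f M) (hh : Continuous h) {c : ℝ} (hc : 0 ≤ c)
    (hhc : ∀ x, |h x| ≤ c) : Bd m d (fun x => h x * f x) (c * M) where
  cont := hh.mul hf.cont
  nonneg := mul_nonneg hc hf.nonneg
  sup hd x := by rw [abs_mul]; exact mul_le_mul (hhc x) (hf.sup hd x) (abs_nonneg _) hc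
  supw hd x := by
    rw [fld_mul, norm_smul]; exact mul_le_mul (hhc x) (hf.supw hd x) (norm_nonneg _) hc
  l4 hd := eLpNorm_le_of_norm_le_mul hc (fun x => by
    rw [norm_mul]; exact mul_le_mul_of_nonneg_right (hhc x) (norm_nonneg _)) (hf.l4 hd)
  l2 hd := eLpNorm_le_of_norm_le_mul hc (fun x => by
    rw [norm_mul]; exact mul_le_mul_of_nonneg_right (hhc x) (norm_nonneg _)) (hf.l2 hd)
  l2w hd := eLpNorm_le_of_norm_le_mul hc (fun x => by
    rw [fld_mul, norm_smul]; exact mul_le_mul_of_nonneg_right (hhc x) (norm_nonneg _)) (hf.l2w hd)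

theorem add (hf : Bd m d f M) (hg : Bd m d g M') : Bd m d (fun x => f x + g x) (M + M') where
  cont := hf.cont.add hg.cont
  nonneg := add_nonneg hf.nonneg hg.nonneg
  sup hd x := (abs_add_le _ _).trans (add_le_add (hf.sup hd x) (hg.sup hd x))
  supw hd x := by
    rw [show fld (fun x => f x + g x) x = fld f x + fld g x from add_smul _ _ _]
    exact (norm_add_le _ _).trans (add_le_add (hf.supw hd x) (hg.supw hd x))
  l4 hd := by
    rw [ENNReal.ofReal_add hf.nonneg hg.nonneg]
    exact (eLpNorm_add_le hf.cont.aestronglyMeasurable hg.cont.aestronglyMeasurable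
      (by norm_num)).trans (add_le_add (hf.l4 hd) (hg.l4 hd))
  l2 hd := by
    rw [ENNReal.ofReal_add hf.nonneg hg.nonneg]
    exact (eLpNorm_add_le hf.cont.aestronglyMeasurable hg.cont.aestronglyMeasurable
      (by norm_num)).trans (add_le_add (hf.l2 hd) (hg.l2 hd))
  l2w hd := by
    rw [ENNReal.ofReal_add hf.nonneg hg.nonneg,
      show fld (fun x => f x + g x) = fld f + fld g from funext fun x => add_smul _ _ _]
    exact (eLpNorm_add_le (continuous_fld hf.cont).aestronglyMeasurable
      (continuous_fld hg.cont).aestronglyMeasurable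
      (by norm_num)).trans (add_le_add (hf.l2w hd) (hg.l2w hd))

/-- Usually one factor is bounded and the other keeps the norm. In `l2` the one exception is `m =
4`, `d = k = 1`, settled by `L⁴ × L⁴`. In `l2w` both factors may be unbounded when `m ≤ 5`; then one
of them is bounded with the weight `r` and the other lies in `L²`. -/
theorem mul (hm : 4 ≤ m) (hf : Bd m d f M) (hg : Bd m k g M') :
    Bd m (d + k) (fun x => f x * g x) (M * M') where
  cont := hf.cont.mul hg.cont
  nonneg := mul_nonneg hf.nonneg hg.nonneg
  sup hd x := by
    rw [abs_mul]
    exact mul_le_mul (hf.sup (by omega) x) (hg.sup (by omega) x) (abs_nonneg _) hf.nonneg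
  supw hd x := by
    by_cases h1 : d + 4 ≤ m
    · rw [fld_mul, norm_smul]
      exact mul_le_mul (hf.sup h1 x) (hg.supw (by omega) x) (norm_nonneg _) hf.nonneg
    · rw [fld_mul', norm_smul, mul_comm]
      exact mul_le_mul (hf.supw (by omega) x) (hg.sup (by omega) x) (abs_nonneg _) hf.nonneg
  l4 hd := by
    by_cases h1 : d + 4 ≤ m
    · refine eLpNorm_le_of_norm_le_mul hf.nonneg (fun x => ?_) (hg.l4 (by omega))
      rw [norm_mul]; exact mul_le_mul_of_nonneg_right (hf.sup h1 x) (norm_nonneg _)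
    · rw [mul_comm]
      refine eLpNorm_le_of_norm_le_mul hg.nonneg (fun x => ?_) (hf.l4 (by omega))
      rw [norm_mul, mul_comm]
      exact mul_le_mul_of_nonneg_right (hg.sup (by omega) x) (norm_nonneg _)
  l2 hd := by
    by_cases h1 : d + 4 ≤ m
    · refine eLpNorm_le_of_norm_le_mul hf.nonneg (fun x => ?_) (hg.l2 (by omega))
      rw [norm_mul]; exact mul_le_mul_of_nonneg_right (hf.sup h1 x) (norm_nonneg _)
    by_cases h2 : k + 4 ≤ m
    · rw [mul_comm]
      refine eLpNorm_le_of_norm_le_mul hg.nonneg (fun x => ?_) (hf.l2 (by omega))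
      rw [norm_mul, mul_comm]
      exact mul_le_mul_of_nonneg_right (hg.sup h2 x) (norm_nonneg _)
    · have : ENNReal.HolderTriple 4 4 2 := ⟨by
        rw [← two_mul, show (4 : ENNReal) = 2 * 2 by norm_num, ENNReal.mul_inv (by simp) (by simp),
          ← mul_assoc, ENNReal.mul_inv_cancel (by simp) (by simp), one_mul]⟩
      have h3 := eLpNorm_smul_le_mul_eLpNorm (p := 4) (q := 4) (r := 2) (f := g) (φ := f)
        (μ := volume) hg.cont.aestronglyMeasurable hf.cont.aestronglyMeasurable
      rw [ENNReal.ofReal_mul hf.nonneg]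
      exact h3.trans (mul_le_mul' (hf.l4 (by omega)) (hg.l4 (by omega)))
  l2w hd := by
    by_cases h1 : d + 4 ≤ m
    · refine eLpNorm_le_of_norm_le_mul hf.nonneg (fun x => ?_) (hg.l2w (by omega))
      rw [fld_mul, norm_smul]; exact mul_le_mul_of_nonneg_right (hf.sup h1 x) (norm_nonneg _)
    by_cases h2 : k + 4 ≤ m
    · rw [mul_comm]
      refine eLpNorm_le_of_norm_le_mul hg.nonneg (fun x => ?_) (hf.l2w (by omega))
      rw [fld_mul', norm_smul]
      exact mul_le_mul_of_nonneg_right (hg.sup h2 x) (norm_nonneg _)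
    by_cases h3 : d + 3 ≤ m
    · refine eLpNorm_le_of_norm_le_mul hf.nonneg (fun x => ?_) (hg.l2 (by omega))
      rw [fld_mul', norm_smul, mul_comm]
      exact mul_le_mul_of_nonneg_right (hf.supw h3 x) (norm_nonneg _)
    · rw [mul_comm]
      refine eLpNorm_le_of_norm_le_mul hg.nonneg (fun x => ?_) (hf.l2 (by omega))
      rw [fld_mul, norm_smul, mul_comm]
      exact mul_le_mul_of_nonneg_right (hg.supw (by omega) x) (norm_nonneg _)

end Bd

/-- The bounds on the derivatives of the coefficient of a field in `H^m`. -/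
theorem exists_bd_base (m : ℕ) : ∃ C : ℝ, 0 ≤ C ∧ ∀ (a : E3 → ℝ) (N : ℝ), Test a → 0 ≤ N →
    HB m a N → (∀ (j : Fin 3) (w : List (Fin 3)), Bd m w.length (Dw (j :: w) a) (C * N)) ∧
      (3 ≤ m → ∀ x, |a x| ≤ C * N) := by
  obtain ⟨S, hS, hSob⟩ := exists_sobolev_const
  refine ⟨(4 * S + 4) * (1 + 2 * m), by positivity, fun a N ha hN hB => ?_⟩
  have hl2 := eLpNorm_coeff_le ha hN hB
  have hlow := eLpNorm_Dw_lowerTerms_le ha (m := m) (by positivity) hl2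
  have hm0 : (0 : ℝ) ≤ m := Nat.cast_nonneg m
  have hSN : 0 ≤ S * N := mul_nonneg hS hN
  have hNm : 0 ≤ N * m := mul_nonneg hN hm0
  have hSNm : 0 ≤ S * N * m := mul_nonneg hSN hm0
  -- The Leibniz formula `Dw_fld` read backwards: the weighted derivative is a derivative of the
  -- field minus lower terms, hence `N + m · 2N`.
  have hfld : ∀ u v : List (Fin 3), u.length + v.length ≤ m →
      eLpNorm (Dw u (fld (Dw v a))) 2 volume ≤ ENNReal.ofReal ((1 + 2 * m) * N) := by
    intro u v huv
    have h1 : fld (Dw v a) = Dw v (fld a) - lowerTerms a v := by rw [Dw_fld ha]; simp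
    rw [h1, Dw_sub (ha.fld.Dw v).smooth (test_lowerTerms ha v).smooth, ← Dw_append]
    refine (eLpNorm_sub_le (ha.fld.Dw _).cont.aestronglyMeasurable
      ((test_lowerTerms ha v).Dw u).cont.aestronglyMeasurable (by norm_num)).trans ?_
    rw [show (1 + 2 * m) * N = N + m * (2 * N) by ring, ENNReal.ofReal_add hN (by positivity)]
    refine add_le_add (hB _ (by simpa using huv)) ((hlow v u huv).trans
      (ENNReal.ofReal_le_ofReal ?_))
    have : (v.length : ℝ) ≤ m := by exact_mod_cast (by omega : v.length ≤ m)
    gcongr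
  have hsup : ∀ v : List (Fin 3), v.length + 3 ≤ m → ∀ x, |Dw v a x| ≤ S * (2 * N) := by
    intro v hv
    refine hSob _ _ (ha.Dw v) (by positivity) fun w hw => ?_
    rw [← Dw_append]
    exact hl2 _ (by simp; omega)
  refine ⟨fun j w => ⟨(ha.Dw _).cont, by positivity, ?_, ?_, ?_, ?_, ?_⟩, fun h3 x => ?_⟩
  · intro hd x
    refine (hsup _ (by simp; omega) x).trans ?_
    nlinarith
  · intro hd x
    have hF := (ha.Dw (j :: w)).fld
    let p : Fin 3 → E3 →L[ℝ] ℝ := fun i => EuclideanSpace.proj i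
    have hc : ∀ i, |p i (fld (Dw (j :: w) a) x)| ≤ S * ((1 + 2 * m) * N) := fun i => by
      refine hSob (fun x => p i (fld (Dw (j :: w) a) x)) _
        ⟨(p i).contDiff.comp hF.smooth, hF.supp.comp_left (map_zero _)⟩ (by positivity)
        (fun u hu => ?_) x
      rw [Dw_clm (p i) hF.smooth]
      refine (eLpNorm_mono fun y => ?_).trans (hfld u (j :: w) (by simp; omega))
      exact PiLp.norm_apply_le _ i
    have hn : ‖fld (Dw (j :: w) a) x‖ ≤ ∑ i, |p i (fld (Dw (j :: w) a) x)| := by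
      refine le_of_sq_le_sq ?_ (Finset.sum_nonneg fun _ _ => abs_nonneg _)
      rw [EuclideanSpace.norm_sq_eq]
      exact Finset.sum_sq_le_sq_sum_of_nonneg fun _ _ => abs_nonneg _
    refine hn.trans ((Finset.sum_le_sum fun i _ => hc i).trans ?_)
    simp
    nlinarith
  · intro hd
    -- Interpolates between the sup of `Dw w a` and the `L²` norm of its second derivative; this
    -- reaches one order beyond the sup bound.
    refine (eLpNorm_four_D_le (M := (2 * S + 2) * N) (ha.Dw w) j (by positivity)
      (fun x => (hsup w hd x).trans (by nlinarith)) ?_).trans (ENNReal.ofReal_le_ofReal ?_)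
    · exact (hl2 (j :: j :: w) (by simp; omega)).trans (ENNReal.ofReal_le_ofReal (by nlinarith))
    · nlinarith
  · intro hd
    exact (hl2 (j :: w) (by simp; omega)).trans (ENNReal.ofReal_le_ofReal (by nlinarith))
  · intro hd
    exact (hfld [] (j :: w) (by simp; omega)).trans (ENNReal.ofReal_le_ofReal (by nlinarith))
  · exact (hsup [] (by simpa using h3) x).trans (by nlinarith)

end

/-! ### The algebra of expressions produced by the chain rule -/

section

/-- The Jacobian determinant of the shear `x ↦ x - 2 t a(x) e_z`. -/
def jac (t : ℝ) (a : E3 → ℝ) (x : E3) : ℝ := 1 - 2 * t * D 2 a x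

/-- The characteristics issued from `a` are far from crossing at time `t`. -/
def Adm (t : ℝ) (a : E3 → ℝ) : Prop := ∀ x, 1 / 2 ≤ jac t a x

theorem Adm.pos {t : ℝ} {a : E3 → ℝ} (h : Adm t a) (x : E3) : 0 < jac t a x :=
  lt_of_lt_of_le (by norm_num) (h x)

theorem adm_zero (t : ℝ) : Adm t 0 := fun x => by simp [jac]; norm_num

theorem contDiff_jac {t : ℝ} {a : E3 → ℝ} (ha : ContDiff ℝ ∞ a) : ContDiff ℝ ∞ (jac t a) :=
  contDiff_const.sub (contDiff_const.mul (contDiff_D ha 2))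

theorem D_jac {t : ℝ} {a : E3 → ℝ} (ha : ContDiff ℝ ∞ a) (j : Fin 3) :
    D j (jac t a) = fun x => -(2 * t * D j (D 2 a) x) := by
  have h1 : Differentiable ℝ fun x => (2 * t) • D 2 a x :=
    (diff_of_smooth (contDiff_D ha 2)).const_smul (2 * t)
  rw [show jac t a = (fun _ => 1) - fun x => (2 * t) • D 2 a x from rfl,
    D_sub (differentiable_const _) h1, D_const, D_const_smul _ (diff_of_smooth (contDiff_D ha 2))]
  ext x; simp

/-- Polynomial expressions in the derivatives of a coefficient, graded by the number of derivatives
in excess of one per factor. -/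
inductive Good : ℕ → (ℝ → (E3 → ℝ) → E3 → ℝ) → Prop
  | base (j : Fin 3) (w : List (Fin 3)) : Good w.length fun _ a => Dw (j :: w) a
  | mul {d k F G} : Good d F → Good k G → Good (d + k) fun t a x => F t a x * G t a x
  | add {d F G} : Good d F → Good d G → Good d fun t a x => F t a x + G t a x
  | smul {d F} (c : ℝ) : Good d F → Good d fun t a x => c * F t a x
  | tmul {d F} : Good d F → Good d fun t a x => t * F t a x
  | jinv {d F} : Good d F → Good d fun t a x => (jac t a x)⁻¹ * F t a x

namespace Good

variable {d : ℕ} {G : ℝ → (E3 → ℝ) → E3 → ℝ}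

/-- Every expression contains at least one derivative of the coefficient. Comparison with `0`
therefore turns Lipschitz bounds into size bounds. -/
theorem zero_right (h : Good d G) (t : ℝ) : G t 0 = 0 := by
  induction h with
  | base j w => exact Dw_zero _
  | mul _ _ h1 h2 => ext x; simp [h1]
  | add _ _ h1 h2 => ext x; simp [h1, h2]
  | smul c _ h => ext x; simp [h]
  | tmul _ h => ext x; simp [h]
  | jinv _ h => ext x; simp [h]

theorem contDiff (h : Good d G) {t : ℝ} {a : E3 → ℝ} (ha : ContDiff ℝ ∞ a) (hA : Adm t a) :
    ContDiff ℝ ∞ (G t a) := by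
  induction h with
  | base j w => exact contDiff_Dw ha _
  | mul _ _ h1 h2 => exact h1.mul h2
  | add _ _ h1 h2 => exact h1.add h2
  | smul c _ h => exact contDiff_const.mul h
  | tmul _ h => exact contDiff_const.mul h
  | jinv _ h => exact ((contDiff_jac ha).inv fun x => (hA.pos x).ne').mul h

theorem continuousOn (h : Good d G) {a : E3 → ℝ} (ha : ContDiff ℝ ∞ a) {I : Set ℝ}
    (hA : ∀ t ∈ I, Adm t a) : ContinuousOn (fun p : ℝ × E3 => G p.1 a p.2) (I ×ˢ univ) := by
  have hc : ∀ f : E3 → ℝ, Continuous f → ContinuousOn (fun p : ℝ × E3 => f p.2) (I ×ˢ univ) :=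
    fun f hf => (hf.comp continuous_snd).continuousOn
  induction h with
  | base j w => exact hc _ (contDiff_Dw ha _).continuous
  | mul _ _ h1 h2 => exact h1.mul h2
  | add _ _ h1 h2 => exact h1.add h2
  | smul c _ h => exact continuousOn_const.mul h
  | tmul _ h => exact continuous_fst.continuousOn.mul h
  | jinv _ h =>
    refine ContinuousOn.mul (ContinuousOn.inv₀ ?_ fun p hp => ((hA p.1 hp.1).pos p.2).ne') h
    exact continuousOn_const.sub ((continuousOn_const.mul continuous_fst.continuousOn).mul
      (hc _ (contDiff_D ha 2).continuous))

/-- The grade rises by exactly one. For `1 / jac` the derivative brings out `2 t ∂_j ∂_z a / jac²`,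
in which the new factor carries two derivatives and so has grade 1. -/
theorem D (h : Good d G) (j : Fin 3) : ∃ G', Good (d + 1) G' ∧ ∀ t a, ContDiff ℝ ∞ a → Adm t a →
    D j (G t a) = G' t a := by
  induction h with
  | base i w => exact ⟨_, base j (i :: w), fun t a _ _ => rfl⟩
  | @mul d k F G hF hG h1 h2 =>
    obtain ⟨F', hF', eF⟩ := h1
    obtain ⟨G', hG', eG⟩ := h2
    have hFG := hF'.mul hG
    rw [Nat.add_right_comm] at hFG
    refine ⟨_, (hF.mul hG').add hFG, fun t a ha hA => ?_⟩
    rw [D_mul (diff_of_smooth (hF.contDiff ha hA)) (diff_of_smooth (hG.contDiff ha hA)), eF t a ha hA,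
      eG t a ha hA]
  | add hF hG h1 h2 =>
    obtain ⟨F', hF', eF⟩ := h1
    obtain ⟨G', hG', eG⟩ := h2
    refine ⟨_, hF'.add hG', fun t a ha hA => ?_⟩
    exact (D_add (diff_of_smooth (hF.contDiff ha hA)) (diff_of_smooth (hG.contDiff ha hA)) j).trans
      (by rw [eF t a ha hA, eG t a ha hA]; rfl)
  | smul c hF h =>
    obtain ⟨F', hF', eF⟩ := h
    refine ⟨_, hF'.smul c, fun t a ha hA => ?_⟩
    exact (D_const_smul c (diff_of_smooth (hF.contDiff ha hA)) j).trans (by rw [eF t a ha hA]; rfl)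
  | tmul hF h =>
    obtain ⟨F', hF', eF⟩ := h
    refine ⟨_, hF'.tmul, fun t a ha hA => ?_⟩
    exact (D_const_smul t (diff_of_smooth (hF.contDiff ha hA)) j).trans (by rw [eF t a ha hA]; rfl)
  | @jinv d F hF h =>
    obtain ⟨F', hF', eF⟩ := h
    refine ⟨_, hF'.jinv.add (((hF.mul (base j [2])).smul 2).tmul.jinv.jinv), fun t a ha hA => ?_⟩
    have hj := contDiff_jac (t := t) ha
    have hji : ContDiff ℝ ∞ fun x => (jac t a x)⁻¹ := hj.inv fun x => (hA.pos x).ne'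
    rw [D_mul (diff_of_smooth hji) (diff_of_smooth (hF.contDiff ha hA)), eF t a ha hA]
    ext x
    have h1 : AxisymEMHD.D j (fun x => (jac t a x)⁻¹) x
        = -(jac t a x ^ 2)⁻¹ * AxisymEMHD.D j (jac t a) x := by
      have := ((hasDerivAt_inv (hA.pos x).ne').comp_hasFDerivAt x
        (diff_of_smooth hj x).hasFDerivAt).fderiv
      simp only [AxisymEMHD.D]
      rw [show (fun x => (jac t a x)⁻¹) = (fun y => y⁻¹) ∘ jac t a from rfl, this]
      simp
    rw [h1, D_jac ha]
    have := (hA.pos x).ne'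
    simp only [Dw_cons, Dw_nil]
    field_simp

/-- Structural induction on differences, with products telescoped as `F(a)G(a) - F(b)G(b) = (F(a) -
F(b)) G(a) + F(b) (G(a) - G(b))`. The individual bounds are the case `b = 0`, `N = K`. -/
theorem bound (h : Good d G) {m : ℕ} (hm : 4 ≤ m) : ∀ K : ℝ, 0 ≤ K → ∃ C : ℝ, 0 ≤ C ∧
    ∀ (t : ℝ) (a b : E3 → ℝ) (N : ℝ), |t| ≤ 1 → Test a → Test b → Adm t a → Adm t b → 0 ≤ N →
      HB m a K → HB m b K → HB m (a - b) N →
      Bd m d (fun x => G t a x - G t b x) (C * N) ∧ Bd m d (G t a) (C * K)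
      ∧ Bd m d (G t b) (C * K) := by
  intro K hK
  suffices hs : ∃ C : ℝ, 0 ≤ C ∧
    ∀ (t : ℝ) (a b : E3 → ℝ) (N : ℝ), |t| ≤ 1 → Test a → Test b → Adm t a → Adm t b → 0 ≤ N →
      HB m a K → HB m b K → HB m (a - b) N → Bd m d (fun x => G t a x - G t b x) (C * N) by
    obtain ⟨C, hC, H⟩ := hs
    have H0 : ∀ (t : ℝ) (a : E3 → ℝ), |t| ≤ 1 → Test a → Adm t a → HB m a K →
        Bd m d (G t a) (C * K) := fun t a ht ha hA hB => by
      have := H t a 0 K ht ha Test.zero hA (adm_zero t) hK hB (fun w _ => by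
        rw [show fld 0 = 0 from funext fun x => zero_smul _ _, Dw_zero]; simp) (by rwa [sub_zero])
      simpa [h.zero_right] using this
    exact ⟨C, hC, fun t a b N ht ha hb hAa hAb hN hBa hBb hBN =>
      ⟨H t a b N ht ha hb hAa hAb hN hBa hBb hBN, H0 t a ht ha hAa hBa, H0 t b ht hb hAb hBb⟩⟩
  have aux : ∀ {d : ℕ} {G : ℝ → (E3 → ℝ) → E3 → ℝ}, Good d G → ∀ C : ℝ, (∀ (t : ℝ)
      (a b : E3 → ℝ) (N : ℝ), |t| ≤ 1 → Test a → Test b → Adm t a → Adm t b → 0 ≤ N →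
      HB m a K → HB m b K → HB m (a - b) N → Bd m d (fun x => G t a x - G t b x) (C * N)) →
      ∀ (t : ℝ) (a : E3 → ℝ), |t| ≤ 1 → Test a → Adm t a → HB m a K →
        Bd m d (G t a) (C * K) := fun {d G} h C H t a ht ha hA hB => by
      have := H t a 0 K ht ha Test.zero hA (adm_zero t) hK hB (fun w _ => by
        rw [show fld 0 = 0 from funext fun x => zero_smul _ _, Dw_zero]; simp) (by rwa [sub_zero])
      simpa [h.zero_right] using this
  obtain ⟨Cb, hCb, Hb⟩ := exists_bd_base m
  induction h with
  | base j w =>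
    refine ⟨Cb, hCb, fun t a b N ht ha hb hAa hAb hN hBa hBb hBN => ?_⟩
    have := (Hb (a - b) N (ha.sub hb) hN hBN).1 j w
    rwa [Dw_sub ha.smooth hb.smooth] at this
  | @mul d k F G hF hG h1 h2 =>
    obtain ⟨C1, hC1, H1⟩ := h1
    obtain ⟨C2, hC2, H2⟩ := h2
    refine ⟨2 * K * C1 * C2, by positivity, fun t a b N ht ha hb hAa hAb hN hBa hBb hBN => ?_⟩
    have e1 := (H1 t a b N ht ha hb hAa hAb hN hBa hBb hBN).mul hm
      (aux hG C2 H2 t a ht ha hAa hBa)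
    have e2 := (aux hF C1 H1 t b ht hb hAb hBb).mul hm
      (H2 t a b N ht ha hb hAa hAb hN hBa hBb hBN)
    have e3 := e1.add e2
    rw [show C1 * N * (C2 * K) + C1 * K * (C2 * N) = 2 * K * C1 * C2 * N by ring] at e3
    convert e3 using 2
    ring
  | add _ _ h1 h2 =>
    obtain ⟨C1, hC1, H1⟩ := h1
    obtain ⟨C2, hC2, H2⟩ := h2
    refine ⟨C1 + C2, by positivity, fun t a b N ht ha hb hAa hAb hN hBa hBb hBN => ?_⟩
    have e3 := (H1 t a b N ht ha hb hAa hAb hN hBa hBb hBN).add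
      (H2 t a b N ht ha hb hAa hAb hN hBa hBb hBN)
    rw [← add_mul] at e3
    convert e3 using 2
    ring
  | smul c _ h =>
    obtain ⟨C, hC, H⟩ := h
    refine ⟨|c| * C, by positivity, fun t a b N ht ha hb hAa hAb hN hBa hBb hBN => ?_⟩
    have e3 := (H t a b N ht ha hb hAa hAb hN hBa hBb hBN).bdd_mul (h := fun _ => c)
      continuous_const (abs_nonneg c) (fun _ => le_rfl)
    rw [← mul_assoc] at e3
    simpa only [mul_sub] using e3
  | tmul _ h =>
    obtain ⟨C, hC, H⟩ := h
    refine ⟨1 * C, by positivity, fun t a b N ht ha hb hAa hAb hN hBa hBb hBN => ?_⟩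
    have e3 := (H t a b N ht ha hb hAa hAb hN hBa hBb hBN).bdd_mul (h := fun _ => t)
      continuous_const zero_le_one (fun _ => ht)
    rw [← mul_assoc] at e3
    simpa only [mul_sub] using e3
  | @jinv d F hF h =>
    obtain ⟨C, hC, H⟩ := h
    refine ⟨2 * C + 8 * K * C * Cb, by positivity,
      fun t a b N ht ha hb hAa hAb hN hBa hBb hBN => ?_⟩
    have hji : ∀ {c : E3 → ℝ}, Test c → Adm t c → Continuous fun x => (jac t c x)⁻¹ :=
      fun hc hA => (contDiff_jac hc.smooth).continuous.inv₀ fun x => (hA.pos x).ne'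
    have hjb : ∀ {c : E3 → ℝ}, Adm t c → ∀ x, |(jac t c x)⁻¹| ≤ 2 := fun hA x => by
      rw [abs_of_pos (inv_pos.2 (hA.pos x))]
      exact inv_le_of_inv_le₀ (by norm_num) (by simpa using hA x)
    have e1 := (H t a b N ht ha hb hAa hAb hN hBa hBb hBN).bdd_mul (hji ha hAa) zero_le_two
      (hjb hAa)
    -- The difference of the inverse Jacobians is `2 t ∂_z(a - b) / (jac a · jac b)`: a factor of
    -- grade 0 times one bounded by `2 · 1 · 2 · 2 = 8`.
    have e2 := (aux hF C H t b ht hb hAb hBb).mul hm ((Hb (a - b) N (ha.sub hb) hN hBN).1 2 [])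
    have e3 := e2.bdd_mul (h := fun x => 2 * t * ((jac t a x)⁻¹ * (jac t b x)⁻¹))
      (continuous_const.mul ((hji ha hAa).mul (hji hb hAb))) (by norm_num : (0 : ℝ) ≤ 8)
      (fun x => by
        rw [abs_mul, abs_mul, abs_mul, abs_two]
        have h1 := mul_le_mul (hjb hAa x) (hjb hAb x) (abs_nonneg _) zero_le_two
        have h2 := mul_le_mul (mul_le_mul_of_nonneg_left ht (zero_le_two (α := ℝ))) h1
          (by positivity) (by norm_num)
        linarith)
    have e4 := e1.add e3
    rw [show 2 * (C * N) + 8 * (C * K * (Cb * N)) = (2 * C + 8 * K * C * Cb) * N by ring] at e4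
    convert e4 using 2 with x
    have ha0 := (hAa.pos x).ne'
    have hb0 := (hAb.pos x).ne'
    simp only [Dw_cons, Dw_nil, D_sub ha.diff hb.diff, Pi.sub_apply]
    field_simp
    simp only [jac]
    ring

end Good

/-- Fields that behave like derivatives of order `n` of a field with a given coefficient. -/
inductive W : ℕ → (ℝ → (E3 → ℝ) → E3 → E3) → Prop
  | zero (n : ℕ) : W n fun _ _ _ => 0
  | wt {d G} : Good d G → W (d + 1) fun t a => fld (G t a)
  | unwt {d G} (c : E3) : Good d G → W (d + 2) fun t a x => G t a x • c
  | add {n F G} : W n F → W n G → W n fun t a x => F t a x + G t a x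

namespace W

variable {n : ℕ} {H : ℝ → (E3 → ℝ) → E3 → E3}

theorem contDiff (h : W n H) {t : ℝ} {a : E3 → ℝ} (ha : ContDiff ℝ ∞ a) (hA : Adm t a) :
    ContDiff ℝ ∞ (H t a) := by
  induction h with
  | zero n => exact contDiff_const
  | wt h => exact (h.contDiff ha hA).smul contDiff_dTheta
  | unwt c h => exact (h.contDiff ha hA).smul contDiff_const
  | add _ _ h1 h2 => exact h1.add h2

theorem continuousOn (h : W n H) {a : E3 → ℝ} (ha : ContDiff ℝ ∞ a) {I : Set ℝ}
    (hA : ∀ t ∈ I, Adm t a) : ContinuousOn (fun p : ℝ × E3 => H p.1 a p.2) (I ×ˢ univ) := by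
  induction h with
  | zero n => exact continuousOn_const
  | wt h =>
    exact (h.continuousOn ha hA).smul
      (contDiff_dTheta.continuous.comp continuous_snd).continuousOn
  | unwt c h => exact (h.continuousOn ha hA).smul continuousOn_const
  | add _ _ h1 h2 => exact h1.add h2

/-- A factor of grade 0, such as `∂_j a / jac`, is free: it does not change the order. -/
theorem mulGood (h : W n H) {G : ℝ → (E3 → ℝ) → E3 → ℝ} (hG : Good 0 G) :
    W n fun t a x => G t a x • H t a x := by
  induction h with
  | zero n => simpa using zero n
  | wt h =>
    convert wt (h.mul hG) using 4 with t a x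
    exact (fld_mul' _ _ x).symm
  | unwt c h =>
    convert unwt c (h.mul hG) using 4 with t a x
    rw [smul_smul, mul_comm]
  | add _ _ h1 h2 => simpa only [smul_add] using h1.add h2

theorem tmul (h : W n H) : W n fun t a x => t • H t a x := by
  induction h with
  | zero n => simpa using zero n
  | wt h =>
    convert wt h.tmul using 4 with t a x
    simp [fld, mul_smul]
  | unwt c h =>
    convert unwt c h.tmul using 4 with t a x
    rw [smul_smul]
  | add _ _ h1 h2 => simpa only [smul_add] using h1.add h2

/-- The shifts `d + 1` and `d + 2` are compatible: when the derivative falls on the weight `∂_θ`,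
the grade stays and the weight is lost, which still counts as one order. -/
theorem D (h : W n H) (j : Fin 3) : ∃ H', W (n + 1) H' ∧ ∀ t a, ContDiff ℝ ∞ a → Adm t a →
    D j (H t a) = H' t a := by
  induction h with
  | zero n => exact ⟨_, zero _, fun t a _ _ => D_zero j⟩
  | wt h =>
    obtain ⟨G', hG', e⟩ := h.D j
    refine ⟨_, (unwt (dTheta (AxisymEMHD.e j)) h).add (wt hG'), fun t a ha hA => ?_⟩
    rw [D_smul_dTheta (diff_of_smooth (h.contDiff ha hA)), e t a ha hA]; rfl
  | unwt c h =>
    obtain ⟨G', hG', e⟩ := h.D j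
    refine ⟨_, unwt c hG', fun t a ha hA => ?_⟩
    have hd := diff_of_smooth (h.contDiff ha hA)
    rw [D_smul hd (differentiable_const c), e t a ha hA, D_const]
    ext1 x
    simp
  | add hF hG h1 h2 =>
    obtain ⟨F', hF', eF⟩ := h1
    obtain ⟨G', hG', eG⟩ := h2
    refine ⟨_, hF'.add hG', fun t a ha hA => ?_⟩
    exact (D_add (diff_of_smooth (hF.contDiff ha hA)) (diff_of_smooth (hG.contDiff ha hA)) j).trans
      (by rw [eF t a ha hA, eG t a ha hA]; rfl)

theorem zero_right (h : W n H) (t : ℝ) : H t 0 = 0 := by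
  induction h with
  | zero n => rfl
  | wt h => ext1 x; simp [h.zero_right, fld]
  | unwt c h => ext1 x; simp [h.zero_right]
  | add _ _ h1 h2 => ext1 x; simp [h1, h2]

/-- Order at most `m` is exactly what `Bd.l2w` needs for weighted terms and `Bd.l2` for unweighted
ones. -/
theorem bound (h : W n H) {m : ℕ} (hm : 4 ≤ m) (hn : n ≤ m) : ∀ K : ℝ, 0 ≤ K → ∃ C : ℝ, 0 ≤ C ∧
    ∀ (t : ℝ) (a b : E3 → ℝ) (N : ℝ), |t| ≤ 1 → Test a → Test b → Adm t a → Adm t b → 0 ≤ N →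
      HB m a K → HB m b K → HB m (a - b) N →
      eLpNorm (H t a - H t b) 2 volume ≤ ENNReal.ofReal (C * N) := by
  intro K hK
  induction h with
  | zero n => exact ⟨0, le_rfl, fun t a b N _ _ _ _ _ _ _ _ _ => by
      rw [sub_self]; simp⟩
  | @wt d G h =>
    obtain ⟨C, hC, H⟩ := h.bound hm K hK
    refine ⟨C, hC, fun t a b N ht ha hb hAa hAb hN hBa hBb hBN => ?_⟩
    have := (H t a b N ht ha hb hAa hAb hN hBa hBb hBN).1.l2w hn
    rwa [show fld (fun x => G t a x - G t b x) = fld (G t a) - fld (G t b) from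
      funext fun x => sub_smul _ _ _] at this
  | @unwt d G c h =>
    obtain ⟨C, hC, H⟩ := h.bound hm K hK
    refine ⟨‖c‖ * C, by positivity, fun t a b N ht ha hb hAa hAb hN hBa hBb hBN => ?_⟩
    rw [mul_assoc]
    refine eLpNorm_le_of_norm_le_mul (norm_nonneg c) (fun x => ?_)
      ((H t a b N ht ha hb hAa hAb hN hBa hBb hBN).1.l2 hn)
    rw [Pi.sub_apply, ← sub_smul, norm_smul, mul_comm]
  | @add n F G hF hG h1 h2 =>
    obtain ⟨C1, hC1, H1⟩ := h1 hn
    obtain ⟨C2, hC2, H2⟩ := h2 hn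
    refine ⟨C1 + C2, by positivity, fun t a b N ht ha hb hAa hAb hN hBa hBb hBN => ?_⟩
    have e : (fun x => F t a x + G t a x) - (fun x => F t b x + G t b x)
        = (F t a - F t b) + (G t a - G t b) := by ext1 x; simp; abel
    have cF := ((hF.contDiff ha.smooth hAa).continuous.sub (hF.contDiff hb.smooth hAb).continuous)
    have cG := ((hG.contDiff ha.smooth hAa).continuous.sub (hG.contDiff hb.smooth hAb).continuous)
    rw [e, add_mul, ENNReal.ofReal_add (by positivity) (by positivity)]
    exact (eLpNorm_add_le cF.aestronglyMeasurable cG.aestronglyMeasurable (by norm_num)).trans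
      (add_le_add (H1 t a b N ht ha hb hAa hAb hN hBa hBb hBN)
        (H2 t a b N ht ha hb hAa hAb hN hBa hBb hBN))

end W

end

/-! ### Characteristics of Burgers' equation and Lagrangian derivatives -/

section

open Filter Topology

variable {V : Type*} [NormedAddCommGroup V] [NormedSpace ℝ V]

/-- At time `t` the characteristics issued from `a` have not crossed, the slope of `a` in the
direction of the axis being at most `L`. -/
structure Slow (L t : ℝ) (a : E3 → ℝ) : Prop where
  diff : Differentiable ℝ a
  slope : ∀ x, |D 2 a x| ≤ L
  small : 4 * |t| * L < 1

/-- The position at time `t` of the characteristic issued from `x`. -/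
def shear (t : ℝ) (a : E3 → ℝ) (x : E3) : E3 := x - (2 * t * a x) • e 2

open Classical in
/-- The solution of Burgers' equation `∂_t A = 2 A ∂_z A` with initial value `a`. -/
def burgers (a : E3 → ℝ) (t : ℝ) (y : E3) : ℝ :=
  -- Under `Slow` the root exists and is unique, so neither the choice nor the default 0 matters.
  if h : ∃ s, s = a (y + (2 * t * s) • e 2) then h.choose else 0

namespace Slow

variable {L t : ℝ} {a : E3 → ℝ}

theorem L_nonneg (h : Slow L t a) : 0 ≤ L := (abs_nonneg _).trans (h.slope 0)

theorem adm (h : Slow L t a) : Adm t a := fun x => by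
  have h1 : |2 * t * D 2 a x| ≤ 2 * |t| * L := by
    rw [abs_mul, abs_mul, abs_two]
    exact mul_le_mul_of_nonneg_left (h.slope x) (by positivity)
  have := le_abs_self (2 * t * D 2 a x)
  have := h.small
  simp only [jac]
  linarith

theorem lip (h : Slow L t a) (y : E3) (s s' : ℝ) :
    |a (y + s • e 2) - a (y + s' • e 2)| ≤ L * |s - s'| := by
  have hd : ∀ r : ℝ, HasDerivAt (fun r : ℝ => a (y + r • e 2)) (D 2 a (y + r • e 2)) r := by
    intro r
    have h1 : HasDerivAt (fun r : ℝ => y + r • e 2) (e 2) r := by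
      simpa using ((hasDerivAt_id r).smul_const (e 2)).const_add y
    exact (h.diff _).hasFDerivAt.comp_hasDerivAt r h1
  have := Convex.norm_image_sub_le_of_norm_hasDerivWithin_le (s := univ) (C := L)
    (fun r _ => (hd r).hasDerivWithinAt) (fun r _ => h.slope _) convex_univ (mem_univ s')
    (mem_univ s)
  simpa using this

/-- Smallness of `4 |t| L` makes the implicit equation a fixed point problem for a
`1/2`-contraction; existence, uniqueness and stability of the root all follow. -/
theorem lip' (h : Slow L t a) (y : E3) (s s' : ℝ) :
    |a (y + (2 * t * s) • e 2) - a (y + (2 * t * s') • e 2)| ≤ 1 / 2 * |s - s'| := by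
  refine (h.lip y _ _).trans ?_
  rw [← mul_sub, abs_mul, abs_mul, abs_two]
  have := h.small
  nlinarith [abs_nonneg (s - s')]

theorem eq_of_fixed (h : Slow L t a) {y : E3} {s s' : ℝ} (hs : s = a (y + (2 * t * s) • e 2))
    (hs' : s' = a (y + (2 * t * s') • e 2)) : s = s' := by
  have := h.lip' y s s'
  rw [← hs, ← hs'] at this
  have h0 := abs_nonneg (s - s')
  exact sub_eq_zero.1 (abs_eq_zero.1 (by linarith))

theorem exists_fixed (h : Slow L t a) (y : E3) : ∃ s, s = a (y + (2 * t * s) • e 2) := by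
  have hc : ContractingWith (1 / 2) fun s => a (y + (2 * t * s) • e 2) := by
    refine ⟨by norm_num, LipschitzWith.of_dist_le_mul fun s s' => ?_⟩
    simpa [Real.dist_eq] using h.lip' y s s'
  exact ⟨_, (hc.fixedPoint_isFixedPt).symm⟩

theorem spec (h : Slow L t a) (y : E3) :
    burgers a t y = a (y + (2 * t * burgers a t y) • e 2) := by
  have := h.exists_fixed y
  simp only [burgers, dif_pos this]
  exact this.choose_spec

theorem eq_burgers (h : Slow L t a) {y : E3} {s : ℝ} (hs : s = a (y + (2 * t * s) • e 2)) :
    burgers a t y = s := h.eq_of_fixed (h.spec y) hs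

theorem burgers_shear (h : Slow L t a) (x : E3) : burgers a t (shear t a x) = a x :=
  h.eq_burgers (by simp [shear])

theorem shear_burgers (h : Slow L t a) (y : E3) :
    shear t a (y + (2 * t * burgers a t y) • e 2) = y := by
  simp [shear, ← h.spec y]

theorem shear_injective (h : Slow L t a) : Function.Injective (shear t a) := fun x y hxy => by
  have h1 : a x = a y := by rw [← h.burgers_shear x, hxy, h.burgers_shear y]
  simpa [shear, h1] using hxy

theorem shear_surjective (h : Slow L t a) : Function.Surjective (shear t a) := fun y =>
  ⟨_, h.shear_burgers y⟩

/-- Implicit function theorem, jointly in time and space: the derivative of `s - a(y + 2 t s e_z)`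
in `s` is the positive Jacobian. Uniqueness of the root identifies the implicit function with
`burgers` near the point. -/
theorem contDiffAt {n : WithTop ℕ∞} (hn : n ≠ 0) (h : Slow L t a) (ha : ContDiff ℝ n a) (y : E3) :
    ContDiffAt ℝ n (fun p : ℝ × E3 => burgers a p.1 p.2) (t, y) := by
  let f : (ℝ × E3) × ℝ → ℝ := fun q => q.2 - a (q.1.2 + (2 * q.1.1 * q.2) • e 2)
  let u : (ℝ × E3) × ℝ := ((t, y), burgers a t y)
  have hf : ContDiff ℝ n f := contDiff_snd.sub (ha.comp (by fun_prop))
  have hu : f u = 0 := sub_eq_zero.2 (h.spec y)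
  set z := y + (2 * t * burgers a t y) • e 2 with hz
  have hc : 0 < 1 - 2 * t * D 2 a z := h.adm.pos z
  have hinv : (fderiv ℝ f u ∘L .inr ℝ (ℝ × E3) ℝ).IsInvertible := by
    have h1 : fderiv ℝ f u ∘L .inr ℝ (ℝ × E3) ℝ
        = (ContinuousLinearEquiv.unitsEquivAut ℝ (Units.mk0 _ hc.ne') : ℝ →L[ℝ] ℝ) := by
      ext
      have h2 : HasDerivAt (fun s : ℝ => y + (2 * t * s) • e 2) ((2 * t) • e 2)
          (burgers a t y) := by
        simpa using (((hasDerivAt_id (burgers a t y)).const_mul (2 * t)).smul_const (e 2)).const_add y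
      have h3 : HasDerivAt (fun s : ℝ => f ((t, y), s)) (1 - 2 * t * D 2 a z) (burgers a t y) := by
        have h4 := (h.diff z).hasFDerivAt.comp_hasDerivAt (burgers a t y) h2
        simp only [map_smul, smul_eq_mul] at h4
        exact (hasDerivAt_id _).sub h4
      have h5 : HasDerivAt (fun s : ℝ => f ((t, y), s)) (fderiv ℝ f u ((0 : ℝ × E3), (1 : ℝ)))
          (burgers a t y) := by
        have h6 : HasDerivAt (fun s : ℝ => (((t, y), s) : (ℝ × E3) × ℝ)) (0, 1) (burgers a t y) :=
          (hasDerivAt_const _ _).prodMk (hasDerivAt_id _)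
        exact ((hf.differentiable hn) u).hasFDerivAt.comp_hasDerivAt (burgers a t y) h6
      simpa using h5.unique h3
    exact ⟨_, h1.symm⟩
  have h1 := hf.contDiffAt.contDiffAt_implicitFunction (u := u) hn hinv
  have h2 := hf.contDiffAt.eventually_apply_implicitFunction (u := u) hn hinv
  have h3 : ∀ᶠ p in 𝓝 u.1, 4 * |p.1| * L < 1 :=
    (by fun_prop : Continuous fun p : ℝ × E3 => 4 * |p.1| * L).continuousAt.eventually_lt
      continuousAt_const h.small
  refine h1.congr_of_eventuallyEq ?_
  filter_upwards [h2, h3] with p hp hp3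
  rw [hu] at hp
  exact (⟨h.diff, h.slope, hp3⟩ : Slow L p.1 a).eq_burgers (sub_eq_zero.1 hp)

theorem contDiff {n : WithTop ℕ∞} (hn : n ≠ 0) (h : Slow L t a) (ha : ContDiff ℝ n a) :
    ContDiff ℝ n (burgers a t) := contDiff_iff_contDiffAt.2 fun y =>
  (h.contDiffAt hn ha y).comp y (contDiffAt_const.prodMk contDiffAt_id)

theorem sub_le (h : Slow L t a) {b : E3 → ℝ} (hb : Slow L t b) {δ : ℝ}
    (hab : ∀ x, |a x - b x| ≤ δ) (y : E3) : |burgers a t y - burgers b t y| ≤ 2 * δ := by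
  have h1 := h.lip' y (burgers a t y) (burgers b t y)
  rw [← h.spec y] at h1
  have h2 := hab (y + (2 * t * burgers b t y) • e 2)
  rw [← hb.spec y] at h2
  have := abs_sub_le (burgers a t y) (a (y + (2 * t * burgers b t y) • e 2)) (burgers b t y)
  linarith

theorem hasFDerivAt_shear (h : Slow L t a) (x : E3) : HasFDerivAt (shear t a)
    (ContinuousLinearMap.id ℝ E3 - ((2 * t) • fderiv ℝ a x).smulRight (e 2)) x :=
  (hasFDerivAt_id x).sub (((h.diff x).hasFDerivAt.const_mul (2 * t)).smul_const (e 2))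

/-- Composition with the shear distorts `L²` norms by a bounded factor. -/
theorem eLpNorm_le {V' : Type*} [NormedAddCommGroup V'] (h : Slow L t a) {g f : E3 → V'}
    (hgf : ∀ x, g (shear t a x) = f x) :
    eLpNorm g 2 volume ≤ 2 * eLpNorm f 2 volume := by
  -- The derivative of the shear is the identity plus a rank one map into the axis direction, a
  -- transvection, so its determinant is one plus a single number.
  have hdet : ∀ x, (ContinuousLinearMap.id ℝ E3
      - ((2 * t) • fderiv ℝ a x).smulRight (e 2) : E3 →L[ℝ] E3).det = jac t a x := fun x => by
    have : ((ContinuousLinearMap.id ℝ E3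
        - ((2 * t) • fderiv ℝ a x).smulRight (e 2) : E3 →L[ℝ] E3) : E3 →ₗ[ℝ] E3)
        = LinearMap.transvection (-((2 * t) • (fderiv ℝ a x : E3 →ₗ[ℝ] ℝ))) (e 2) := by
      ext v
      simp [LinearMap.transvection, sub_eq_add_neg]
    rw [ContinuousLinearMap.det, this, LinearMap.transvection.det]
    simp [jac, D, sub_eq_add_neg]
  have hcv := lintegral_image_eq_lintegral_abs_det_fderiv_mul volume MeasurableSet.univ
    (fun x _ => (h.hasFDerivAt_shear x).hasFDerivWithinAt) (h.shear_injective.injOn)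
    (fun y => ‖g y‖ₑ ^ (2 : ℝ))
  rw [image_univ, h.shear_surjective.range_eq, setLIntegral_univ, setLIntegral_univ] at hcv
  simp only [hdet, hgf] at hcv
  have hle : ∫⁻ y, ‖g y‖ₑ ^ (2 : ℝ) ≤ 2 ^ (2 : ℝ) * ∫⁻ x, ‖f x‖ₑ ^ (2 : ℝ) := by
    rw [hcv, ← lintegral_const_mul' _ _ (by simp)]
    refine lintegral_mono fun x => mul_le_mul_left ?_ _
    -- The Jacobian is even at most `3/2`; 4 is taken for its square root 2.
    have h1 : |jac t a x| ≤ 4 := by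
      rw [abs_of_pos (h.adm.pos x)]
      have h1 : |2 * t * D 2 a x| ≤ 2 * |t| * L := by
        rw [abs_mul, abs_mul, abs_two]
        exact mul_le_mul_of_nonneg_left (h.slope x) (by positivity)
      have := neg_abs_le (2 * t * D 2 a x)
      have := h.small
      simp only [jac]
      linarith
    calc ENNReal.ofReal |jac t a x| ≤ ENNReal.ofReal 4 := ENNReal.ofReal_le_ofReal h1
      _ = 2 ^ (2 : ℝ) := by rw [ENNReal.rpow_two]; norm_num
  simp only [eLpNorm_eq_lintegral_rpow_enorm_toReal two_ne_zero ENNReal.ofNat_ne_top,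
    ENNReal.toReal_ofNat]
  calc _ ≤ (2 ^ (2 : ℝ) * ∫⁻ x, ‖f x‖ₑ ^ (2 : ℝ)) ^ (1 / (2 : ℝ)) :=
        ENNReal.rpow_le_rpow hle (by norm_num)
    _ = _ := by
      rw [ENNReal.mul_rpow_of_nonneg _ _ (by norm_num), ← ENNReal.rpow_mul]
      norm_num

end Slow

/-- The chain rule along the shear. -/
theorem D_shear {t : ℝ} {a : E3 → ℝ} (ha : Differentiable ℝ a) (hA : Adm t a) {v f : E3 → V}
    (hv : Differentiable ℝ v) (h : ∀ x, v (shear t a x) = f x) (j : Fin 3) (x : E3) :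
    D j v (shear t a x) = D j f x + ((jac t a x)⁻¹ * (2 * t * D j a x)) • D 2 f x := by
  have h1 : HasFDerivAt (shear t a)
      (ContinuousLinearMap.id ℝ E3 - ((2 * t) • fderiv ℝ a x).smulRight (e 2)) x :=
    (hasFDerivAt_id x).sub (((ha x).hasFDerivAt.const_mul (2 * t)).smul_const (e 2))
  have h2 := (hv (shear t a x)).hasFDerivAt.comp x h1
  rw [show v ∘ shear t a = f from funext h] at h2
  have h3 : ∀ i, D i f x = D i v (shear t a x) - (2 * t * D i a x) • D 2 v (shear t a x) :=
    fun i => by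
      simp only [D]
      rw [h2.fderiv]
      simp
  have h4 : D 2 f x = jac t a x • D 2 v (shear t a x) := by
    rw [h3 2, jac, sub_smul, one_smul]
  have := (hA.pos x).ne'
  have h5 : (jac t a x)⁻¹ * (2 * t * D j a x) * jac t a x = 2 * t * D j a x := by field_simp
  rw [h4, h3 j, smul_smul, h5, sub_add_cancel]

/-- The field itself is not in the class `W`, its coefficient being undifferentiated. A vertical
derivative ignores `∂_θ` and lands on the coefficient, so the result is a weighted expression of
grade 0 to be differentiated further. -/
theorem exists_W_Dw_D_two : ∀ w : List (Fin 3), ∃ H, W (w.length + 1) H ∧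
    ∀ t a, ContDiff ℝ ∞ a → Adm t a → D 2 (Dw w (fld a)) = H t a
  | [] => ⟨_, W.wt (Good.base 2 []), fun t a ha _ => by
      rw [Dw_nil, D_smul_dTheta (diff_of_smooth ha), dTheta_e_two]
      ext1 x
      simp [fld]⟩
  | j :: w => by
    obtain ⟨H, hH, eH⟩ := exists_W_Dw_D_two w
    obtain ⟨H', hH', eH'⟩ := hH.D j
    refine ⟨H', hH', fun t a ha hA => ?_⟩
    have hF : ContDiff ℝ ∞ (fld a) := ha.smul contDiff_dTheta
    rw [Dw_cons, D_comm (contDiff_Dw hF w), ← eH' t a ha hA,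
      ← eH t a ha hA]

/-- The derivatives of the transported field, in Lagrangian coordinates. -/
theorem exists_W_transport : ∀ w : List (Fin 3), ∃ H, W w.length H ∧
    ∀ (t : ℝ) (a : E3 → ℝ) (v : E3 → E3), ContDiff ℝ ∞ a → Adm t a → ContDiff ℝ ∞ v →
      (∀ x, v (shear t a x) = fld a x) →
      ∀ x, Dw w v (shear t a x) = Dw w (fld a) x + t • H t a x
  | [] => ⟨_, W.zero 0, fun t a v _ _ _ h x => by simp [h]⟩
  | j :: w => by
    obtain ⟨H, hH, eH⟩ := exists_W_transport w
    obtain ⟨H1, hH1, eH1⟩ := hH.D j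
    obtain ⟨H2, hH2, eH2⟩ := hH.D 2
    obtain ⟨H3, hH3, eH3⟩ := exists_W_Dw_D_two w
    have hg := ((Good.base j []).smul 2).jinv
    -- The new remainder is `∂_j H + (2 ∂_j a / jac) (∂_z D^w (a ∂_θ) + t ∂_z H)`, read off from
    -- `D_shear`.
    refine ⟨_, (hH1.add (hH3.mulGood hg)).add (hH2.mulGood hg).tmul, fun t a v ha hA hv h x => ?_⟩
    have hF : ContDiff ℝ ∞ (fld a) := ha.smul contDiff_dTheta
    have hHs := hH.contDiff ha hA (t := t)
    have hs : Differentiable ℝ fun x => t • H t a x := (diff_of_smooth hHs).const_smul t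
    have e1 : ∀ i, D i (fun x => Dw w (fld a) x + t • H t a x)
        = D i (Dw w (fld a)) + fun x => t • D i (H t a) x := fun i =>
      (D_add (diff_of_smooth (contDiff_Dw hF w)) hs i).trans
        (by rw [D_const_smul t (diff_of_smooth hHs)])
    rw [Dw_cons, D_shear (diff_of_smooth ha) hA (diff_of_smooth (contDiff_Dw hv w))
      (eH t a v ha hA hv h) j x, e1 j, e1 2, eH1 t a ha hA, eH2 t a ha hA, eH3 t a ha hA]
    simp only [Pi.add_apply, Dw_cons, Dw_nil]
    module

end

/-! ### Bounds on the transported field in `H^m` -/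

section

open Filter Topology

theorem eLpNorm_le_of_bound_of_support {f : E3 → E3} {s : Set E3} {C : ℝ}
    (hC : 0 ≤ C) (h : ∀ x, ‖f x‖ ≤ C) (h0 : ∀ x, x ∉ s → f x = 0) :
    eLpNorm f 2 volume ≤ ENNReal.ofReal C * volume s ^ (1 / (2 : ℝ)) := by
  have h1 : eLpNorm f 2 volume ≤ eLpNorm (s.indicator fun _ => C) 2 volume := by
    refine eLpNorm_mono fun x => ?_
    by_cases hx : x ∈ s
    · rw [indicator_of_mem hx, Real.norm_of_nonneg hC]; exact h x
    · rw [h0 x hx]; simp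
  refine h1.trans ((eLpNorm_indicator_const_le C 2).trans (le_of_eq ?_))
  rw [← ofReal_norm, Real.norm_of_nonneg hC]
  simp

/-- Uniform continuity in `L²` of the composition with maps close to the identity. -/
theorem exists_delta_comp {T R S : ℝ} {h : ℝ → E3 → E3}
    (hc : ContinuousOn (fun p : ℝ × E3 => h p.1 p.2) (Icc 0 T ×ˢ univ))
    (hs : ∀ t ∈ Icc 0 T, ∀ x, R < ‖x‖ → h t x = 0) {ε : ℝ} (hε : 0 < ε) :
    ∃ δ > 0, ∀ t ∈ Icc 0 T, ∀ t' ∈ Icc 0 T, |t - t'| < δ → ∀ ψ ψ' : E3 → E3,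
      (∀ y, ‖ψ y - y‖ ≤ S) → (∀ y, ‖ψ' y - y‖ ≤ S) → (∀ y, ‖ψ y - ψ' y‖ < δ) →
      eLpNorm (fun y => h t (ψ y) - h t' (ψ' y)) 2 volume ≤ ENNReal.ofReal ε := by
  -- Maps moving points by at most `S` pull the ball of radius `R` back into `B`, and send `B` into
  -- radius `R + 2S`, where uniform continuity is used.
  set B : Set E3 := Metric.closedBall 0 (R + S) with hB
  set q : ENNReal := volume B ^ (1 / (2 : ℝ)) with hq
  have hqt : q ≠ ⊤ := ENNReal.rpow_ne_top_of_nonneg (by norm_num) measure_closedBall_lt_top.ne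
  have hη : 0 < ε / (q.toReal + 1) := div_pos hε (by positivity)
  have hcomp : IsCompact (Icc 0 T ×ˢ Metric.closedBall (0 : E3) (R + S + S)) :=
    isCompact_Icc.prod (isCompact_closedBall _ _)
  have huc := hcomp.uniformContinuousOn_of_continuous
    (hc.mono (prod_mono subset_rfl (subset_univ _)))
  obtain ⟨δ, hδ, H⟩ := Metric.uniformContinuousOn_iff.1 huc _ hη
  refine ⟨δ, hδ, fun t ht t' ht' htt ψ ψ' hψ hψ' hψψ => ?_⟩
  have hzero : ∀ y, y ∉ B → h t (ψ y) - h t' (ψ' y) = 0 := fun y hy => by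
    have hy' : R + S < ‖y‖ := by simpa [hB] using hy
    have h1 : ∀ {φ : E3 → E3}, (∀ y, ‖φ y - y‖ ≤ S) → R < ‖φ y‖ := fun {φ} hφ => by
      have h2 := norm_le_norm_add_norm_sub' y (φ y)
      have h3 := hφ y
      rw [norm_sub_rev] at h3
      linarith
    rw [hs t ht _ (h1 hψ), hs t' ht' _ (h1 hψ'), sub_zero]
  have hbd : ∀ y, ‖h t (ψ y) - h t' (ψ' y)‖ ≤ ε / (q.toReal + 1) := fun y => by
    by_cases hy : y ∈ B
    · have hy' : ‖y‖ ≤ R + S := by simpa [hB] using hy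
      have h1 : ∀ {φ : E3 → E3}, (∀ y, ‖φ y - y‖ ≤ S) →
          φ y ∈ Metric.closedBall (0 : E3) (R + S + S) :=
        fun {φ} hφ => by
          have h2 := norm_le_norm_add_norm_sub' (φ y) y
          have h3 := hφ y
          rw [mem_closedBall_zero_iff]
          linarith
      have := H (t, ψ y) ⟨ht, h1 hψ⟩ (t', ψ' y) ⟨ht', h1 hψ'⟩ (by
        rw [Prod.dist_eq, max_lt_iff]
        exact ⟨by simpa [Real.dist_eq] using htt, by simpa [dist_eq_norm] using hψψ y⟩)
      rw [dist_eq_norm] at this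
      exact this.le
    · rw [hzero y hy, norm_zero]; exact hη.le
  refine (eLpNorm_le_of_bound_of_support hη.le hbd
    hzero).trans ?_
  change ENNReal.ofReal _ * q ≤ _
  have hqq : q = ENNReal.ofReal q.toReal := (ENNReal.ofReal_toReal hqt).symm
  refine (congrArg _ hqq).trans_le ?_
  rw [← ENNReal.ofReal_mul hη.le]
  refine ENNReal.ofReal_le_ofReal ?_
  rw [div_mul_eq_mul_div, div_le_iff₀ (by positivity)]
  have : 0 ≤ q.toReal := ENNReal.toReal_nonneg
  nlinarith

/-- Subtract the two implicit equations: half of the difference of the roots is absorbed on the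
left, which doubles the remaining `δ + 2 L S |t - t'|`. -/
theorem Slow.dist_le {L t t' S : ℝ} {a b : E3 → ℝ} (h : Slow L t a) (hb : Slow L t' b)
    (hS : ∀ x, |b x| ≤ S) {δ : ℝ} (hab : ∀ x, |a x - b x| ≤ δ) (y : E3) :
    |burgers a t y - burgers b t' y| ≤ 2 * δ + 4 * L * S * |t - t'| := by
  set s := burgers a t y with hs
  set s' := burgers b t' y with hs'
  have he : s = a (y + (2 * t * s) • e 2) := h.spec y
  have he' : s' = b (y + (2 * t' * s') • e 2) := hb.spec y
  have h1 := h.lip y (2 * t * s) (2 * t' * s')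
  have h2 := hab (y + (2 * t' * s') • e 2)
  rw [← he] at h1
  rw [← he'] at h2
  have hs'S : |s'| ≤ S := by rw [he']; exact hS _
  have h3 : |2 * t * s - 2 * t' * s'| ≤ 2 * |t| * |s - s'| + 2 * |t - t'| * S := by
    rw [show 2 * t * s - 2 * t' * s' = 2 * t * (s - s') + 2 * (t - t') * s' by ring]
    refine (abs_add_le _ _).trans ?_
    simp only [abs_mul, abs_two]
    gcongr
  have h4 := abs_sub_le s (a (y + (2 * t' * s') • e 2)) s'
  have h5 := mul_le_mul_of_nonneg_left h3 h.L_nonneg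
  have h6 : L * (2 * |t| * |s - s'|) ≤ 1 / 2 * |s - s'| := by
    have := h.small
    nlinarith [abs_nonneg (s - s')]
  nlinarith

theorem Slow.test_burgers {L t : ℝ} {a : E3 → ℝ} (h : Slow L t a) (ha : Test a) :
    Test (burgers a t) := by
  refine ⟨h.contDiff (by simp) ha.smooth, HasCompactSupport.intro
    (ha.supp.isCompact.image (f := shear t a) ?_) fun y hy => ?_⟩
  · exact continuous_id.sub ((continuous_const.mul ha.cont).smul continuous_const)
  · rw [h.spec y]
    by_contra hne
    exact hy ⟨_, subset_tsupport _ hne, h.shear_burgers y⟩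

/-- The foot at time `0` of the characteristic through `y` at time `t`. -/
def foot (a : E3 → ℝ) (t : ℝ) (y : E3) : E3 := y + (2 * t * burgers a t y) • e 2

theorem norm_foot_sub_le {L t S : ℝ} {a : E3 → ℝ} (h : Slow L t a) (hS : ∀ x, |a x| ≤ S)
    (ht : |t| ≤ 1) (y : E3) : ‖foot a t y - y‖ ≤ 2 * S := by
  have : |burgers a t y| ≤ S := by rw [h.spec y]; exact hS _
  simp only [foot, add_sub_cancel_left, norm_smul, Real.norm_eq_abs, abs_mul, abs_two]
  simp
  nlinarith [abs_nonneg t, abs_nonneg (burgers a t y)]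

theorem norm_foot_sub_foot_le {L t t' S : ℝ} {a b : E3 → ℝ} (h : Slow L t a) (hb : Slow L t' b)
    (hS : ∀ x, |b x| ≤ S) (ht : |t| ≤ 1) {δ : ℝ} (hab : ∀ x, |a x - b x| ≤ δ) (y : E3) :
    ‖foot a t y - foot b t' y‖ ≤ 4 * δ + (8 * L * S + 2 * S) * |t - t'| := by
  have h1 := h.dist_le hb hS hab y
  have h2 : |burgers b t' y| ≤ S := by rw [hb.spec y]; exact hS _
  have e1 : foot a t y - foot b t' y
      = (2 * t * (burgers a t y - burgers b t' y) + 2 * (t - t') * burgers b t' y) • e 2 := by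
    simp only [foot]; module
  rw [e1, norm_smul]
  simp only [Real.norm_eq_abs, PiLp.norm_single, norm_one, mul_one]
  refine (abs_add_le _ _).trans ?_
  simp only [abs_mul, abs_two]
  have h3 : |t| * |burgers a t y - burgers b t' y| ≤ 2 * δ + 4 * L * S * |t - t'| :=
    (mul_le_of_le_one_left (abs_nonneg _) ht).trans h1
  have h4 : |t - t'| * |burgers b t' y| ≤ |t - t'| * S := by gcongr
  linarith

/-- The field transported from the field with coefficient `a`, in `H^m`. -/
def sol (m : ℕ) (a : E3 → ℝ) (t : ℝ) : SobolevH m :=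
  open Classical in if h : Test (burgers a t) then toSob m h.fld else 0

theorem Slow.sol_eq {L t : ℝ} {a : E3 → ℝ} (h : Slow L t a) (ha : Test a) (m : ℕ) :
    sol m a t = toSob m (h.test_burgers ha).fld := dif_pos (h.test_burgers ha)

/-- The shear is vertical and `∂_θ` depends only on the horizontal position, so the field is
transported exactly as its coefficient. -/
theorem fld_shear (t : ℝ) (a : E3 → ℝ) {f : E3 → ℝ} {x : E3} (h : f (shear t a x) = a x) :
    fld f (shear t a x) = fld a x := by
  have : dTheta (shear t a x) = dTheta x := by
    ext i; fin_cases i <;> simp [dTheta, shear]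
  simp [fld, h, this]

/-- A bounded family of test coefficients. -/
structure Cls (m : ℕ) (K L S : ℝ) (a : E3 → ℝ) : Prop where
  test : Test a
  hb : HB m a K
  slope : ∀ x, |D 2 a x| ≤ L
  bd : ∀ x, |a x| ≤ S

theorem Cls.slow {m : ℕ} {K L S t : ℝ} {a : E3 → ℝ} (h : Cls m K L S a) (ht : 4 * |t| * L < 1) :
    Slow L t a := ⟨h.test.diff, h.slope, ht⟩

/-- `Dw w v = Dw w (fld a) + t H` along the shear, for the field `v` transported from `fld a`. -/
def IsTransport (w : List (Fin 3)) (H : ℝ → (E3 → ℝ) → E3 → E3) : Prop :=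
  ∀ (t : ℝ) (a : E3 → ℝ) (v : E3 → E3), ContDiff ℝ ∞ a → Adm t a → ContDiff ℝ ∞ v →
      (∀ x, v (shear t a x) = fld a x) →
      ∀ x, Dw w v (shear t a x) = Dw w (fld a) x + t • H t a x

/-- The constants in the Lagrangian estimates. -/
structure Consts (m : ℕ) (K C : ℝ) : Prop where
  nonneg : 0 ≤ C
  lip : ∀ w : List (Fin 3), w.length ≤ m → ∃ H, W w.length H ∧ IsTransport w H ∧
    ∀ (t : ℝ) (a b : E3 → ℝ) (N : ℝ), |t| ≤ 1 → Test a → Test b → Adm t a → Adm t b → 0 ≤ N →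
      HB m a K → HB m b K → HB m (a - b) N →
      eLpNorm (H t a - H t b) 2 volume ≤ ENNReal.ofReal (C * N)

/-- Only finitely many words have length at most `m`; the sum of their constants serves all of them.
-/
theorem exists_consts {m : ℕ} (hm : 4 ≤ m) {K : ℝ} (hK : 0 ≤ K) : ∃ C, Consts m K C := by
  choose H hW hT using exists_W_transport
  have hb := fun w : {w : List (Fin 3) // w.length ≤ m} => (hW w.1).bound hm w.2 K hK
  choose C hC hB using hb
  have hsum : ∀ w : {w : List (Fin 3) // w.length ≤ m},
      C w ≤ ∑ a : DerivIndex m, C ⟨List.ofFn a.2, length_le_of_index a⟩ := fun w => by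
    have := Finset.single_le_sum (f := fun a : DerivIndex m =>
      C ⟨List.ofFn a.2, length_le_of_index a⟩) (fun a _ => hC _) (Finset.mem_univ (indexOf w.1 w.2))
    simpa [indexOf] using this
  refine ⟨∑ a : DerivIndex m, C ⟨List.ofFn a.2, length_le_of_index a⟩,
    Finset.sum_nonneg fun a _ => hC _, fun w hw => ⟨H w, hW w, hT w,
    fun t a b N ht ha hb hAa hAb hN hBa hBb hBN => ?_⟩⟩
  exact (hB ⟨w, hw⟩ t a b N ht ha hb hAa hAb hN hBa hBb hBN).trans
    (ENNReal.ofReal_le_ofReal (mul_le_mul_of_nonneg_right (hsum ⟨w, hw⟩) hN))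

theorem Slow.Dw_burgers {L t : ℝ} {a : E3 → ℝ} (h : Slow L t a) (ha : Test a)
    {w : List (Fin 3)} {H : ℝ → (E3 → ℝ) → E3 → E3} (hH : IsTransport w H) (x : E3) :
    Dw w (fld (burgers a t)) (shear t a x) = Dw w (fld a) x + t • H t a x :=
  hH t a _ ha.smooth h.adm (h.test_burgers ha).fld.smooth
    (fun x => fld_shear t a (h.burgers_shear x)) x

/-- The Lipschitz bound against `b = 0` is linear in the norm of the data. Change of variables gives
`4 (A + B)² ≤ 8A² + 8B²` per index; the time restriction makes the summed remainder at most `N²`,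
and `8 + 1 = 3²`. -/
theorem norm_sol_le {m : ℕ} {K L S C T : ℝ} (hC : Consts m K C) (hT1 : T ≤ 1)
    (hTL : 4 * T * L < 1) (hTC : 8 * (Fintype.card (DerivIndex m)) * (T * C) ^ 2 ≤ 1)
    {a : E3 → ℝ} (ha : Cls m K L S a) {t : ℝ} (ht : t ∈ Icc 0 T) :
    ‖sol m a t‖ ≤ 3 * ‖toSob m ha.test.fld‖ := by
  have ht0 : |t| = t := abs_of_nonneg ht.1
  have hL : 0 ≤ L := (abs_nonneg _).trans (ha.slope 0)
  have ht1 : |t| ≤ 1 := by rw [ht0]; exact ht.2.trans hT1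
  have hslow : Slow L t a := ha.slow (by rw [ht0]; nlinarith [ht.2])
  set N := ‖toSob m ha.test.fld‖ with hN
  have hN0 : 0 ≤ N := norm_nonneg _
  rw [hslow.sol_eq ha.test]
  have hcomp : ∀ i : DerivIndex m,
      ‖(toSob m (hslow.test_burgers ha.test).fld : PiLp 2 fun _ : DerivIndex m => L2) i‖
      ≤ 2 * (‖(toSob m ha.test.fld : PiLp 2 fun _ : DerivIndex m => L2) i‖ + T * C * N) := by
    intro i
    obtain ⟨H, hW, hH, hB⟩ := hC.lip (List.ofFn i.2) (length_le_of_index i)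
    have h0 : ∀ w : List (Fin 3), Dw w (fld 0) = 0 := fun w => by
      rw [show fld 0 = 0 from funext fun x => zero_smul _ _, Dw_zero]
    have h1 := hB t a 0 N ht1 ha.test Test.zero hslow.adm (adm_zero t) hN0 ha.hb
      (fun w _ => by rw [h0]; simp)
      (by rw [sub_zero]; exact fun w hw => eLpNorm_Dw_le ha.test.fld w hw)
    rw [hW.zero_right, sub_zero] at h1
    have h2 : eLpNorm (fun x => t • H t a x) 2 volume ≤ ENNReal.ofReal (T * C * N) := by
      rw [mul_assoc]
      refine eLpNorm_le_of_norm_le_mul (ht.1.trans ht.2) (fun x => ?_) h1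
      rw [norm_smul, Real.norm_eq_abs, ht0]
      exact mul_le_mul_of_nonneg_right ht.2 (norm_nonneg _)
    have hcH : Continuous fun x => t • H t a x :=
      (hW.contDiff ha.test.smooth hslow.adm).continuous.const_smul t
    have hF := (ha.test.fld.Dw (List.ofFn i.2))
    have h3 := hslow.eLpNorm_le (g := Dw (List.ofFn i.2) (fld (burgers a t)))
      (f := fun x => Dw (List.ofFn i.2) (fld a) x + t • H t a x) (hslow.Dw_burgers ha.test hH)
    have h4 := h3.trans (mul_le_mul_right ((eLpNorm_add_le hF.cont.aestronglyMeasurable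
      hcH.aestronglyMeasurable (by norm_num)).trans (add_le_add_right h2 _)) 2)
    rw [norm_toSob_apply, norm_toSob_apply]
    have hTCN : 0 ≤ T * C * N := mul_nonneg (mul_nonneg (ht.1.trans ht.2) hC.nonneg) hN0
    have hfin := (hF.memLp 2).eLpNorm_ne_top
    have h5 := ENNReal.toReal_mono (by finiteness) h4
    rwa [ENNReal.toReal_mul, ENNReal.toReal_add hfin ENNReal.ofReal_ne_top,
      ENNReal.toReal_ofReal hTCN, ENNReal.toReal_ofNat] at h5
  refine le_of_sq_le_sq ?_ (by positivity)
  rw [norm_sq_eq]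
  calc _ ≤ ∑ i : DerivIndex m, (8 * ‖(toSob m ha.test.fld : PiLp 2 fun _ : DerivIndex m => L2) i‖ ^ 2
        + 8 * (T * C * N) ^ 2) := by
        refine Finset.sum_le_sum fun i _ => ?_
        have h1 := pow_le_pow_left₀ (norm_nonneg _) (hcomp i) 2
        refine h1.trans ?_
        nlinarith [sq_nonneg
          (‖(toSob m ha.test.fld : PiLp 2 fun _ : DerivIndex m => L2) i‖ - T * C * N)]
    _ = 8 * N ^ 2 + 8 * Fintype.card (DerivIndex m) * (T * C) ^ 2 * N ^ 2 := by
        rw [Finset.sum_add_distrib, ← Finset.mul_sum, ← norm_sq_eq, Finset.sum_const,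
          Finset.card_univ, nsmul_eq_mul]
        ring
    _ ≤ (3 * N) ^ 2 := by nlinarith [sq_nonneg N]

end

/-! ### Stability of the transported fields and passage to the limit -/

section

open Filter Topology

theorem foot_shear {L t : ℝ} {a : E3 → ℝ} (h : Slow L t a) (x : E3) :
    foot a t (shear t a x) = x := by
  simp only [foot, h.burgers_shear x]
  simp [shear]

theorem Slow.continuous_foot {L t : ℝ} {a : E3 → ℝ} (h : Slow L t a) (ha : Test a) :
    Continuous (foot a t) :=
  continuous_id.add ((continuous_const.mul (h.test_burgers ha).cont).smul continuous_const)

/-- The Lagrangian expression is a derivative of the transported field seen through the shear, so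
its support is that of the data. This compactness is what `exists_delta_comp` requires. -/
theorem Slow.transport_eq_zero {L t : ℝ} {a : E3 → ℝ} (h : Slow L t a) (ha : Test a)
    {w : List (Fin 3)} {H : ℝ → (E3 → ℝ) → E3 → E3} (hH : IsTransport w H) {x : E3}
    (hx : x ∉ tsupport a) : Dw w (fld a) x + t • H t a x = 0 := by
  rw [← h.Dw_burgers ha hH x]
  refine image_eq_zero_of_notMem_tsupport fun hmem => ?_
  have h1 : tsupport (burgers a t) ⊆ shear t a '' tsupport a := by
    have hcomp : IsCompact (shear t a '' tsupport a) := ha.supp.isCompact.image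
      (continuous_id.sub ((continuous_const.mul ha.cont).smul continuous_const))
    refine closure_minimal (fun y hy => ?_) hcomp.isClosed
    rw [Function.mem_support, h.spec y] at hy
    exact ⟨_, subset_tsupport _ hy, h.shear_burgers y⟩
  obtain ⟨x', hx', e⟩ := h1 (tsupport_smul_subset_left _ _ (tsupport_Dw_subset _ w hmem))
  exact hx (h.shear_injective e ▸ hx')

/-- The expression of `c` is evaluated along the characteristics of `a`, not its own. Both terms
then have the same foot, and one change of variables gives a bound by `‖a - c‖` without loss of a
derivative. -/
theorem eLpNorm_Dw_burgers_sub_le {m : ℕ} {K L S C T : ℝ} (hC : Consts m K C) (hT1 : T ≤ 1)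
    (hTL : 4 * T * L < 1) {w : List (Fin 3)} {H : ℝ → (E3 → ℝ) → E3 → E3}
    (hW : W w.length H) (hw : w.length ≤ m)
    (hH : IsTransport w H)
    (hB : ∀ (t : ℝ) (a b : E3 → ℝ) (N : ℝ), |t| ≤ 1 → Test a → Test b → Adm t a → Adm t b → 0 ≤ N →
      HB m a K → HB m b K → HB m (a - b) N →
      eLpNorm (H t a - H t b) 2 volume ≤ ENNReal.ofReal (C * N))
    {a c : E3 → ℝ} (ha : Cls m K L S a) (hc : Cls m K L S c) {t : ℝ} (ht : t ∈ Icc 0 T) {N : ℝ}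
    (hN : 0 ≤ N) (hac : HB m (a - c) N) :
    eLpNorm (fun y => Dw w (fld (burgers a t)) y
      - (Dw w (fld c) (foot a t y) + t • H t c (foot a t y))) 2 volume
      ≤ ENNReal.ofReal (2 * ((1 + C) * N)) := by
  have ht0 : |t| = t := abs_of_nonneg ht.1
  have hL : 0 ≤ L := (abs_nonneg _).trans (ha.slope 0)
  have ht1 : |t| ≤ 1 := by rw [ht0]; exact ht.2.trans hT1
  have htL : 4 * |t| * L < 1 := by rw [ht0]; nlinarith [ht.2]
  have hsa := ha.slow htL
  have hsc := hc.slow htL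
  have h1 := hsa.eLpNorm_le (f := fun x => (Dw w (fld a) x - Dw w (fld c) x)
      + t • (H t a x - H t c x)) (g := fun y => Dw w (fld (burgers a t)) y
      - (Dw w (fld c) (foot a t y) + t • H t c (foot a t y))) fun x => by
    rw [hsa.Dw_burgers ha.test hH, foot_shear hsa]
    module
  have h2 : eLpNorm (fun x => Dw w (fld a) x - Dw w (fld c) x) 2 volume ≤ ENNReal.ofReal N := by
    have := hac w hw
    rwa [show fld (a - c) = fld a - fld c from funext fun x => sub_smul _ _ _,
      Dw_sub ha.test.fld.smooth hc.test.fld.smooth] at this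
  have h3 : eLpNorm (fun x => t • (H t a x - H t c x)) 2 volume ≤ ENNReal.ofReal (1 * (C * N)) := by
    refine eLpNorm_le_of_norm_le_mul zero_le_one (fun x => ?_)
      (hB t a c N ht1 ha.test hc.test hsa.adm hsc.adm hN ha.hb hc.hb hac)
    rw [norm_smul, Real.norm_eq_abs, Pi.sub_apply]
    gcongr
  have hcont1 : Continuous fun x => Dw w (fld a) x - Dw w (fld c) x :=
    (ha.test.fld.Dw w).cont.sub (hc.test.fld.Dw w).cont
  have hcont2 : Continuous fun x => t • (H t a x - H t c x) :=
    ((hW.contDiff ha.test.smooth hsa.adm).continuous.sub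
      (hW.contDiff hc.test.smooth hsc.adm).continuous).const_smul t
  have hCN : 0 ≤ C * N := mul_nonneg hC.nonneg hN
  refine h1.trans ?_
  rw [ENNReal.ofReal_mul (by norm_num), ENNReal.ofReal_ofNat, add_mul, one_mul,
    ENNReal.ofReal_add hN hCN]
  refine mul_le_mul_right ?_ 2
  refine (eLpNorm_add_le hcont1.aestronglyMeasurable hcont2.aestronglyMeasurable
    (by norm_num)).trans (add_le_add h2 ?_)
  rwa [one_mul] at h3

/-- Stability of the transported fields in the initial coefficient and in time. -/
theorem exists_delta_Dw {m : ℕ} {K L S C T : ℝ} (hC : Consts m K C) (hT1 : T ≤ 1)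
    (hTL : 4 * T * L < 1) {w : List (Fin 3)} (hw : w.length ≤ m) {c : E3 → ℝ}
    (hc : Cls m K L S c) {ε : ℝ} (hε : 0 < ε) :
    ∃ δ > 0, ∀ a b : E3 → ℝ, Cls m K L S a → Cls m K L S b → ∀ t ∈ Icc 0 T, ∀ t' ∈ Icc 0 T,
      |t - t'| < δ → (∀ x, |a x - b x| ≤ δ) → ∀ N, 0 ≤ N → HB m (a - c) N → HB m (b - c) N →
      eLpNorm (Dw w (fld (burgers a t)) - Dw w (fld (burgers b t'))) 2 volume
        ≤ ENNReal.ofReal (4 * ((1 + C) * N) + ε) := by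
  obtain ⟨H, hW, hH, hB⟩ := hC.lip w hw
  have hL : 0 ≤ L := (abs_nonneg _).trans (hc.slope 0)
  have hS : 0 ≤ S := (abs_nonneg _).trans (hc.bd 0)
  have hsmall : ∀ t ∈ Icc 0 T, 4 * |t| * L < 1 := fun t ht => by
    rw [abs_of_nonneg ht.1]; nlinarith [ht.2]
  have habs : ∀ t ∈ Icc 0 T, |t| ≤ 1 := fun t ht => by
    rw [abs_of_nonneg ht.1]; exact ht.2.trans hT1
  obtain ⟨R, hR⟩ := hc.test.supp.isCompact.isBounded.subset_closedBall (0 : E3)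
  have hcont : ContinuousOn (fun p : ℝ × E3 => Dw w (fld c) p.2 + p.1 • H p.1 c p.2)
      (Icc 0 T ×ˢ univ) :=
    (((hc.test.fld.Dw w).cont.comp continuous_snd).continuousOn).add
      (continuousOn_fst.smul (hW.continuousOn hc.test.smooth
        fun t ht => (hc.slow (hsmall t ht)).adm))
  obtain ⟨δ, hδ, hδH⟩ := exists_delta_comp (S := 2 * S) (R := R)
    (h := fun t x => Dw w (fld c) x + t • H t c x) hcont
    (fun t ht x hx => (hc.slow (hsmall t ht)).transport_eq_zero hc.test hH fun hmem => by
      have := hR hmem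
      rw [mem_closedBall_zero_iff] at this
      linarith) hε
  have hD : 0 < 5 + (8 * L * S + 2 * S) := by positivity
  -- The feet differ by at most `4η + (8LS + 2S) |t - t'|`; the 5 in place of 4 makes this strictly
  -- less than `δ`.
  refine ⟨δ / (5 + (8 * L * S + 2 * S)), div_pos hδ hD,
    fun a b ha hb t ht t' ht' htt hab N hN hac hbc => ?_⟩
  set η := δ / (5 + (8 * L * S + 2 * S)) with hη
  have hηpos : 0 < η := div_pos hδ hD
  have hηe : η * (5 + (8 * L * S + 2 * S)) = δ := div_mul_cancel₀ _ hD.ne'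
  have hsa := ha.slow (hsmall t ht)
  have hsb := hb.slow (hsmall t' ht')
  have hLS : 0 ≤ 8 * L * S + 2 * S := by positivity
  have h3 := hδH t ht t' ht' (by nlinarith) (foot a t) (foot b t')
    (norm_foot_sub_le hsa ha.bd (habs t ht)) (norm_foot_sub_le hsb hb.bd (habs t' ht'))
    (fun y => by
      refine (norm_foot_sub_foot_le hsa hsb hb.bd (habs t ht) hab y).trans_lt ?_
      nlinarith [abs_nonneg (t - t')])
  have h1 := eLpNorm_Dw_burgers_sub_le hC hT1 hTL hW hw hH hB ha hc ht hN hac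
  have h2 := eLpNorm_Dw_burgers_sub_le hC hT1 hTL hW hw hH hB hb hc ht' hN hbc
  have hmc : ∀ {a' : E3 → ℝ} {s : ℝ}, Cls m K L S a' → s ∈ Icc 0 T → Continuous fun y =>
      Dw w (fld c) (foot a' s y) + s • H s c (foot a' s y) := fun {a' s} ha' hs =>
    ((hc.test.fld.Dw w).cont.add ((hW.contDiff hc.test.smooth
      (hc.slow (hsmall s hs)).adm).continuous.const_smul s)).comp
      ((ha'.slow (hsmall s hs)).continuous_foot ha'.test)
  have hma : Continuous (Dw w (fld (burgers a t))) :=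
    ((hsa.test_burgers ha.test).fld.Dw w).cont
  have hmb : Continuous (Dw w (fld (burgers b t'))) :=
    ((hsb.test_burgers hb.test).fld.Dw w).cont
  have e : Dw w (fld (burgers a t)) - Dw w (fld (burgers b t'))
      = (fun y => Dw w (fld (burgers a t)) y
          - (Dw w (fld c) (foot a t y) + t • H t c (foot a t y)))
        + (fun y => (Dw w (fld c) (foot a t y) + t • H t c (foot a t y))
          - (Dw w (fld c) (foot b t' y) + t' • H t' c (foot b t' y)))
        - fun y => Dw w (fld (burgers b t')) y
          - (Dw w (fld c) (foot b t' y) + t' • H t' c (foot b t' y)) := by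
    ext1 y
    simp only [Pi.sub_apply, Pi.add_apply]
    abel
  have hCN : 0 ≤ (1 + C) * N := mul_nonneg (by linarith [hC.nonneg]) hN
  rw [e, show 4 * ((1 + C) * N) + ε = 2 * ((1 + C) * N) + ε + 2 * ((1 + C) * N) by ring,
    ENNReal.ofReal_add (by positivity) (by positivity),
    ENNReal.ofReal_add (by positivity) (by positivity)]
  refine (eLpNorm_sub_le (((hma.sub (hmc ha ht)).add
    ((hmc ha ht).sub (hmc hb ht')))).aestronglyMeasurable
    (hmb.sub (hmc hb ht')).aestronglyMeasurable (by norm_num)).trans (add_le_add ?_ h2)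
  exact (eLpNorm_add_le (hma.sub (hmc ha ht)).aestronglyMeasurable
    ((hmc ha ht).sub (hmc hb ht')).aestronglyMeasurable (by norm_num)).trans (add_le_add h1 h3)

theorem exists_delta_sol {m : ℕ} {K L S C T : ℝ} (hC : Consts m K C) (hT1 : T ≤ 1)
    (hTL : 4 * T * L < 1) {c : E3 → ℝ} (hc : Cls m K L S c) {ε : ℝ} (hε : 0 < ε) :
    ∃ δ > 0, ∀ a b : E3 → ℝ, Cls m K L S a → Cls m K L S b → ∀ t ∈ Icc 0 T, ∀ t' ∈ Icc 0 T,
      |t - t'| < δ → (∀ x, |a x - b x| ≤ δ) → ∀ N, 0 ≤ N → HB m (a - c) N → HB m (b - c) N →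
      ‖sol m a t - sol m b t'‖
        ≤ Fintype.card (DerivIndex m) * (4 * ((1 + C) * N) + ε) := by
  have hsmall : ∀ t ∈ Icc 0 T, 4 * |t| * L < 1 := fun t ht => by
    have hL : 0 ≤ L := (abs_nonneg _).trans (hc.slope 0)
    rw [abs_of_nonneg ht.1]; nlinarith [ht.2]
  choose δ hδ H using fun i : DerivIndex m =>
    exists_delta_Dw hC hT1 hTL (length_le_of_index i) hc hε
  obtain ⟨η, hη, hηδ⟩ : ∃ η > 0, ∀ i, η ≤ δ i := by
    have : Nonempty (DerivIndex m) := ⟨idIndex m⟩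
    obtain ⟨i, hi⟩ := Finite.exists_min (α := DerivIndex m) δ
    exact ⟨δ i, hδ i, hi⟩
  refine ⟨η, hη, fun a b ha hb t ht t' ht' htt hab N hN hac hbc => ?_⟩
  have hCN : 0 ≤ (1 + C) * N := mul_nonneg (by linarith [hC.nonneg]) hN
  rw [(ha.slow (hsmall t ht)).sol_eq ha.test, (hb.slow (hsmall t' ht')).sol_eq hb.test, ← toSob_sub]
  refine (norm_le_sum _).trans ?_
  rw [← nsmul_eq_mul, ← Finset.card_univ]
  refine Finset.sum_le_card_nsmul _ _ _ fun i _ => ?_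
  rw [norm_toSob_apply]
  refine ENNReal.toReal_le_of_le_ofReal (by positivity) ?_
  rw [Dw_sub ((ha.slow (hsmall t ht)).test_burgers ha.test).fld.smooth
    ((hb.slow (hsmall t' ht')).test_burgers hb.test).fld.smooth]
  exact H i a b ha hb t ht t' ht' (htt.trans_le (hηδ i)) (fun x => (hab x).trans (hηδ i)) N hN
    hac hbc

theorem HB_sub_self (m : ℕ) (a : E3 → ℝ) : HB m (a - a) 0 := fun w _ => by
  rw [sub_self, show fld 0 = 0 from funext fun x => zero_smul _ _, Dw_zero]
  simp

/-- Stability with the coefficient as its own reference, hence `N = 0`. -/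
theorem Cls.continuousOn_sol {m : ℕ} {K L S C T : ℝ} (hC : Consts m K C) (hT1 : T ≤ 1)
    (hTL : 4 * T * L < 1) {a : E3 → ℝ} (ha : Cls m K L S a) : ContinuousOn (sol m a) (Icc 0 T) := by
  rw [Metric.continuousOn_iff]
  intro t' ht' ε hε
  obtain ⟨δ, hδ, H⟩ := exists_delta_sol hC hT1 hTL ha
    (ε := ε / (Fintype.card (DerivIndex m) + 1)) (by positivity)
  refine ⟨δ, hδ, fun t ht htt => ?_⟩
  rw [dist_eq_norm]
  refine (H a a ha ha t ht t' ht' htt (fun x => by simpa using hδ.le) 0 le_rfl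
    (HB_sub_self m a) (HB_sub_self m a)).trans_lt ?_
  rw [mul_zero, mul_zero, zero_add, mul_div_assoc', div_lt_iff₀ (by positivity)]
  nlinarith

theorem HB_of_norm_sub_le {m : ℕ} {a c : E3 → ℝ} (ha : Test a) (hc : Test c) {N : ℝ}
    (h : ‖toSob m ha.fld - toSob m hc.fld‖ ≤ N) : HB m (a - c) N := fun w hw => by
  rw [show fld (a - c) = fld a - fld c from funext fun x => sub_smul _ _ _]
  refine (eLpNorm_Dw_le (ha.fld.sub hc.fld) w hw).trans (ENNReal.ofReal_le_ofReal ?_)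
  rwa [toSob_sub]

/-- The modulus of continuity depends on the reference coefficient, so the order of choices matters:
a reference `a k₀` close to the tail in `H^m`, then its `δ`, then a tail whose members are `δ`-close
in sup norm. -/
theorem uniformCauchySeqOn_sol {m : ℕ} (hm : 4 ≤ m) {K L S C T : ℝ} (hC : Consts m K C)
    (hT1 : T ≤ 1) (hTL : 4 * T * L < 1) {a : ℕ → E3 → ℝ} (ha : ∀ k, Cls m K L S (a k))
    (hcau : CauchySeq fun k => toSob m (ha k).test.fld) :
    UniformCauchySeqOn (fun k => sol m (a k)) atTop (Icc 0 T) := by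
  rw [Metric.uniformCauchySeqOn_iff]
  intro ε hε
  set n : ℝ := ((Fintype.card (DerivIndex m) : ℕ) : ℝ) with hn
  have hn0 : 0 ≤ n := Nat.cast_nonneg _
  have hC0 := hC.nonneg
  obtain ⟨Cb, hCb, hbase⟩ := exists_bd_base m
  have hN : 0 < ε / (2 * n + 1) / (4 * (1 + C)) := by positivity
  set N := ε / (2 * n + 1) / (4 * (1 + C)) with hNdef
  obtain ⟨k₀, hk₀⟩ := Metric.cauchySeq_iff.1 hcau N hN
  obtain ⟨δ, hδ, H⟩ := exists_delta_sol hC hT1 hTL (ha k₀) (ε := ε / (2 * n + 1)) (by positivity)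
  obtain ⟨k₁, hk₁⟩ := Metric.cauchySeq_iff.1 hcau (δ / (Cb + 1)) (by positivity)
  refine ⟨max k₀ k₁, fun k hk l hl t ht => ?_⟩
  rw [dist_eq_norm]
  have hHB : ∀ k ≥ max k₀ k₁, HB m (a k - a k₀) N := fun k hk => by
    refine HB_of_norm_sub_le (ha k).test (ha k₀).test ?_
    rw [← dist_eq_norm]
    exact (hk₀ k (le_trans (le_max_left _ _) hk) k₀ le_rfl).le
  have hkl : HB m (a k - a l) (δ / (Cb + 1)) := by
    refine HB_of_norm_sub_le (ha k).test (ha l).test ?_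
    rw [← dist_eq_norm]
    exact (hk₁ k (le_trans (le_max_right _ _) hk) l (le_trans (le_max_right _ _) hl)).le
  have hsup : ∀ x, |a k x - a l x| ≤ δ := fun x => by
    refine ((hbase _ _ ((ha k).test.sub (ha l).test) (by positivity) hkl).2 (by omega) x).trans ?_
    rw [mul_div_assoc', div_le_iff₀ (by positivity)]
    nlinarith
  refine (H (a k) (a l) (ha k) (ha l) t ht t ht (by simpa using hδ) hsup N hN.le (hHB k hk)
    (hHB l hl)).trans_lt ?_
  have e1 : 4 * ((1 + C) * N) = ε / (2 * n + 1) := by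
    rw [hNdef]; field_simp
  rw [e1, ← hn, ← two_mul, mul_div_assoc', mul_div_assoc', div_lt_iff₀ (by positivity)]
  nlinarith

theorem burgers_zero {L : ℝ} {a : E3 → ℝ} (h : Slow L 0 a) : burgers a 0 = a :=
  funext fun y => by rw [h.spec y]; simp

theorem toSob_congr {m : ℕ} {f g : E3 → E3} (hf : Test f) (hg : Test g) (h : f = g) :
    toSob m hf = toSob m hg := by
  subst h; rfl

theorem sol_zero {m : ℕ} {a : E3 → ℝ} {L : ℝ} (h : Slow L 0 a) (ha : Test a) :
    sol m a 0 = toSob m ha.fld := by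
  rw [h.sol_eq ha]
  exact toSob_congr _ _ (by rw [burgers_zero h])

theorem exists_limit_sol {m : ℕ} (hm : 4 ≤ m) {K L S C T : ℝ} (hC : Consts m K C) (hT0 : 0 ≤ T)
    (hT1 : T ≤ 1) (hTL : 4 * T * L < 1)
    (hTC : 8 * (Fintype.card (DerivIndex m)) * (T * C) ^ 2 ≤ 1) {a : ℕ → E3 → ℝ}
    (ha : ∀ k, Cls m K L S (a k)) {u₀ : SobolevH m}
    (hlim : Tendsto (fun k => toSob m (ha k).test.fld) atTop (𝓝 u₀)) :
    ∃ u : ℝ → SobolevH m, ContinuousOn u (Icc 0 T) ∧ u 0 = u₀ ∧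
      (∀ t ∈ Icc 0 T, ‖u t‖ ≤ 3 * ‖u₀‖) ∧
      ∀ t ∈ Icc 0 T, Tendsto (fun k => sol m (a k) t) atTop (𝓝 (u t)) := by
  have hcau := uniformCauchySeqOn_sol hm hC hT1 hTL ha hlim.cauchySeq
  have hex : ∀ t, ∃ v, t ∈ Icc 0 T → Tendsto (fun k => sol m (a k) t) atTop (𝓝 v) := fun t => by
    by_cases ht : t ∈ Icc 0 T
    · obtain ⟨v, hv⟩ := cauchySeq_tendsto_of_complete (hcau.cauchySeq ht)
      exact ⟨v, fun _ => hv⟩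
    · exact ⟨0, fun h => absurd h ht⟩
  choose u hu using hex
  have h0 : (0 : ℝ) ∈ Icc 0 T := ⟨le_rfl, hT0⟩
  refine ⟨u, ?_, ?_, fun t ht => ?_, hu⟩
  · exact (hcau.tendstoUniformlyOn_of_tendsto hu).continuousOn
      (Frequently.of_forall fun k => (ha k).continuousOn_sol hC hT1 hTL)
  · refine tendsto_nhds_unique (hu 0 h0) (hlim.congr fun k => ?_)
    exact (sol_zero ((ha k).slow (t := 0) (by simp)) (ha k).test).symm
  · exact le_of_tendsto_of_tendsto' (hu t ht).norm (hlim.norm.const_mul 3)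
      fun k => norm_sol_le hC hT1 hTL hTC (ha k) ht

end

/-! ### Smooth division by `∂_θ` -/

section

open Filter Topology

theorem contDiff_integral_param {F : E3 × ℝ → ℝ} (hF : ContDiff ℝ ∞ F) :
    ContDiff ℝ ∞ fun x => ∫ s in (0 : ℝ)..1, F (x, s) := by
  let χ : ContDiffBump (0 : ℝ) := ⟨2, 3, by norm_num, by norm_num⟩
  -- The integral is the convolution, at 0, of the indicator of `(0, 1]` with this kernel. The
  -- cutoff equals 1 where it is evaluated, and makes the kernel compactly supported in `u`.
  let g : E3 → ℝ → ℝ := fun x u => χ u * F (x, -u)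
  have hg : ContDiff ℝ ∞ (Function.uncurry g) :=
    (χ.contDiff.comp contDiff_snd).mul (hF.comp (contDiff_fst.prodMk contDiff_snd.neg))
  have hf : LocallyIntegrable ((Ioc (0 : ℝ) 1).indicator fun _ => (1 : ℝ)) volume :=
    (integrable_indicator_iff measurableSet_Ioc).2 (by simp) |>.locallyIntegrable
  have h := contDiffOn_convolution_right_with_param_comp (n := ⊤) (s := univ)
    (ContinuousLinearMap.mul ℝ ℝ) (contDiffOn_const (c := (0 : ℝ))) isOpen_univ
    χ.hasCompactSupport.isCompact
    (g := g) (fun p x _ hx => by simp [g, image_eq_zero_of_notMem_tsupport hx]) hf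
    hg.contDiffOn
  refine (contDiffOn_univ.1 (h.congr fun x _ => ?_))
  rw [convolution_def, intervalIntegral.integral_of_le zero_le_one,
    ← integral_indicator measurableSet_Ioc]
  refine integral_congr_ae (Eventually.of_forall fun s => ?_)
  by_cases hs : s ∈ Ioc (0 : ℝ) 1
  · have : χ (0 - s) = 1 := χ.one_of_mem_closedBall (by
      rw [mem_closedBall_zero_iff, zero_sub, norm_neg, Real.norm_of_nonneg hs.1.le]
      exact hs.2.trans (by norm_num))
    simp only [indicator_of_mem hs, g, this, ContinuousLinearMap.mul_apply']
    simp
  · simp [indicator_of_notMem hs]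

theorem eq_zero_of_forall_ne {f : E3 → ℝ} (hf : Continuous f) (x : E3) (j : Fin 3)
    (h : ∀ s : ℝ, s ≠ 0 → f (x + s • e j) = 0) : f x = 0 := by
  have hc : Continuous fun s : ℝ => f (x + s • e j) := by fun_prop
  have := hc.ext_on (dense_compl_singleton (0 : ℝ)) (continuous_const (y := (0 : ℝ)))
    fun s hs => h s hs
  simpa using congrFun this 0

/-- A smooth field which is everywhere tangent to the rotations is a smooth multiple of `∂_θ`. -/
theorem exists_eq_fld {v : E3 → E3} (hv : ContDiff ℝ ∞ v)
    (h0 : ∀ x, x 0 * v x 0 + x 1 * v x 1 = 0) (h2 : ∀ x, v x 2 = 0) :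
    ∃ a : E3 → ℝ, ContDiff ℝ ∞ a ∧ v = fld a := by
  have hcomp : ∀ i, ContDiff ℝ ∞ fun x => v x i := fun i => by fun_prop
  set g : E3 → ℝ := fun x => v x 1 with hg
  have hgs : ContDiff ℝ ∞ g := hcomp 1
  -- Hadamard's lemma: `p x s` is `x` with first coordinate scaled by `s`, and the second component
  -- of `v` vanishes on `x 0 = 0`, so it equals `x 0` times this integral.
  set p : E3 → ℝ → E3 := fun x s => x + ((s - 1) * x 0) • e 0 with hp
  set a : E3 → ℝ := fun x => ∫ s in (0 : ℝ)..1, D 0 g (p x s) with ha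
  have hps : ContDiff ℝ ∞ fun q : E3 × ℝ => p q.1 q.2 := by
    refine contDiff_fst.add (((contDiff_snd.sub contDiff_const).mul ?_).smul contDiff_const)
    exact (by fun_prop : ContDiff ℝ ∞ fun x : E3 => x 0).comp contDiff_fst
  have has : ContDiff ℝ ∞ a := contDiff_integral_param ((contDiff_D hgs 0).comp hps)
  -- On this plane tangency reads `x 1 * v x 1 = 0`; the axis is reached by continuity.
  have hg0 : ∀ q : E3, q 0 = 0 → g q = 0 := fun q hq => by
    have h1 : ∀ q : E3, q 0 = 0 → q 1 ≠ 0 → g q = 0 := fun q hq hq1 => by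
      have := h0 q
      rw [hq, zero_mul, zero_add] at this
      exact (mul_eq_zero.1 this).resolve_left hq1
    by_cases hq1 : q 1 = 0
    · exact eq_zero_of_forall_ne hgs.continuous q 1 fun s hs =>
        h1 _ (by simp [e, hq]) (by simp [e, hq1, hs])
    · exact h1 q hq hq1
  have hga : ∀ x, g x = x 0 * a x := fun x => by
    have hd : ∀ s : ℝ, HasDerivAt (fun s => g (p x s)) (x 0 * D 0 g (p x s)) s := fun s => by
      have h1 : HasDerivAt (p x) (x 0 • e 0) s := by
        have := ((((hasDerivAt_id s).sub_const 1).mul_const (x 0)).smul_const (e 0)).const_add x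
        simpa [hp] using this
      have h2 := (diff_of_smooth hgs (p x s)).hasFDerivAt.comp_hasDerivAt s h1
      exact h2.congr_deriv (by simp [D])
    have hcont : Continuous fun s => x 0 * D 0 g (p x s) :=
      continuous_const.mul ((contDiff_D hgs 0).continuous.comp
        (hps.continuous.comp (continuous_const.prodMk continuous_id)))
    have h3 := intervalIntegral.integral_eq_sub_of_hasDerivAt (a := 0) (b := 1) (fun s _ => hd s)
      (hcont.intervalIntegrable _ _)
    rw [intervalIntegral.integral_const_mul, hg0 (p x 0) (by simp [p, e]), sub_zero] at h3
    rw [ha]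
    refine Eq.trans ?_ h3.symm
    simp [p]
  have hva : ∀ x, v x 0 + x 1 * a x = 0 := fun x => by
    have h1 : ∀ x : E3, x 0 ≠ 0 → v x 0 + x 1 * a x = 0 := fun x hx => by
      have := h0 x
      rw [show v x 1 = x 0 * a x from hga x] at this
      exact (mul_eq_zero.1 (show x 0 * (v x 0 + x 1 * a x) = 0 by linarith)).resolve_left hx
    by_cases hx : x 0 = 0
    · refine eq_zero_of_forall_ne (f := fun x => v x 0 + x 1 * a x) ?_ x 0 fun s hs =>
        h1 _ (by simp [e, hx, hs])
      exact (hcomp 0).continuous.add ((by fun_prop : Continuous fun x : E3 => x 1).mul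
        has.continuous)
    · exact h1 x hx
  refine ⟨a, has, funext fun x => ?_⟩
  ext i
  fin_cases i
  · have := hva x
    simp [fld, dTheta]; linarith
  · have := hga x
    simp [fld, dTheta]; linarith
  · simpa [fld, dTheta] using h2 x

end

/-! ### Mollification in `L²` -/

section

open Filter Topology

theorem exists_radial_bump {ε : ℝ} (hε : 0 < ε) : ∃ ρ : E3 → ℝ, Test ρ ∧ (∀ x, 0 ≤ ρ x) ∧
    ∫ x, ρ x = 1 ∧ (∀ x, ε ≤ ‖x‖ → ρ x = 0) ∧ ∀ x y, ‖x‖ = ‖y‖ → ρ x = ρ y := by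
  let b : E3 → ℝ := fun x => Real.smoothTransition (1 - (‖x‖ / ε) ^ 2)
  have hb0 : ∀ x, 0 ≤ b x := fun x => Real.smoothTransition.nonneg _
  have hbs : ContDiff ℝ ∞ b := by
    refine Real.smoothTransition.contDiff.comp (contDiff_const.sub ?_)
    simp_rw [div_pow]
    exact (contDiff_norm_sq ℝ).div_const _
  have hbz : ∀ x, ε ≤ ‖x‖ → b x = 0 := fun x hx => by
    refine Real.smoothTransition.zero_of_nonpos ?_
    have : 1 ≤ ‖x‖ / ε := (one_le_div hε).2 hx
    nlinarith
  have hbt : Test b := ⟨hbs, HasCompactSupport.intro (isCompact_closedBall (0 : E3) ε)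
    fun x hx => hbz x (by simpa using (not_le.1 fun h => hx (by simpa using h)).le)⟩
  have hpos : 0 < ∫ x, b x := hbt.cont.integral_pos_of_hasCompactSupport_nonneg_nonzero
    (x := 0) hbt.supp hb0 (by simp [b])
  refine ⟨fun x => (∫ x, b x)⁻¹ • b x, hbt.smul_left contDiff_const, fun x =>
    mul_nonneg (inv_nonneg.2 hpos.le) (hb0 x), ?_, fun x hx => by simp [hbz x hx], fun x y h => ?_⟩
  · rw [integral_smul, smul_eq_mul, inv_mul_cancel₀ hpos.ne']
  · simp only [b, h]

/-- The mollification of `f` by `ρ`. -/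
def mollify (ρ : E3 → ℝ) (f : E3 → E3) : E3 → E3 :=
  convolution ρ f (ContinuousLinearMap.lsmul ℝ ℝ) volume

theorem mollify_apply (ρ : E3 → ℝ) (f : E3 → E3) (x : E3) :
    mollify ρ f x = ∫ t, ρ t • f (x - t) := rfl

theorem mollify_apply_swap (ρ : E3 → ℝ) (f : E3 → E3) (x : E3) :
    mollify ρ f x = ∫ t, ρ (x - t) • f t := by
  rw [mollify, convolution_lsmul_swap]

theorem contDiff_mollify {ρ : E3 → ℝ} (hρ : Test ρ) {f : E3 → E3} (hf : LocallyIntegrable f) :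
    ContDiff ℝ ∞ (mollify ρ f) :=
  hρ.supp.contDiff_convolution_left (n := ⊤) _ hρ.smooth hf

theorem D_mollify {ρ : E3 → ℝ} (hρ : Test ρ) {f : E3 → E3} (hf : LocallyIntegrable f)
    (j : Fin 3) : D j (mollify ρ f) = mollify (D j ρ) f := by
  ext1 x
  have h := hρ.supp.hasFDerivAt_convolution_left (ContinuousLinearMap.lsmul ℝ ℝ)
    (hρ.smooth.of_le (by simp)) hf x
  have hint : Integrable fun t => (ContinuousLinearMap.lsmul ℝ ℝ).precompL E3 (fderiv ℝ ρ t)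
      (f (x - t)) := by
    have := (hρ.supp.fderiv (𝕜 := ℝ)).convolutionExists_left
      (L := (ContinuousLinearMap.lsmul ℝ ℝ : ℝ →L[ℝ] E3 →L[ℝ] E3).precompL E3)
      (hρ.smooth.continuous_fderiv (by simp)) hf x
    exact this
  unfold D mollify
  rw [h.fderiv, convolution_def, ContinuousLinearMap.integral_apply hint, convolution_def]
  rfl

theorem Dw_mollify {ρ : E3 → ℝ} (hρ : Test ρ) {f : E3 → E3} (hf : LocallyIntegrable f) :
    ∀ w, Dw w (mollify ρ f) = mollify (Dw w ρ) f
  | [] => rfl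
  | j :: w => by rw [Dw_cons, Dw_mollify hρ hf w, D_mollify (hρ.Dw w) hf j]; rfl

theorem Dw_comp_sub {ρ : E3 → ℝ} (hρ : ContDiff ℝ ∞ ρ) (x : E3) : ∀ w : List (Fin 3),
    Dw w (fun t => ρ (x - t)) = fun t => (-1 : ℝ) ^ w.length * Dw w ρ (x - t)
  | [] => by simp
  | j :: w => by
    ext1 t
    have h1 : HasFDerivAt (fun t : E3 => x - t) (-ContinuousLinearMap.id ℝ E3) t :=
      (hasFDerivAt_id t).const_sub x
    have h2 := ((diff_of_smooth (contDiff_Dw hρ w) (x - t)).hasFDerivAt.comp t h1).const_mul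
      ((-1 : ℝ) ^ w.length)
    rw [Dw_cons, Dw_comp_sub hρ x w, D]
    refine (congrFun (congrArg _ h2.fderiv) _).trans ?_
    simp [D, pow_succ]

/-- Test the weak derivative against `ρ(x - ·)`: the sign from reflecting the kernel cancels the
sign in the definition. -/
theorem mollify_weakDeriv {n : ℕ} {w : Fin n → Fin 3} {f g : E3 → E3} (h : IsWeakDeriv w f g)
    {ρ : E3 → ℝ} (hρ : Test ρ) : mollify (Dw (List.ofFn w) ρ) f = mollify ρ g := by
  ext1 x
  have hs : ContDiff ℝ ∞ fun t => ρ (x - t) := hρ.smooth.comp (contDiff_const.sub contDiff_id)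
  have hc : HasCompactSupport fun t => ρ (x - t) :=
    hρ.supp.comp_homeomorph (Homeomorph.subLeft x)
  have h1 := h _ hs hc
  rw [partialDeriv_eq hs, Dw_comp_sub hρ.smooth] at h1
  rw [mollify_apply_swap, mollify_apply_swap]
  simp only [List.length_ofFn, mul_smul] at h1
  rw [integral_smul] at h1
  exact smul_right_injective E3 (pow_ne_zero n (by norm_num : (-1 : ℝ) ≠ 0)) h1

theorem exists_translate_close (f : L2) {η : ℝ} (hη : 0 < η) : ∃ ε > 0, ∀ t : E3, ‖t‖ < ε →
    eLpNorm (fun x => f (x - t) - f x) 2 volume ≤ ENNReal.ofReal η := by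
  let c : C(E3, C(E3, E3)) := ContinuousMap.curry ⟨fun p : E3 × E3 => p.2 - p.1, by fun_prop⟩
  have hmp : ∀ t, MeasurePreserving (c t) volume volume := fun t =>
    measurePreserving_sub_right volume t
  have hcont := (continuous_const (y := f)).compMeasurePreservingLp c.continuous hmp
    (by norm_num)
  obtain ⟨ε, hε, H⟩ := Metric.continuous_iff.1 hcont 0 η hη
  refine ⟨ε, hε, fun t ht => ?_⟩
  have h1 := (H t (by simpa using ht)).le
  rw [dist_eq_norm, Lp.norm_def] at h1
  rw [← ENNReal.ofReal_toReal (a := eLpNorm _ _ _) ?_]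
  · refine ENNReal.ofReal_le_ofReal (le_trans (le_of_eq ?_) h1)
    congr 1
    refine eLpNorm_congr_ae ?_
    filter_upwards [Lp.coeFn_sub (Lp.compMeasurePreserving (c t) (hmp t) f)
      (Lp.compMeasurePreserving (c 0) (hmp 0) f), Lp.coeFn_compMeasurePreserving f (hmp t),
      Lp.coeFn_compMeasurePreserving f (hmp 0)] with x h1 h2 h3
    rw [h1, Pi.sub_apply, h2, h3]
    simp [c]
  · exact (((Lp.memLp f).comp_measurePreserving (hmp t)).sub (Lp.memLp f)).eLpNorm_ne_top

/-- The difference is an average of `f(· - t) - f` over the probability measure `ρ dt`. Apply Jensen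
for the square and Tonelli; only `‖t‖ < ε` contributes. -/
theorem eLpNorm_mollify_sub_le (f : L2) {ε : ℝ} {η : ENNReal}
    (hη : ∀ t : E3, ‖t‖ < ε → eLpNorm (fun x => f (x - t) - f x) 2 volume ≤ η) {ρ : E3 → ℝ}
    (hρ : Test ρ) (h0 : ∀ x, 0 ≤ ρ x) (h1 : ∫ x, ρ x = 1) (hε : ∀ x, ε ≤ ‖x‖ → ρ x = 0) :
    eLpNorm (fun x => mollify ρ f x - f x) 2 volume ≤ η := by
  have hm : Measurable fun x => ENNReal.ofReal (ρ x) := hρ.cont.measurable.ennreal_ofReal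
  set μ : Measure E3 := volume.withDensity fun x => ENNReal.ofReal (ρ x) with hμ
  have hprob : IsProbabilityMeasure μ := ⟨by
    rw [hμ, withDensity_apply _ MeasurableSet.univ, Measure.restrict_univ,
      ← ofReal_integral_eq_lintegral_ofReal hρ.integrable (Eventually.of_forall h0), h1,
      ENNReal.ofReal_one]⟩
  have hfm : StronglyMeasurable f := Lp.stronglyMeasurable f
  have hjoint : StronglyMeasurable fun p : E3 × E3 => f (p.1 - p.2) - f p.1 :=
    (hfm.comp_measurable (measurable_fst.sub measurable_snd)).sub
      (hfm.comp_measurable measurable_fst)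
  have hpt : ∀ x, ‖mollify ρ f x - f x‖ₑ ^ (2 : ℝ) ≤ ∫⁻ t, ‖f (x - t) - f x‖ₑ ^ (2 : ℝ) ∂μ := by
    intro x
    have hi : Integrable fun t => ρ t • f (x - t) :=
      hρ.supp.convolutionExists_left (L := (ContinuousLinearMap.lsmul ℝ ℝ : ℝ →L[ℝ] E3 →L[ℝ] E3))
        hρ.cont ((Lp.memLp f).locallyIntegrable (by norm_num)) x
    have he : mollify ρ f x - f x = ∫ t, ρ t • (f (x - t) - f x) := by
      simp_rw [smul_sub]
      rw [integral_sub hi (hρ.integrable.smul_const _), integral_smul_const, h1, one_smul]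
      rfl
    have hsm : StronglyMeasurable fun t => f (x - t) - f x :=
      hjoint.comp_measurable measurable_prodMk_left
    have hle : ‖mollify ρ f x - f x‖ₑ ≤ eLpNorm (fun t => f (x - t) - f x) 1 μ := by
      rw [he, eLpNorm_one_eq_lintegral_enorm, hμ,
        lintegral_withDensity_eq_lintegral_mul _ hm hsm.enorm]
      refine (enorm_integral_le_lintegral_enorm _).trans (lintegral_mono fun t => ?_)
      rw [enorm_smul, Pi.mul_apply, Real.enorm_of_nonneg (h0 t)]
    have h2 := hle.trans (eLpNorm_le_eLpNorm_of_exponent_le (q := 2) (by norm_num)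
      hsm.aestronglyMeasurable)
    refine (ENNReal.rpow_le_rpow h2 (by norm_num : (0 : ℝ) ≤ 2)).trans (le_of_eq ?_)
    have := eLpNorm_nnreal_pow_eq_lintegral (f := fun t => f (x - t) - f x) (μ := μ)
      (p := 2) (by norm_num)
    simpa using this
  have key : eLpNorm (fun x => mollify ρ f x - f x) 2 volume ^ (2 : ℝ) ≤ η ^ (2 : ℝ) := by
    have e1 := eLpNorm_nnreal_pow_eq_lintegral (f := fun x => mollify ρ f x - f x)
      (μ := (volume : Measure E3)) (p := 2) (by norm_num)
    simp only [NNReal.coe_ofNat, ENNReal.coe_ofNat] at e1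
    rw [e1]
    refine (lintegral_mono hpt).trans ?_
    rw [lintegral_lintegral_swap (hjoint.enorm.pow_const _).aemeasurable]
    have hbd : ∀ᵐ t ∂μ, ∫⁻ x, ‖f (x - t) - f x‖ₑ ^ (2 : ℝ) ≤ η ^ (2 : ℝ) := by
      rw [hμ, ae_withDensity_iff hm]
      refine Eventually.of_forall fun t ht => ?_
      have htε : ‖t‖ < ε := lt_of_not_ge fun h => ht (by simp [hε t h])
      have e2 := eLpNorm_nnreal_pow_eq_lintegral (f := fun x => f (x - t) - f x)
        (μ := (volume : Measure E3)) (p := 2) (by norm_num)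
      simp only [NNReal.coe_ofNat, ENNReal.coe_ofNat] at e2
      rw [← e2]
      exact ENNReal.rpow_le_rpow (hη t htε) (by norm_num)
    refine (lintegral_mono_ae hbd).trans ?_
    simp
  exact (ENNReal.rpow_le_rpow_iff (by norm_num)).1 key

end

/-! ### Reflections, cutoffs and density of test coefficients -/

section

open Filter Topology

/-- The reflection with horizontal part `(c, s; s, -c)`. -/
def refl (c s : ℝ) (h : c ^ 2 + s ^ 2 = 1) : E3 ≃ₗᵢ[ℝ] E3 where
  toFun x := !₂[c * x 0 + s * x 1, s * x 0 - c * x 1, x 2]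
  invFun x := !₂[c * x 0 + s * x 1, s * x 0 - c * x 1, x 2]
  map_add' x y := by ext i; fin_cases i <;> simp <;> ring
  map_smul' r x := by ext i; fin_cases i <;> simp <;> ring
  left_inv x := by
    ext i; fin_cases i <;> simp
    · linear_combination x 0 * h
    · linear_combination x 1 * h
  right_inv x := by
    ext i; fin_cases i <;> simp
    · linear_combination x 0 * h
    · linear_combination x 1 * h
  norm_map' x := by
    simp only [LinearEquiv.coe_mk, LinearMap.coe_mk, AddHom.coe_mk, EuclideanSpace.norm_eq,
      Fin.sum_univ_three, Real.norm_eq_abs, sq_abs]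
    congr 1
    simp
    linear_combination (x 0 ^ 2 + x 1 ^ 2) * h

theorem refl_apply {c s : ℝ} (h : c ^ 2 + s ^ 2 = 1) (x : E3) :
    refl c s h x = !₂[c * x 0 + s * x 1, s * x 0 - c * x 1, x 2] := rfl

theorem cylRadius_refl {c s : ℝ} (h : c ^ 2 + s ^ 2 = 1) (x : E3) :
    cylRadius (refl c s h x) = cylRadius x := by
  simp only [cylRadius, refl_apply]
  congr 1
  simp
  linear_combination (x 0 ^ 2 + x 1 ^ 2) * h

theorem dTheta_refl {c s : ℝ} (h : c ^ 2 + s ^ 2 = 1) (x : E3) :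
    dTheta (refl c s h x) = -refl c s h (dTheta x) := by
  ext i; fin_cases i <;> (simp [dTheta, refl_apply]; try ring)

/-- A reflection in a plane through the axis preserves `r` and `z` but reverses `∂_θ`. This oddness
survives radial mollification and, conversely, forces a multiple of `∂_θ`. -/
theorem ae_refl {P : ℝ → ℝ → ℝ} {f : E3 → E3}
    (hf : f =ᵐ[volume] fun x => P (cylRadius x) (x 2) • dTheta x) {c s : ℝ}
    (h : c ^ 2 + s ^ 2 = 1) : ∀ᵐ x, f (refl c s h x) = -refl c s h (f x) := by
  filter_upwards [hf, (refl c s h).measurePreserving.quasiMeasurePreserving.ae hf] with x h1 h2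
  rw [h2, h1, cylRadius_refl, dTheta_refl, map_smul, smul_neg]
  rfl

theorem mollify_refl {ρ : E3 → ℝ} (hρ : ∀ x y, ‖x‖ = ‖y‖ → ρ x = ρ y) {f : E3 → E3}
    {R : E3 ≃ₗᵢ[ℝ] E3} (hf : ∀ᵐ x, f (R x) = -R (f x)) (x : E3) :
    mollify ρ f (R x) = -R (mollify ρ f x) := by
  rw [mollify_apply, mollify_apply, ← R.measurePreserving.integral_comp
    R.toHomeomorph.measurableEmbedding]
  refine Eq.trans ?_ (congrArg Neg.neg (R.toContinuousLinearEquiv.integral_comp_comm _))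
  rw [← integral_neg]
  refine integral_congr_ae ?_
  filter_upwards [(Measure.measurePreserving_sub_left volume x).quasiMeasurePreserving.ae hf]
    with t ht
  rw [← map_sub, ht, hρ (R t) t (R.norm_map t), smul_neg, map_smul]
  rfl

/-- The mollification by a radial kernel preserves the form `Π ∂_θ`. -/
theorem exists_mollify_eq_fld {P : ℝ → ℝ → ℝ} {f : E3 → E3}
    (hf : f =ᵐ[volume] fun x => P (cylRadius x) (x 2) • dTheta x) (hfl : LocallyIntegrable f)
    {ρ : E3 → ℝ} (ht : Test ρ) (hρ : ∀ x y, ‖x‖ = ‖y‖ → ρ x = ρ y) :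
    ∃ a : E3 → ℝ, ContDiff ℝ ∞ a ∧ mollify ρ f = fld a := by
  -- Reflection in the plane through `x` and the axis, with entries the cosine and sine of twice the
  -- polar angle. It fixes `x`, so oddness makes the vector at `x` normal to that plane.
  have hfix : ∀ x : E3, ∃ c s : ℝ, ∃ h : c ^ 2 + s ^ 2 = 1, refl c s h x = x := fun x => by
    by_cases hr : x 0 ^ 2 + x 1 ^ 2 = 0
    · have h0 : x 0 = 0 := by nlinarith [sq_nonneg (x 0), sq_nonneg (x 1)]
      have h1 : x 1 = 0 := by nlinarith [sq_nonneg (x 0), sq_nonneg (x 1)]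
      exact ⟨1, 0, by norm_num, by ext i; fin_cases i <;> simp [refl_apply, h0, h1]⟩
    · refine ⟨(x 0 ^ 2 - x 1 ^ 2) / (x 0 ^ 2 + x 1 ^ 2), 2 * x 0 * x 1 / (x 0 ^ 2 + x 1 ^ 2), ?_, ?_⟩
      · field_simp; ring
      · ext i
        fin_cases i <;> simp [refl_apply] <;> field_simp <;> ring
  refine exists_eq_fld (contDiff_mollify ht hfl) (fun x => ?_) fun x => ?_
  · obtain ⟨c, s, h, hx⟩ := hfix x
    have h1 := mollify_refl hρ (ae_refl hf h) x
    rw [hx, refl_apply] at h1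
    rw [refl_apply] at hx
    have a0 := congrArg (fun v : E3 => v 0) h1
    have a1 := congrArg (fun v : E3 => v 1) h1
    have b0 := congrArg (fun v : E3 => v 0) hx
    have b1 := congrArg (fun v : E3 => v 1) hx
    simp at a0 a1 b0 b1
    linear_combination x 0 * a0 / 2 + x 1 * a1 / 2 - mollify ρ f x 0 * b0 / 2
      - mollify ρ f x 1 * b1 / 2
  · obtain ⟨c, s, h, hx⟩ := hfix x
    have h1 := mollify_refl hρ (ae_refl hf h) x
    rw [hx, refl_apply] at h1
    have a2 := congrArg (fun v : E3 => v 2) h1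
    simp at a2
    linarith

theorem contDiff_dilate {ψ : E3 → ℝ} (hψ : ContDiff ℝ ∞ ψ) (r : ℝ) :
    ContDiff ℝ ∞ fun x => ψ (r • x) := hψ.comp (contDiff_const_smul r)

theorem D_dilate {ψ : E3 → ℝ} (hψ : ContDiff ℝ ∞ ψ) (r : ℝ) (j : Fin 3) :
    D j (fun x => ψ (r • x)) = fun x => r * D j ψ (r • x) := by
  ext1 x
  have h := (diff_of_smooth hψ (r • x)).hasFDerivAt.comp x
    ((hasFDerivAt_id (𝕜 := ℝ) x).const_smul r)
  refine (congrFun (congrArg _ h.fderiv) _).trans ?_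
  simp [D]

theorem tendsto_inv_succ : Tendsto (fun k : ℕ => ((k : ℝ) + 1)⁻¹) atTop (𝓝 0) := by
  simpa [one_div] using tendsto_one_div_add_atTop_nhds_zero_nat (𝕜 := ℝ)

theorem tendsto_cutoff_zero {ψ : E3 → ℝ} (hψ : Test ψ) {v : E3 → E3} (hv : ContDiff ℝ ∞ v)
    (h2 : MemLp v 2 volume) :
    Tendsto (fun k : ℕ => eLpNorm (fun x => ψ (((k : ℝ) + 1)⁻¹ • x) • v x - ψ 0 • v x) 2 volume)
      atTop (𝓝 0) := by
  obtain ⟨M, hM⟩ := hψ.cont.bounded_above_of_compact_support hψ.supp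
  have e1 : ∀ f : E3 → E3, eLpNorm f 2 volume = (∫⁻ x, ‖f x‖ₑ ^ (2 : ℝ)) ^ (1 / 2 : ℝ) := fun f => by
    rw [eLpNorm_eq_lintegral_rpow_enorm_toReal (by norm_num) (by norm_num)]
    simp
  simp_rw [e1]
  have hbound : ∀ (k : ℕ) x, ‖ψ (((k : ℝ) + 1)⁻¹ • x) • v x - ψ 0 • v x‖ₑ ^ (2 : ℝ)
      ≤ ENNReal.ofReal (2 * M) ^ (2 : ℝ) * ‖v x‖ₑ ^ (2 : ℝ) := fun k x => by
    rw [← ENNReal.mul_rpow_of_nonneg _ _ (by norm_num), ← sub_smul, enorm_smul]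
    refine ENNReal.rpow_le_rpow (mul_le_mul_left ?_ _) (by norm_num)
    rw [← ofReal_norm]
    refine ENNReal.ofReal_le_ofReal ((norm_sub_le _ _).trans ?_)
    linarith [hM (((k : ℝ) + 1)⁻¹ • x), hM 0]
  have hfin : ∫⁻ x, ENNReal.ofReal (2 * M) ^ (2 : ℝ) * ‖v x‖ₑ ^ (2 : ℝ) ≠ ⊤ := by
    rw [lintegral_const_mul' _ _ (by finiteness)]
    have := lintegral_rpow_enorm_lt_top_of_eLpNorm_lt_top (f := v) (p := 2)
      (by norm_num) (by norm_num) h2.2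
    simp only [ENNReal.toReal_ofNat] at this
    exact ENNReal.mul_ne_top (by finiteness) this.ne
  have hlim := tendsto_lintegral_of_dominated_convergence (μ := (volume : Measure E3))
    (F := fun (k : ℕ) x => ‖ψ (((k : ℝ) + 1)⁻¹ • x) • v x - ψ 0 • v x‖ₑ ^ (2 : ℝ))
    (f := fun _ => 0) _ (fun k => by
      have : Continuous fun x => ψ (((k : ℝ) + 1)⁻¹ • x) • v x - ψ 0 • v x :=
        ((contDiff_dilate hψ.smooth _).continuous.smul hv.continuous).sub
          (hv.continuous.const_smul (ψ 0))
      exact this.measurable.enorm.pow_const _)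
    (fun k => Eventually.of_forall (hbound k)) hfin (Eventually.of_forall fun x => by
      have h1 : Tendsto (fun k : ℕ => ψ (((k : ℝ) + 1)⁻¹ • x) • v x - ψ 0 • v x) atTop
          (𝓝 (ψ ((0 : ℝ) • x) • v x - ψ 0 • v x)) :=
        (((hψ.cont.tendsto _).comp (tendsto_inv_succ.smul_const x)).smul_const _).sub_const _
      have h2 := (ENNReal.continuous_rpow_const (y := 2)).tendsto _ |>.comp h1.enorm
      simpa [Function.comp_def] using h2)
  have := (ENNReal.continuous_rpow_const (y := 1 / 2)).tendsto _ |>.comp hlim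
  simpa [Function.comp_def] using this

/-- Induction on the innermost derivative. If it falls on the cutoff, it produces `∂_j ψ` with a
factor `1 / (k + 1)` tending to 0; this is why `ψ 0` is left arbitrary. -/
theorem tendsto_cutoff (w : List (Fin 3)) : ∀ {ψ : E3 → ℝ}, Test ψ → ∀ {v : E3 → E3},
    ContDiff ℝ ∞ v → (∀ w' : List (Fin 3), w'.length ≤ w.length → MemLp (Dw w' v) 2 volume) →
    Tendsto (fun k : ℕ => eLpNorm (fun x => Dw w (fun x => ψ (((k : ℝ) + 1)⁻¹ • x) • v x) x
      - ψ 0 • Dw w v x) 2 volume) atTop (𝓝 0) := by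
  induction w using List.reverseRecOn with
  | nil => exact fun {ψ} hψ {v} hv h => tendsto_cutoff_zero hψ hv (h [] le_rfl)
  | append_singleton w j ih =>
    intro ψ hψ v hv h
    have h1 := ih hψ (contDiff_D hv j) fun w' hw' => by
      have := h (w' ++ [j]) (by simpa using hw')
      rwa [Dw_append] at this
    have hL2 : MemLp (Dw w v) 2 volume := h w (by simp)
    have h2 := ih (hψ.D j) hv fun w' hw' => h w' (by simp; omega)
    have hs : Tendsto (fun k : ℕ => ENNReal.ofReal ((k : ℝ) + 1)⁻¹) atTop (𝓝 0) := by
      simpa using ENNReal.tendsto_ofReal tendsto_inv_succ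
    have hfin : 0 + eLpNorm (fun x => D j ψ 0 • Dw w v x) 2 volume ≠ ⊤ := by
      rw [zero_add]
      exact (hL2.const_smul (D j ψ 0)).eLpNorm_ne_top
    have h3 := h1.add (ENNReal.Tendsto.mul hs (Or.inr hfin)
      (h2.add_const (eLpNorm (fun x => D j ψ 0 • Dw w v x) 2 volume)) (Or.inr (by simp)))
    rw [zero_mul, add_zero] at h3
    refine tendsto_of_tendsto_of_tendsto_of_le_of_le tendsto_const_nhds h3 (fun _ => zero_le)
      fun k => ?_
    set r : ℝ := ((k : ℝ) + 1)⁻¹ with hr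
    have hr0 : 0 ≤ r := by positivity
    have e1 : Dw (w ++ [j]) (fun x => ψ (r • x) • v x)
        = fun x => Dw w (fun x => ψ (r • x) • D j v x) x
          + r • Dw w (fun x => D j ψ (r • x) • v x) x := by
      have s1 : ContDiff ℝ ∞ fun x => ψ (r • x) • D j v x :=
        (contDiff_dilate hψ.smooth r).smul (contDiff_D hv j)
      have s2 : ContDiff ℝ ∞ fun x => D j ψ (r • x) • v x :=
        (contDiff_dilate (contDiff_D hψ.smooth j) r).smul hv
      rw [Dw_append, Dw_cons, Dw_nil, D_smul (diff_of_smooth (contDiff_dilate hψ.smooth r))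
        (diff_of_smooth hv), D_dilate hψ.smooth]
      have : (fun x => ψ (r • x) • D j v x + (r * D j ψ (r • x)) • v x)
          = (fun x => ψ (r • x) • D j v x) + fun x => r • (D j ψ (r • x) • v x) := by
        ext1 x; simp [mul_smul]
      rw [this, Dw_add s1 (s2.const_smul r), Dw_const_smul _ s2]
      rfl
    rw [e1, Dw_append]
    have c1 : Continuous fun x => Dw w (fun x => ψ (r • x) • D j v x) x
        - ψ 0 • Dw w (Dw [j] v) x :=
      (contDiff_Dw ((contDiff_dilate hψ.smooth r).smul (contDiff_D hv j)) w).continuous.sub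
        ((contDiff_Dw (contDiff_D hv j) w).continuous.const_smul (ψ 0))
    have c2 : Continuous fun x => Dw w (fun x => D j ψ (r • x) • v x) x - D j ψ 0 • Dw w v x :=
      (contDiff_Dw ((contDiff_dilate (contDiff_D hψ.smooth j) r).smul hv) w).continuous.sub
        ((contDiff_Dw hv w).continuous.const_smul (D j ψ 0))
    have c3 : Continuous fun x => D j ψ 0 • Dw w v x :=
      (contDiff_Dw hv w).continuous.const_smul (D j ψ 0)
    have e2 : (fun x => Dw w (fun x => ψ (r • x) • D j v x) x
          + r • Dw w (fun x => D j ψ (r • x) • v x) x - ψ 0 • Dw w (Dw [j] v) x)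
        = (fun x => Dw w (fun x => ψ (r • x) • D j v x) x - ψ 0 • Dw w (Dw [j] v) x)
        + r • ((fun x => Dw w (fun x => D j ψ (r • x) • v x) x - D j ψ 0 • Dw w v x)
          + fun x => D j ψ 0 • Dw w v x) := by
      ext1 x
      simp only [Pi.add_apply, Pi.smul_apply]
      module
    rw [e2]
    refine (eLpNorm_add_le c1.aestronglyMeasurable
      ((c2.add c3).const_smul r).aestronglyMeasurable (by norm_num)).trans ?_
    refine add_le_add le_rfl ?_
    rw [eLpNorm_const_smul, ← ofReal_norm, Real.norm_of_nonneg hr0]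
    exact mul_le_mul_right (eLpNorm_add_le c2.aestronglyMeasurable
      c3.aestronglyMeasurable (by norm_num)) _

/-- Fields with smooth compactly supported coefficient are dense among the fields `Π ∂_θ`. -/
theorem exists_test_near {m : ℕ} {u : SobolevH m} {P : ℝ → ℝ → ℝ} (hu : HasCoeff u P) {η : ℝ}
    (hη : 0 < η) : ∃ a : E3 → ℝ, ∃ ha : Test a, ‖toSob m ha.fld - u‖ ≤ η := by
  set n : ℝ := ((Fintype.card (DerivIndex m) : ℕ) : ℝ) with hn
  have hn0 : 0 ≤ n := Nat.cast_nonneg _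
  -- Each of the `n` derivative indices contributes two errors of size `κ`, one for mollification
  -- and one for the cutoff.
  set κ : ℝ := η / (2 * n + 1) with hκ
  have hκ0 : 0 < κ := by positivity
  have : Nonempty (DerivIndex m) := ⟨idIndex m⟩
  let U : DerivIndex m → L2 := fun i => (u : PiLp 2 fun _ : DerivIndex m => L2) i
  choose ε hε hεU using fun i => exists_translate_close (U i) hκ0
  obtain ⟨i₀, hi₀⟩ := Finite.exists_min (α := DerivIndex m) ε
  obtain ⟨ρ, ht, hρ0, hρ1, hρε, hρr⟩ := exists_radial_bump (hε i₀)
  have hmol : ∀ i, eLpNorm (fun x => mollify ρ (U i) x - U i x) 2 volume ≤ ENNReal.ofReal κ :=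
    fun i => eLpNorm_mollify_sub_le (U i) (fun t h => hεU i t (h.trans_le (hi₀ i))) ht hρ0 hρ1 hρε
  have hloc : LocallyIntegrable (field u) := (Lp.memLp (U (idIndex m))).locallyIntegrable
    (by norm_num)
  obtain ⟨a, has, hav⟩ := exists_mollify_eq_fld hu hloc ht hρr
  have hvs : ContDiff ℝ ∞ (fld a) := hav ▸ contDiff_mollify ht hloc
  have hD : ∀ i : DerivIndex m, Dw (List.ofFn i.2) (fld a) = mollify ρ (U i) := fun i => by
    rw [← hav, Dw_mollify ht hloc]
    exact mollify_weakDeriv (u.2 i) ht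
  have hmem : ∀ i : DerivIndex m, MemLp (Dw (List.ofFn i.2) (fld a)) 2 volume := fun i => by
    have hd : MemLp (fun x => mollify ρ (U i) x - U i x) 2 volume :=
      ⟨((hD i ▸ contDiff_Dw hvs _).continuous.aestronglyMeasurable).sub
        (Lp.aestronglyMeasurable _), (hmol i).trans_lt ENNReal.ofReal_lt_top⟩
    rw [hD i]
    convert hd.add (Lp.memLp (U i)) using 1
    ext1 x
    simp
  have hmem' : ∀ w : List (Fin 3), w.length ≤ m → MemLp (Dw w (fld a)) 2 volume := fun w hw => by
    have := hmem (indexOf w hw)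
    rwa [show List.ofFn (indexOf w hw).2 = w from List.ofFn_get w] at this
  -- The cutoff need not be radial: the estimates do not use symmetry of the approximants, which is
  -- recovered in the limit.
  obtain ⟨ψ, hψ, hψ0⟩ : ∃ ψ : E3 → ℝ, Test ψ ∧ ψ 0 = 1 := by
    let χ : ContDiffBump (0 : E3) := ⟨1, 2, by norm_num, by norm_num⟩
    exact ⟨χ, ⟨χ.contDiff, χ.hasCompactSupport⟩,
      χ.one_of_mem_closedBall (Metric.mem_closedBall_self (by norm_num))⟩
  have hev : ∀ᶠ k : ℕ in atTop, ∀ i : DerivIndex m, eLpNorm (fun x => Dw (List.ofFn i.2)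
      (fun x => ψ (((k : ℝ) + 1)⁻¹ • x) • fld a x) x - ψ 0 • Dw (List.ofFn i.2) (fld a) x) 2 volume
      ≤ ENNReal.ofReal κ := eventually_all.2 fun i =>
    (tendsto_cutoff _ hψ hvs fun w' hw' => hmem' w' (hw'.trans
      (length_le_of_index i))).eventually_le_const
      (by simpa using hκ0)
  obtain ⟨k, hk⟩ := hev.exists
  have hψk : Test fun x => ψ (((k : ℝ) + 1)⁻¹ • x) :=
    ⟨contDiff_dilate hψ.smooth _, hψ.supp.comp_homeomorph
      (Homeomorph.smulOfNeZero (((k : ℝ) + 1)⁻¹) (by positivity))⟩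
  refine ⟨_, hψk.smul_right has, (norm_le_sum _).trans ?_⟩
  have hfin : n * (κ + κ) ≤ η := by
    rw [hκ, ← two_mul, mul_div_assoc', mul_div_assoc', div_le_iff₀ (by positivity)]
    nlinarith
  refine le_trans ?_ hfin
  rw [hn, ← nsmul_eq_mul, ← Finset.card_univ]
  refine Finset.sum_le_card_nsmul _ _ _ fun i _ => ?_
  rw [Submodule.coe_sub, PiLp.sub_apply, Lp.norm_def]
  refine ENNReal.toReal_le_of_le_ofReal (by positivity) ?_
  have e1 : fld (fun x => ψ (((k : ℝ) + 1)⁻¹ • x) • a x)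
      = fun x => ψ (((k : ℝ) + 1)⁻¹ • x) • fld a x := funext fun x => mul_smul _ _ _
  have hc : Continuous (Dw (List.ofFn i.2) fun x => ψ (((k : ℝ) + 1)⁻¹ • x) • fld a x) :=
    (contDiff_Dw (hψk.smooth.smul hvs) _).continuous
  have hc' : Continuous (Dw (List.ofFn i.2) (fld a)) := (contDiff_Dw hvs _).continuous
  have e2 : ((toSob m (hψk.smul_right has).fld : PiLp 2 fun _ : DerivIndex m => L2) i - U i : L2)
      =ᵐ[volume] (fun x => Dw (List.ofFn i.2) (fun x => ψ (((k : ℝ) + 1)⁻¹ • x) • fld a x) x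
        - ψ 0 • Dw (List.ofFn i.2) (fld a) x) + fun x => mollify ρ (U i) x - U i x := by
    filter_upwards [Lp.coeFn_sub ((toSob m (hψk.smul_right has).fld :
      PiLp 2 fun _ : DerivIndex m => L2) i) (U i),
      MemLp.coeFn_toLp (((hψk.smul_right has).fld.Dw (List.ofFn i.2)).memLp 2)] with x h1 h2
    rw [h1, Pi.sub_apply, toSob_apply, h2, e1, Pi.add_apply, hψ0, one_smul, hD i]
    abel
  refine (eLpNorm_congr_ae e2).trans_le ((eLpNorm_add_le
    (hc.sub (hc'.const_smul (ψ 0))).aestronglyMeasurable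
    ((hD i ▸ hc').aestronglyMeasurable.sub (Lp.aestronglyMeasurable _)) (by norm_num)).trans ?_)
  rw [ENNReal.ofReal_add hκ0.le hκ0.le]
  exact add_le_add (hk i) (hmol i)

theorem exists_test_approx {m : ℕ} {u : SobolevH m} {P : ℝ → ℝ → ℝ} (hu : HasCoeff u P) :
    ∃ a : ℕ → E3 → ℝ, ∃ ha : ∀ k, Test (a k),
      Tendsto (fun k => toSob m (ha k).fld) atTop (𝓝 u) := by
  choose a ha h using fun k : ℕ => exists_test_near hu (η := 1 / ((k : ℝ) + 1)) (by positivity)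
  exact ⟨a, ha, tendsto_iff_norm_sub_tendsto_zero.2
    (squeeze_zero (fun _ => norm_nonneg _) h tendsto_one_div_add_atTop_nhds_zero_nat)⟩

end

/-! ### Limits of coefficients and axial symmetry -/

section

open Filter Topology

theorem norm_le_sum_apply_e (T : E3 →L[ℝ] ℝ) : ‖T‖ ≤ ∑ j, |T (e j)| := by
  refine T.opNorm_le_bound (Finset.sum_nonneg fun _ _ => abs_nonneg _) fun v => ?_
  have hv : v = ∑ j, v j • e j := by
    ext i
    fin_cases i <;> simp [Fin.sum_univ_three]
  conv_lhs => rw [hv]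
  rw [map_sum, Finset.sum_mul]
  refine (norm_sum_le _ _).trans (Finset.sum_le_sum fun j _ => ?_)
  rw [map_smul, norm_smul, mul_comm]
  exact mul_le_mul_of_nonneg_left (PiLp.norm_apply_le v j) (norm_nonneg _)

/-- Coefficients of a Cauchy sequence in `H^m` converge in `C¹`. -/
theorem exists_C1_limit {m : ℕ} (hm : 4 ≤ m) {a : ℕ → E3 → ℝ} (ha : ∀ k, Test (a k))
    (hcau : CauchySeq fun k => toSob m (ha k).fld) :
    ∃ a₀ : E3 → ℝ, ContDiff ℝ 1 a₀ ∧ TendstoUniformly a a₀ atTop ∧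
      ∀ x, Tendsto (fun k => fderiv ℝ (a k) x) atTop (𝓝 (fderiv ℝ a₀ x)) := by
  obtain ⟨C, hC, hbase⟩ := exists_bd_base m
  have hev : ∀ ε > 0, ∃ n₀, ∀ k ≥ n₀, ∀ l ≥ n₀, (∀ x, |a k x - a l x| ≤ ε) ∧
      ∀ j x, |D j (a k) x - D j (a l) x| ≤ ε := fun ε hε => by
    obtain ⟨n₀, hn₀⟩ := Metric.cauchySeq_iff.1 hcau (ε / (C + 1)) (by positivity)
    refine ⟨n₀, fun k hk l hl => ?_⟩
    have hHB : HB m (a k - a l) (ε / (C + 1)) := by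
      refine HB_of_norm_sub_le (ha k) (ha l) ?_
      rw [← dist_eq_norm]
      exact (hn₀ k hk l hl).le
    have hle : C * (ε / (C + 1)) ≤ ε := by
      rw [mul_div_assoc', div_le_iff₀ (by positivity)]
      nlinarith
    obtain ⟨h1, h2⟩ := hbase _ _ ((ha k).sub (ha l)) (by positivity) hHB
    refine ⟨fun x => (h2 (by omega) x).trans hle, fun j x => ?_⟩
    -- Here `m ≥ 4` gives uniform control of the gradient of the coefficient: two derivatives for
    -- the embedding, one for the gradient, one for Hardy.
    have h3 := (h1 j []).sup hm x
    rw [Dw_cons, Dw_nil, D_sub (ha k).diff (ha l).diff] at h3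
    exact h3.trans hle
  have hc0 : UniformCauchySeqOn a atTop univ := by
    refine Metric.uniformCauchySeqOn_iff.2 fun ε hε => ?_
    obtain ⟨n₀, h⟩ := hev (ε / 2) (by positivity)
    exact ⟨n₀, fun k hk l hl x _ => ((h k hk l hl).1 x).trans_lt (by linarith)⟩
  have hc1 : UniformCauchySeqOn (fun k => fderiv ℝ (a k)) atTop univ := by
    refine Metric.uniformCauchySeqOn_iff.2 fun ε hε => ?_
    obtain ⟨n₀, h⟩ := hev (ε / 4) (by positivity)
    refine ⟨n₀, fun k hk l hl x _ => ?_⟩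
    rw [dist_eq_norm]
    refine (norm_le_sum_apply_e _).trans_lt ?_
    rw [Fin.sum_univ_three]
    have h0 := (h k hk l hl).2 0 x
    have h1 := (h k hk l hl).2 1 x
    have h2 := (h k hk l hl).2 2 x
    simp only [D] at h0 h1 h2
    simp only [sub_apply]
    linarith
  choose a₀ h₀ using fun x => cauchySeq_tendsto_of_complete (hc0.cauchySeq (mem_univ x))
  choose b₀ h₁ using fun x => cauchySeq_tendsto_of_complete (hc1.cauchySeq (mem_univ x))
  have u0 : TendstoUniformly a a₀ atTop :=
    tendstoUniformlyOn_univ.1 (hc0.tendstoUniformlyOn_of_tendsto fun x _ => h₀ x)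
  have u1 : TendstoUniformly (fun k => fderiv ℝ (a k)) b₀ atTop :=
    tendstoUniformlyOn_univ.1 (hc1.tendstoUniformlyOn_of_tendsto fun x _ => h₁ x)
  have hd : ∀ x, HasFDerivAt a₀ (b₀ x) x :=
    hasFDerivAt_of_tendstoUniformly u1 (fun k x => ((ha k).diff x).hasFDerivAt) h₀
  have hfd : fderiv ℝ a₀ = b₀ := funext fun x => (hd x).fderiv
  refine ⟨a₀, contDiff_one_iff_fderiv.2 ⟨fun x => (hd x).differentiableAt, ?_⟩, u0, ?_⟩
  · rw [hfd]
    exact u1.continuous (Frequently.of_forall fun k => (ha k).smooth.continuous_fderiv (by simp))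
  · rw [hfd]; exact h₁

theorem field_ae_eq_of_tendsto {m : ℕ} {U : ℕ → SobolevH m} {u : SobolevH m}
    (h : Tendsto U atTop (𝓝 u)) {f : ℕ → E3 → E3} {g : E3 → E3}
    (hf : ∀ k, field (U k) =ᵐ[volume] f k) (hg : ∀ x, Tendsto (fun k => f k x) atTop (𝓝 (g x))) :
    field u =ᵐ[volume] g := by
  have h1 : Tendsto (fun k => (U k : PiLp 2 fun _ : DerivIndex m => L2) (idIndex m)) atTop
      (𝓝 ((u : PiLp 2 fun _ : DerivIndex m => L2) (idIndex m))) :=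
    ((PiLp.continuous_apply 2 _ (idIndex m)).tendsto _).comp
      ((continuous_subtype_val.tendsto u).comp h)
  obtain ⟨ns, hns, hae⟩ := (tendstoInMeasure_of_tendsto_Lp h1).exists_seq_tendsto_ae
  filter_upwards [hae, ae_all_iff.2 hf] with x h2 h3
  refine tendsto_nhds_unique h2 (((hg x).comp hns.tendsto_atTop).congr fun k => ?_)
  exact (h3 (ns k)).symm

/-- The coefficient is invariant under the reflections in planes through the axis. -/
def Axisym (a : E3 → ℝ) : Prop :=
  ∀ (c s : ℝ) (h : c ^ 2 + s ^ 2 = 1) (x : E3), a (refl c s h x) = a x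

/-- By continuity the oddness of the field holds everywhere; off the axis divide by `∂_θ`, and on
the axis the reflection fixes the point. -/
theorem axisym_of_ae {P : ℝ → ℝ → ℝ} {f : E3 → E3}
    (hf : f =ᵐ[volume] fun x => P (cylRadius x) (x 2) • dTheta x) {a : E3 → ℝ}
    (ha : Continuous a) (hfa : f =ᵐ[volume] fld a) : Axisym a := by
  intro c s h x
  have h1 : (fun x => fld a (refl c s h x)) = fun x => -refl c s h (fld a x) := by
    refine (Continuous.ae_eq_iff_eq volume
      ((continuous_fld ha).comp (refl c s h).continuous)
      ((refl c s h).continuous.comp (continuous_fld ha)).neg).1 ?_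
    filter_upwards [ae_refl hf h, hfa, (refl c s h).measurePreserving.quasiMeasurePreserving.ae hfa]
      with x h1 h2 h3
    exact h3.symm.trans (h1.trans (by rw [h2]; rfl))
  have h2 := congrFun h1 x
  simp only [fld, dTheta_refl, map_smul, smul_neg, neg_inj] at h2
  by_cases hx : dTheta x = 0
  · have hx0 := congrArg (fun v : E3 => v 0) hx
    have hx1 := congrArg (fun v : E3 => v 1) hx
    simp [dTheta] at hx0 hx1
    congr 1
    ext i; fin_cases i <;> simp [refl_apply, hx0, hx1]
  · have hne : refl c s h (dTheta x) ≠ 0 := fun h0 => hx ((refl c s h).map_eq_zero_iff.1 h0)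
    exact smul_left_injective ℝ hne h2

/-- The point of the half-plane `y = 0` with cylindrical coordinates `r`, `z`. -/
def meridian (r z : ℝ) : E3 := !₂[r, 0, z]

/-- The reflection with `c = x 0 / r`, `s = x 1 / r` carries `x` to the half-plane `y = 0`. -/
theorem Axisym.eq_meridian {a : E3 → ℝ} (h : Axisym a) (x : E3) :
    a x = a (meridian (cylRadius x) (x 2)) := by
  have hr : cylRadius x ^ 2 = x 0 ^ 2 + x 1 ^ 2 := Real.sq_sqrt (by positivity)
  by_cases h0 : cylRadius x = 0
  · rw [h0] at hr
    have hx0 : x 0 = 0 := by nlinarith [sq_nonneg (x 0), sq_nonneg (x 1)]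
    have hx1 : x 1 = 0 := by nlinarith [sq_nonneg (x 0), sq_nonneg (x 1)]
    congr 1
    ext i; fin_cases i <;> simp [meridian, hx0, hx1, h0]
  · have hcs : (x 0 / cylRadius x) ^ 2 + (x 1 / cylRadius x) ^ 2 = 1 := by
      field_simp
      exact hr.symm
    rw [← h _ _ hcs x]
    congr 1
    ext i; fin_cases i
    · simp [refl_apply, meridian]; field_simp; exact hr.symm
    · simp [refl_apply, meridian]; ring
    · simp [refl_apply, meridian]

theorem Axisym.burgers {a : E3 → ℝ} (h : Axisym a) {L t : ℝ} (hs : Slow L t a) :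
    Axisym (burgers a t) := by
  intro c s hcs x
  refine hs.eq_burgers ?_
  rw [hs.spec x]
  conv_lhs => rw [← h c s hcs]
  rw [← hs.spec x, map_add, map_smul]
  congr 3
  ext i; fin_cases i <;> simp [refl_apply]

theorem cylRadius_meridian {r : ℝ} (hr : 0 ≤ r) (z : ℝ) : cylRadius (meridian r z) = r := by
  simp [cylRadius, meridian, Real.sqrt_sq hr]

theorem ae_coeff {a : E3 → ℝ} (h : Axisym a) {f : E3 → E3} (hf : f =ᵐ[volume] fld a) :
    f =ᵐ[volume] fun x => a (meridian (cylRadius x) (x 2)) • dTheta x := by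
  filter_upwards [hf] with x hx
  rw [hx, ← h.eq_meridian x]
  rfl

/-- A continuous coefficient is determined away from the axis. -/
theorem coeff_eq {f : E3 → E3} {P Q : ℝ → ℝ → ℝ}
    (hP : f =ᵐ[volume] fun x => P (cylRadius x) (x 2) • dTheta x)
    (hQ : f =ᵐ[volume] fun x => Q (cylRadius x) (x 2) • dTheta x)
    (hPc : ContinuousOn (fun p : ℝ × ℝ => P p.1 p.2) (Ioi 0 ×ˢ univ))
    (hQc : ContinuousOn (fun p : ℝ × ℝ => Q p.1 p.2) (Ioi 0 ×ˢ univ)) {r : ℝ} (hr : 0 < r) (z : ℝ) :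
    P r z = Q r z := by
  have hcyl : Continuous cylRadius := by unfold cylRadius; fun_prop
  set U : Set E3 := {x | 0 < cylRadius x} with hU
  have hUo : IsOpen U := isOpen_lt continuous_const hcyl
  have hmap : ContinuousOn (fun x : E3 => (cylRadius x, x 2)) U :=
    (hcyl.prodMk (by fun_prop)).continuousOn
  have hmt : MapsTo (fun x : E3 => (cylRadius x, x 2)) U (Ioi 0 ×ˢ univ) := fun x hx =>
    ⟨hx, mem_univ _⟩
  have h := Measure.eqOn_open_of_ae_eq (μ := volume) (U := U)
    (f := fun x => P (cylRadius x) (x 2)) (g := fun x => Q (cylRadius x) (x 2)) (by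
      rw [EventuallyEq, ae_restrict_iff' hUo.measurableSet]
      filter_upwards [hP, hQ] with x h1 h2 hx
      have hne : dTheta x ≠ 0 := fun h0 => by
        have hx0 := congrArg (fun v : E3 => v 0) h0
        have hx1 := congrArg (fun v : E3 => v 1) h0
        simp [dTheta] at hx0 hx1
        exact absurd hx (by simp [hU, cylRadius, hx0, hx1])
      exact smul_left_injective ℝ hne (h1.symm.trans h2)) hUo
    (hPc.comp hmap hmt) (hQc.comp hmap hmt)
  have := h (show meridian r z ∈ U by simpa [hU, cylRadius_meridian hr.le] using hr)
  simp only [cylRadius_meridian hr.le] at this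
  exact this

end

/-! ### Classical solutions, uniqueness and existence -/

section

open Filter Topology

/-- A classical solution is constant along its characteristics. -/
theorem eq_along_characteristic {T : ℝ} (hT : 0 < T) {Q : ℝ → ℝ → ℝ → ℝ}
    (hQ : ContDiffOn ℝ 1 (fun p : ℝ × ℝ × ℝ => Q p.1 p.2.1 p.2.2) (Icc 0 T ×ˢ Ioi 0 ×ˢ univ))
    (heq : ∀ t ∈ Icc 0 T, ∀ r > 0, ∀ z : ℝ,
      derivWithin (fun s => Q s r z) (Icc 0 T) t - 2 * Q t r z * deriv (fun ζ => Q t r ζ) z = 0)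
    {r : ℝ} (hr : 0 < r) (z : ℝ) : ∀ t ∈ Icc 0 T, Q t r (z - 2 * t * Q 0 r z) = Q 0 r z := by
  set q : ℝ × ℝ × ℝ → ℝ := fun p => Q p.1 p.2.1 p.2.2 with hq
  set S : Set (ℝ × ℝ × ℝ) := Icc 0 T ×ˢ Ioi 0 ×ˢ univ with hS
  set c := Q 0 r z with hc
  have hSu : UniqueDiffOn ℝ S := (uniqueDiffOn_Icc hT).prod
    ((uniqueDiffOn_Ioi 0).prod uniqueDiffOn_univ)
  have hmem : ∀ t ∈ Icc 0 T, ∀ ζ : ℝ, (t, r, ζ) ∈ S := fun t ht ζ => ⟨ht, hr, mem_univ _⟩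
  have hd : ∀ t ∈ Icc 0 T, ∀ ζ, HasFDerivWithinAt q (fderivWithin ℝ q S (t, r, ζ)) S (t, r, ζ) :=
    fun t ht ζ => (hQ.differentiableOn (by simp) _ (hmem t ht ζ)).hasFDerivWithinAt
  have ht' : ∀ t ∈ Icc 0 T, ∀ ζ,
      derivWithin (fun s => Q s r ζ) (Icc 0 T) t = fderivWithin ℝ q S (t, r, ζ) (1, 0, 0) :=
    fun t ht ζ => by
      have h1 : HasDerivWithinAt (fun s : ℝ => (s, r, ζ)) ((1 : ℝ), (0 : ℝ), (0 : ℝ)) (Icc 0 T) t :=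
        (hasDerivWithinAt_id t _).prodMk (hasDerivWithinAt_const t _ (r, ζ))
      exact ((hd t ht ζ).comp_hasDerivWithinAt t h1 fun s hs => hmem s hs ζ).derivWithin
        (uniqueDiffOn_Icc hT t ht)
  have hz' : ∀ t ∈ Icc 0 T, ∀ ζ,
      deriv (fun ξ => Q t r ξ) ζ = fderivWithin ℝ q S (t, r, ζ) (0, 0, 1) :=
    fun t ht ζ => by
      have h1 : HasDerivAt (fun s : ℝ => (t, r, s)) ((0 : ℝ), (0 : ℝ), (1 : ℝ)) ζ :=
        (hasDerivAt_const ζ t).prodMk ((hasDerivAt_const ζ r).prodMk (hasDerivAt_id ζ))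
      have h2 := (hd t ht ζ).comp_hasDerivWithinAt (s := univ) ζ h1.hasDerivWithinAt
        fun s _ => hmem t ht s
      exact (hasDerivWithinAt_univ.1 h2).deriv
  set γ : ℝ → ℝ × ℝ × ℝ := fun s => (s, r, z - 2 * s * c) with hγ
  have hγc : Continuous γ := by fun_prop
  have hcont : ContinuousOn (fun s => fderivWithin ℝ q S (γ s) (0, 0, 1)) (Icc 0 T) :=
    ((hQ.continuousOn_fderivWithin hSu (by simp)).clm_apply continuousOn_const).comp
      hγc.continuousOn fun s hs => hmem s hs _
  obtain ⟨M, hM⟩ := isCompact_Icc.exists_bound_of_continuousOn hcont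
  have hder : ∀ s ∈ Icc 0 T, HasDerivWithinAt (fun s => q (γ s) - c)
      (2 * (q (γ s) - c) * fderivWithin ℝ q S (γ s) (0, 0, 1)) (Icc 0 T) s := fun s hs => by
    have h1 : HasDerivAt γ ((1 : ℝ), (0 : ℝ), -(2 * c)) s := by
      refine (hasDerivAt_id s).prodMk ((hasDerivAt_const s r).prodMk ?_)
      simpa using (((hasDerivAt_id s).const_mul 2).mul_const c).const_sub z
    have h2 := ((hd s hs (z - 2 * s * c)).comp_hasDerivWithinAt (s := Icc 0 T) s
      h1.hasDerivWithinAt fun s hs => hmem s hs _).sub_const c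
    refine h2.congr_deriv ?_
    have h3 := heq s hs r hr (z - 2 * s * c)
    rw [ht' s hs, hz' s hs] at h3
    have e1 : ((1 : ℝ), (0 : ℝ), -(2 * c))
        = ((1 : ℝ), (0 : ℝ), (0 : ℝ)) + (-(2 * c)) • ((0 : ℝ), (0 : ℝ), (1 : ℝ)) := by simp
    rw [e1, map_add, map_smul, smul_eq_mul]
    change _ = 2 * (Q s r (z - 2 * s * c) - c) * fderivWithin ℝ q S (s, r, z - 2 * s * c) (0, 0, 1)
    linear_combination h3
  intro t ht
  -- On the straight line of slope fixed by the initial value, `q - c` solves a linear homogeneous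
  -- equation with bounded coefficient and starts at 0, so Gronwall applies.
  refine sub_eq_zero.1 (eq_zero_of_abs_deriv_le_mul_abs_self_of_eq_zero_right (K := 2 * M)
    (f := fun s => q (γ s) - c) (fun s hs => (hder s hs).continuousWithinAt)
    (fun s hs => (hder s ⟨hs.1, hs.2.le⟩).mono_of_mem_nhdsWithin (Icc_mem_nhdsGE_of_mem hs))
    (by simp [hγ, hq, hc]) (fun s hs => ?_) t ht)
  have h1 := hM s ⟨hs.1, hs.2.le⟩
  rw [norm_mul, norm_mul, Real.norm_ofNat]
  nlinarith [norm_nonneg (q (γ s) - c)]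

theorem contDiff_meridian : ContDiff ℝ 1 fun p : ℝ × ℝ => meridian p.1 p.2 := by
  rw [contDiff_euclidean]
  intro i
  fin_cases i
  · exact contDiff_fst
  · exact contDiff_const
  · exact contDiff_snd

theorem meridian_add (r z s : ℝ) : meridian r z + s • e 2 = meridian r (z + s) := by
  ext i; fin_cases i <;> simp [meridian]

/-- Burgers' equation for the transported coefficient. -/
theorem burgers_equation {L T : ℝ} (hT : 0 < T) {a : E3 → ℝ} (ha : ContDiff ℝ 1 a)
    (hs : ∀ t ∈ Icc 0 T, Slow L t a) {t : ℝ} (ht : t ∈ Icc 0 T) (r z : ℝ) :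
    derivWithin (fun s => burgers a s (meridian r z)) (Icc 0 T) t
      - 2 * burgers a t (meridian r z) * deriv (fun ζ => burgers a t (meridian r ζ)) z = 0 := by
  set y := meridian r z with hy
  set A : ℝ × E3 → ℝ := fun p => burgers a p.1 p.2 with hA
  have hd : HasFDerivAt A (fderiv ℝ A (t, y)) (t, y) :=
    (((hs t ht).contDiffAt (by simp) ha y).differentiableAt (by simp)).hasFDerivAt
  have h1 : derivWithin (fun s => burgers a s y) (Icc 0 T) t = fderiv ℝ A (t, y) (1, 0) := by
    have h2 := hd.comp_hasDerivAt t ((hasDerivAt_id t).prodMk (hasDerivAt_const t y))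
    exact h2.hasDerivWithinAt.derivWithin (uniqueDiffOn_Icc hT t ht)
  have h2 : deriv (fun ζ => burgers a t (meridian r ζ)) z = fderiv ℝ A (t, y) (0, e 2) := by
    have h3 : HasDerivAt (fun ζ => meridian r ζ) (e 2) z := by
      have h4 : (fun ζ => meridian r ζ) = fun ζ => meridian r 0 + ζ • e 2 := funext fun ζ => by
        rw [meridian_add, zero_add]
      rw [h4]
      simpa using ((hasDerivAt_id z).smul_const (e 2)).const_add (meridian r 0)
    exact (hd.comp_hasDerivAt z ((hasDerivAt_const z t).prodMk h3)).deriv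
  set c := burgers a t y with hc
  set x := y + (2 * t * c) • e 2 with hx
  have hax : a x = c := ((hs t ht).spec y).symm
  have hsh : shear t a x = y := (hs t ht).shear_burgers y
  have hpath : HasDerivAt (fun s => A (s, shear s a x)) (fderiv ℝ A (t, y) (1, -(2 * c) • e 2)) t := by
    have h3 : HasDerivAt (fun s => shear s a x) (-(2 * c) • e 2) t := by
      have := ((((hasDerivAt_id t).const_mul 2).mul_const (a x)).smul_const (e 2)).const_sub x
      simpa [shear, hax] using this
    rw [← hsh] at hd ⊢
    exact hd.comp_hasDerivAt t ((hasDerivAt_id t).prodMk h3)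
  -- `A` is constant on the characteristic through the point. Smallness is an open condition in
  -- time, so this holds on both sides of `t`, even at the endpoints.
  have hconst : (fun s => A (s, shear s a x)) =ᶠ[𝓝 t] fun _ => a x := by
    have : ∀ᶠ s in 𝓝 t, 4 * |s| * L < 1 :=
      (Continuous.tendsto (by fun_prop : Continuous fun s : ℝ => 4 * |s| * L) t).eventually_lt_const
        (hs t ht).small
    filter_upwards [this] with s hsL
    exact Slow.burgers_shear ⟨(hs t ht).diff, (hs t ht).slope, hsL⟩ x
  have h0 := hpath.unique ((hasDerivAt_const t (a x)).congr_of_eventuallyEq hconst)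
  have e1 : ((1 : ℝ), -(2 * c) • e 2) = ((1 : ℝ), (0 : E3)) + (-(2 * c)) • ((0 : ℝ), e 2) := by simp
  rw [e1, map_add, map_smul, smul_eq_mul] at h0
  rw [h1, h2]
  linear_combination h0

theorem contDiffOn_burgers {L T : ℝ} {a : E3 → ℝ} (ha : ContDiff ℝ 1 a)
    (hs : ∀ t ∈ Icc 0 T, Slow L t a) :
    ContDiffOn ℝ 1 (fun p : ℝ × ℝ × ℝ => burgers a p.1 (meridian p.2.1 p.2.2))
      (Icc 0 T ×ˢ Ioi 0 ×ˢ univ) := fun p hp =>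
  (ContDiffAt.comp (g := fun q : ℝ × E3 => burgers a q.1 q.2)
    (f := fun p : ℝ × ℝ × ℝ => (p.1, meridian p.2.1 p.2.2)) p
    ((hs p.1 hp.1).contDiffAt (by simp) ha (meridian p.2.1 p.2.2))
    (contDiff_fst.prodMk (contDiff_meridian.comp contDiff_snd)).contDiffAt).contDiffWithinAt

theorem isSolution_of_burgers {m : ℕ} {L T : ℝ} (hT : 0 < T) {a : E3 → ℝ} (ha : ContDiff ℝ 1 a)
    (hax : Axisym a) (hs : ∀ t ∈ Icc 0 T, Slow L t a) {u : ℝ → SobolevH m}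
    (huc : ContinuousOn u (Icc 0 T))
    (hu : ∀ t ∈ Icc 0 T, field (u t) =ᵐ[volume] fld (burgers a t)) : IsSolution T u where
  continuousOn := huc
  equation := ⟨fun t r z => burgers a t (meridian r z),
    fun t ht => ae_coeff (hax.burgers (hs t ht)) (hu t ht), contDiffOn_burgers ha hs,
    fun _ ht r _ z => burgers_equation hT ha hs ht r z⟩

theorem continuousOn_slice {T : ℝ} {Q : ℝ → ℝ → ℝ → ℝ}
    (hQ : ContinuousOn (fun p : ℝ × ℝ × ℝ => Q p.1 p.2.1 p.2.2) (Icc 0 T ×ˢ Ioi 0 ×ˢ univ))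
    {t : ℝ} (ht : t ∈ Icc 0 T) :
    ContinuousOn (fun p : ℝ × ℝ => Q t p.1 p.2) (Ioi 0 ×ˢ univ) :=
  hQ.comp (f := fun p : ℝ × ℝ => (t, p)) (by fun_prop) fun _ hp => ⟨ht, hp⟩

/-- Uniqueness, by comparison along the characteristics. -/
theorem IsSolution.field_eq {m : ℕ} {L T : ℝ} (hT : 0 < T) {a : E3 → ℝ} (ha : ContDiff ℝ 1 a)
    (hax : Axisym a) (hs : ∀ t ∈ Icc 0 T, Slow L t a) {v : ℝ → SobolevH m} (hv : IsSolution T v)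
    (h0 : field (v 0) =ᵐ[volume] fld a) {t : ℝ} (ht : t ∈ Icc 0 T) :
    field (v t) =ᵐ[volume] fld (burgers a t) := by
  obtain ⟨Q, hQ, hQc, heq⟩ := hv.equation
  have hT0 : (0 : ℝ) ∈ Icc 0 T := ⟨le_rfl, hT.le⟩
  have hinit : ∀ r > 0, ∀ z, Q 0 r z = a (meridian r z) := fun r hr z =>
    coeff_eq (P := Q 0) (Q := fun r z => a (meridian r z)) (hQ 0 hT0) (ae_coeff hax h0)
      (continuousOn_slice hQc.continuousOn hT0)
      (ha.continuous.comp contDiff_meridian.continuous).continuousOn hr z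
  have hval : ∀ r > 0, ∀ z, Q t r z = burgers a t (meridian r z) := fun r hr z => by
    have hsp := (hs t ht).spec (meridian r z)
    set s := burgers a t (meridian r z) with hsdef
    rw [meridian_add, ← hinit r hr] at hsp
    -- The line issued from height `z + 2 t s`, where the initial value is `s`, arrives at height
    -- `z` at time `t`.
    have := eq_along_characteristic hT hQc heq hr (z + 2 * t * s) t ht
    rw [← hsp] at this
    simpa using this
  refine (hQ t ht).trans (Eventually.of_forall fun x => ?_)
  by_cases hx : dTheta x = 0
  · simp [fld, hx]
  · have hr : 0 < cylRadius x := by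
      refine lt_of_le_of_ne (Real.sqrt_nonneg _) fun h => hx ?_
      have := (Real.sqrt_eq_zero (by positivity)).1 h.symm
      have hx0 : x 0 = 0 := by nlinarith [sq_nonneg (x 0), sq_nonneg (x 1)]
      have hx1 : x 1 = 0 := by nlinarith [sq_nonneg (x 0), sq_nonneg (x 1)]
      ext i; fin_cases i <;> simp [dTheta, hx0, hx1]
    simp only [fld]
    rw [hval _ hr, ← (hax.burgers (hs t ht)).eq_meridian x]

/-- The existence time for data of size `K`. -/
theorem exists_time {m : ℕ} (hm : 4 ≤ m) {K : ℝ} (hK : 0 ≤ K) : ∃ C L T : ℝ, Consts m K C ∧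
    0 < T ∧ T ≤ 1 ∧ 4 * T * L < 1 ∧ 8 * (Fintype.card (DerivIndex m)) * (T * C) ^ 2 ≤ 1 ∧
    ∀ a, Test a → HB m a K → Cls m K L L a := by
  obtain ⟨C, hC⟩ := exists_consts hm hK
  obtain ⟨Cb, hCb, hbase⟩ := exists_bd_base m
  have hC0 := hC.nonneg
  have hL : 0 ≤ Cb * K := mul_nonneg hCb hK
  set n : ℝ := ((Fintype.card (DerivIndex m) : ℕ) : ℝ) with hn
  have hn0 : 0 ≤ n := Nat.cast_nonneg _
  have hnC : 0 ≤ n * C := mul_nonneg hn0 hC0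
  have hX : 0 < 2 + 4 * (Cb * K) + 8 * (n * C) + C := by positivity
  -- One summand of the denominator for each constraint on `T`; the 2 gives the strict inequality in
  -- `4 T L < 1`. The same `Cb * K` bounds slope and sup.
  refine ⟨C, Cb * K, 1 / (2 + 4 * (Cb * K) + 8 * (n * C) + C), hC, by positivity, ?_, ?_, ?_, ?_⟩
  · rw [div_le_one hX]; linarith
  · rw [mul_one_div, div_mul_eq_mul_div, div_lt_one hX]; linarith
  · have h1 : 1 / (2 + 4 * (Cb * K) + 8 * (n * C) + C) * C ≤ 1 := by
      rw [one_div_mul_eq_div, div_le_one hX]; linarith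
    have h2 : 8 * n * (1 / (2 + 4 * (Cb * K) + 8 * (n * C) + C) * C) ≤ 1 := by
      rw [one_div_mul_eq_div, mul_div_assoc', div_le_one hX]; linarith
    have h3 : 0 ≤ 1 / (2 + 4 * (Cb * K) + 8 * (n * C) + C) * C := by positivity
    rw [sq, ← mul_assoc]
    exact mul_le_one₀ h2 h3 h1
  · intro a ha hB
    obtain ⟨h1, h2⟩ := hbase a K ha hK hB
    exact ⟨ha, hB, (h1 2 []).sup hm, h2 (by omega)⟩

/-- The limit in `H^m` of the approximate solutions is identified pointwise: coefficients converge
uniformly, hence so do the roots of the implicit equation, and the `C¹` limit inherits the slope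
bound. -/
theorem exists_solution {m : ℕ} (hm : 4 ≤ m) {K C L T : ℝ} (hC : Consts m K C) (hT : 0 < T)
    (hT1 : T ≤ 1) (hTL : 4 * T * L < 1)
    (hTC : 8 * (Fintype.card (DerivIndex m)) * (T * C) ^ 2 ≤ 1)
    (hcls : ∀ a, Test a → HB m a K → Cls m K L L a) {u₀ : SobolevH m} (hu₀ : ‖u₀‖ < K)
    {P₀ : ℝ → ℝ → ℝ} (hP₀ : HasCoeff u₀ P₀) :
    ∃ u : ℝ → SobolevH m, (IsSolution T u ∧ u 0 = u₀) ∧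
      (∀ v : ℝ → SobolevH m, IsSolution T v ∧ v 0 = u₀ → EqOn v u (Icc 0 T)) ∧
      ∀ t ∈ Icc 0 T, ‖u t‖ ≤ 3 * ‖u₀‖ := by
  obtain ⟨b, hb, hblim⟩ := exists_test_approx hP₀
  -- The strict inequality leaves room for the approximants to have norm at most `K` from some index
  -- on.
  obtain ⟨k₀, hk₀⟩ := eventually_atTop.1 (hblim.norm.eventually_le_const hu₀)
  set a : ℕ → E3 → ℝ := fun k => b (k + k₀) with ha
  have hac : ∀ k, Cls m K L L (a k) := fun k => hcls _ (hb _) fun w hw =>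
    (eLpNorm_Dw_le (hb _).fld w hw).trans (ENNReal.ofReal_le_ofReal (hk₀ _ (by omega)))
  have hlim : Tendsto (fun k => toSob m (hac k).test.fld) atTop (𝓝 u₀) :=
    hblim.comp (tendsto_add_atTop_nat k₀)
  have hT0 : (0 : ℝ) ∈ Icc 0 T := ⟨le_rfl, hT.le⟩
  have hsmall : ∀ t ∈ Icc 0 T, 4 * |t| * L < 1 := fun t ht => by
    have hL : 0 ≤ L := (abs_nonneg _).trans ((hac 0).slope 0)
    rw [abs_of_nonneg ht.1]; nlinarith [ht.2]
  obtain ⟨u, huc, hu0, hub, hul⟩ := exists_limit_sol hm hC hT.le hT1 hTL hTC hac hlim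
  obtain ⟨a₀, ha₀, hunif, hfd⟩ := exists_C1_limit hm (fun k => (hac k).test) hlim.cauchySeq
  have hs : ∀ t ∈ Icc 0 T, Slow L t a₀ := fun t ht => ⟨ha₀.differentiable (by simp),
    fun x => le_of_tendsto' (((ContinuousLinearMap.apply ℝ ℝ (e 2)).continuous.tendsto _).comp
      (hfd x)).abs fun k => (hac k).slope x, hsmall t ht⟩
  have hfield : ∀ t ∈ Icc 0 T, field (u t) =ᵐ[volume] fld (burgers a₀ t) := fun t ht => by
    refine field_ae_eq_of_tendsto (hul t ht) (f := fun k => fld (burgers (a k) t)) (fun k => ?_)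
      fun y => ?_
    · rw [((hac k).slow (hsmall t ht)).sol_eq (hac k).test]
      exact field_toSob _
    · refine Tendsto.smul_const ?_ _
      rw [Metric.tendsto_atTop]
      intro ε hε
      obtain ⟨k₁, hk₁⟩ := eventually_atTop.1
        (Metric.tendstoUniformly_iff.1 hunif (ε / 3) (by positivity))
      refine ⟨k₁, fun k hk => ?_⟩
      have := ((hac k).slow (hsmall t ht)).sub_le (hs t ht) (δ := ε / 3) (fun x => by
        have := (hk₁ k hk x).le
        rwa [dist_comm, Real.dist_eq] at this) y
      rw [Real.dist_eq]
      linarith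
  have h0 : field u₀ =ᵐ[volume] fld a₀ := by
    have := hfield 0 hT0
    rwa [hu0, burgers_zero (hs 0 hT0)] at this
  have hax : Axisym a₀ := axisym_of_ae hP₀ ha₀.continuous h0
  refine ⟨u, ⟨isSolution_of_burgers hT ha₀ hax hs huc hfield, hu0⟩, fun v hv t ht => ?_, hub⟩
  exact sobolevH_ext ((hv.1.field_eq hT ha₀ hax hs (hv.2.symm ▸ h0) ht).trans (hfield t ht).symm)

end

end AxisymEMHD

end

theorem mainTheorem5 :
    ∃ C : ℝ, 0 < C ∧ ∀ m : ℕ, 4 ≤ m →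
      ∃ T₀ : ℝ → ℝ, (∀ N : ℝ, 0 < T₀ N) ∧
        ∀ u₀ : AxisymEMHD.SobolevH m,
          (∃ P₀ : ℝ → ℝ → ℝ, AxisymEMHD.HasCoeff u₀ P₀) →
          ∃ u : ℝ → AxisymEMHD.SobolevH m,
            (AxisymEMHD.IsSolution (T₀ ‖u₀‖) u ∧ u 0 = u₀) ∧
            (∀ v : ℝ → AxisymEMHD.SobolevH m,
              AxisymEMHD.IsSolution (T₀ ‖u₀‖) v ∧ v 0 = u₀ →
                Set.EqOn v u (Set.Icc 0 (T₀ ‖u₀‖))) ∧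
            (∀ t ∈ Set.Icc (0 : ℝ) (T₀ ‖u₀‖), ‖u t‖ ≤ C * ‖u₀‖) := by
  refine ⟨3, by norm_num, fun m hm => ?_⟩
  -- The shift by 1 makes `K` exceed the norm of the data strictly; the absolute value gives a time
  -- for every real `N`.
  choose C L T h using fun N : ℝ =>
    AxisymEMHD.exists_time hm (K := |N| + 1) (by positivity)
  refine ⟨T, fun N => (h N).2.1, fun u₀ ⟨P₀, hP₀⟩ => ?_⟩
  obtain ⟨hC, hT, hT1, hTL, hTC, hcls⟩ := h ‖u₀‖
  exact AxisymEMHD.exists_solution hm hC hT hT1 hTL hTC hcls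
    (by rw [abs_norm]; linarith) hP₀
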